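/- Fix $n\ge 3$, nonzero $q,d\in\mathbb C$, and put $q_1=d/q$, $q_2=q^2$, $q_3=1/(dq)$. Assume that $q_1,q_2,q_3$ are generic: $q_1^aq_2^bq_3^c=1$ with $a,b,c\in\mathbb Z$ only if $a=b=c$. Let $\mathcal E_n=\mathcal E_n(q,d)$ be the quantum toroidal algebra of type $\mathfrak{gl}_n$ at $q^{c/2}=1$, with generators $E_{i,m},F_{i,m}$ ($m\in\mathbb Z$), $H_{i,l}$ ($l\in\mathbb Z\setminus\{0\}$), $K_i^{\pm1}$, $i\in\mathbb Z/n$, and currents $E_i(z)=\sum_m E_{i,m}z^{-m}$, $F_i(z)=\sum_m F_{i,m}z^{-m}$, $K_i^\pm(z)=K_i^{\pm1}\exp(\pm(q-q^{-1})\sum_{l\ge1}H_{i,\pm l}z^{\mp l})$. Let $\delta(z)=\sum_{m\in\mathbb Z}z^m$, let $a_{ij}$ be the Cartan matrix of type $A^{(1)}_{n-1}$, and let $m_{i-1,i}=-1$, $m_{i,i-1}=1$ and $m_{ij}=0$ otherwise (indices modulo $n$). The defining relations are: $K_iK_i^{-1}=K_i^{-1}K_i=1$; all coefficients of the series $K_i^\pm(z)$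 commute; with $a=a_{ij}$, $m=m_{ij}$, $$(q^{a}w-d^{m}z)K_i^\pm(z)E_j(w)=(w-d^{m}q^{a}z)E_j(w)K_i^\pm(z),\quad (w-d^{m}q^{a}z)K_i^\pm(z)F_j(w)=(q^{a}w-d^{m}z)F_j(w)K_i^\pm(z),$$ $$[E_i(z),F_j(w)]=\tfrac{\delta_{ij}}{q-q^{-1}}\bigl(\delta(w/z)K_i^+(w)-\delta(z/w)K_i^-(z)\bigr),$$ $$(d^{m}z-q^{a}w)E_i(z)E_j(w)=(d^{m}q^{a}z-w)E_j(w)E_i(z),\quad (d^{m}z-q^{-a}w)F_i(z)F_j(w)=(d^{m}q^{-a}z-w)F_j(w)F_i(z);$$ for $X=E$ and $X=F$, $X_i(z_1)X_i(z_2)X_{i\pm1}(w)-(q+q^{-1})X_i(z_1)X_{i\pm1}(w)X_i(z_2)+X_{i\pm1}(w)X_i(z_1)X_i(z_2)+(z_1\leftrightarrow z_2)=0$, and $[X_i(z),X_j(w)]=0$ if $j\ne i,i\pm1$. Put $\psi(z)=(q-q^{-1}z)/(1-z)$. Fix $k\in\mathbb Z/n$ and $u,K\in\mathbb C^\times$;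 $\equiv$ is congruence modulo $n$. **Fock modules.** $\mathcal F^{(k)}(u)$ has basis $|\lambda\rangle$, $\lambda=(\lambda_1\ge\lambda_2\ge\cdots)$ a partition. The nonzero matrix elements are, for $i+\lambda_j\equiv j+k-1$ and $\lambda+\mathbf 1_j$ (that is, $\lambda$ with $\lambda_j$ increased by one) a partition, $$\langle\lambda+\mathbf 1_j|E_i(z)|\lambda\rangle=\prod_{s<j,\ \lambda_s+i\equiv s+k}\psi(q_1^{\lambda_s-\lambda_j-1}q_3^{s-j})\prod_{s<j,\ \lambda_s+i+1\equiv s+k}\psi(q_1^{\lambda_j-\lambda_s}q_3^{j-s})\;\delta(q_1^{\lambda_j}q_3^{j-1}u/z),$$ $\langle\lambda|F_i(z)|\lambda+\mathbf 1_j\rangle$, given by the same expression with $s>j$ instead of $s<j$, and $$\langle\lambda|K_i(z)|\lambda\rangle=\prod_{s\ge1,\ \lambda_s+i\equiv s+k}\psi(q_1^{\lambda_s-1}q_3^{s-1}u/z)\prod_{s\ge1,\ \lambda_s+i+1\equiv s+k}\psi(q_1^{\lambda_s-1}q_3^{s-2}u/z)^{-1}.$$ Infinite products are finite after cancellation: the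 factors with $s\ge r$ are omitted for an $r$ with $\lambda_r=0$, $i\equiv r+k$ (and $r>j$ for $F_i$). $K_i^+(z)$ and $K_i^-(z)$ are the expansions of the rational function $K_i(z)$ at $z=\infty$ and $z=0$. **Macmahon space.** $\mathcal M^{(k)}(u)$ is the vector space with basis $|\boldsymbol\lambda\rangle=|\lambda^{(1)}\rangle\otimes|\lambda^{(2)}\rangle\otimes\cdots$, where $\boldsymbol\lambda$ runs over plane partitions: sequences of partitions, only finitely many nonempty, with $\lambda^{(p)}_j\ge\lambda^{(p+1)}_j$ for all $p,j$. If $\lambda^{(p)}=\emptyset$ for all $p>r$, then the currents act on $|\boldsymbol\lambda\rangle$ as on $|\lambda^{(1)}\rangle\otimes\cdots\otimes|\lambda^{(r)}\rangle$ in $\mathcal F^{(k)}(u)\otimes\mathcal F^{(k)}(uq_2)\otimes\cdots\otimes\mathcal F^{(k)}(uq_2^{r-1})$, with respect to $$\Delta K_i^\pm(z)=K_i^\pm(z)\otimes K_i^\pm(z),\quad \Delta E_i(z)=E_i(z)\otimes1+K_i^-(z)\otimes E_i(z),\quad \Delta F_i(z)=F_i(z)\otimes K_i^+(z)+1\otimes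 F_i(z),$$ where only terms adding a box to, or removing a box from, $\boldsymbol\lambda$ so that the result is a plane partition occur ($E_i$ may also add a box to the first empty layer), and rational functions multiplied by $\delta(a/z)$ are evaluated at $z=a$; moreover the actions of $K_k^\pm(z)$ and $F_k(z)$ are multiplied by $$f_r(z)=\frac{K^{-1}-Ku/z}{q^{-r}-q^{r}u/z}.$$ **Theorem.** (1) These formulas do not depend on $r$ and define a unique $\mathcal E_n$-module structure on $\mathcal M^{(k)}(u)$. (2) Suppose that $K$ is generic in the sense that $K^2\ne q_3^xq_1^yq_2^w$ for all integers $x,y,w\ge1$ with $x\equiv y$ (for example, $K^2\notin q_1^{\mathbb Z}q_2^{\mathbb Z}$). Then this module is * irreducible; * tame: the commuting series $K_i^\pm(z)$, $i\in\mathbb Z/n$, are diagonalizable with simple joint spectrum; * a lowest weight module: the vector $|\boldsymbol\emptyset\rangle$ of the empty plane partition generates it, is annihilated by all $F_{i,m}$, and satisfies $K_i^\pm(z)|\boldsymbol\emptyset\rangle=\phi_i^\pm(z)|\boldsymbol\emptyset\rangle$, where $\phi_i^+$ and $\phi_i^-$ are the expansions at $z=\infty$ and $z=0$ of $\phi_i(z)=\left(\frac{K^{-1}-Ku/z}{1-u/z}\right)^{\delta_{ik}}$;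 * $\mathbb Z^n$-graded, with $\deg E_{i,m}=1_i$, $\deg F_{i,m}=-1_i$, $\deg H_{i,l}=\deg K_i^{\pm1}=0$, and $|\boldsymbol\lambda\rangle$ in the degree whose $i$-th component is the number of boxes of color $i$ (the $y$-th box of the $x$-th row of a layer has color $k+x-y$ modulo $n$); * of level $K$: $\prod_iK_i^{-1}$ acts as the scalar $K$. -/

import Mathlib

noncomputable section

namespace QuantumToroidal

/-! ## The algebra `E_n(q, d)` -/

/-- `q₁ = d / q`. -/
def q1 (q d : ℂ) : ℂ := d / q

/-- `q₂ = q ^ 2`. -/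
def q2 (q : ℂ) : ℂ := q ^ 2

/-- `q₃ = 1 / (d q)`. -/
def q3 (q d : ℂ) : ℂ := 1 / (d * q)

/-- `q₁, q₂, q₃` are generic: the only multiplicative relations between them are the powers of
`q₁ q₂ q₃ = 1`. -/
def GenericParameters (q d : ℂ) : Prop :=
  ∀ a b c : ℤ, q1 q d ^ a * q2 q ^ b * q3 q d ^ c = 1 → a = b ∧ b = c

/-- The Cartan matrix of type `A_{n-1}^{(1)}`, for `n ≥ 3`. -/
def cartan {n : ℕ} (i j : ZMod n) : ℤ :=
  if i = j then 2 else if j = i + 1 ∨ i = j + 1 then -1 else 0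

/-- The matrix with `m_{i-1,i} = -1`, `m_{i,i-1} = 1` and other entries zero, for `n ≥ 3`. -/
def mMat {n : ℕ} (i j : ZMod n) : ℤ :=
  if j = i + 1 then -1 else if i = j + 1 then 1 else 0

/-- Generators `E_{i,m}`, `F_{i,m}` (`m ∈ ℤ`), `H_{i,l}` (`l ∈ ℤ`, `l ≠ 0`), `K_i`, `K_i⁻¹`. -/
inductive Gen (n : ℕ) : Type
  | E (i : ZMod n) (m : ℤ)
  | F (i : ZMod n) (m : ℤ)
  | H (i : ZMod n) (l : ℤ) (hl : l ≠ 0)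
  | K (i : ZMod n)
  | Kinv (i : ZMod n)

/-- The free algebra on the generators. -/
abbrev FreeGen (n : ℕ) : Type := FreeAlgebra ℂ (Gen n)

/-- The coefficient of `T ^ m` in `exp (X(T))`, for a power series `X` without constant term
(so that `X ^ j` does not contribute for `j > m`). -/
def expCoeff {A : Type*} [Ring A] [Algebra ℂ A] (X : PowerSeries A) (m : ℕ) : A :=
  PowerSeries.coeff m (∑ j ∈ Finset.range (m + 1), ((j.factorial : ℂ)⁻¹) • X ^ j)

/-- The generators in the free algebra. -/
def fE {n : ℕ} (i : ZMod n) (m : ℤ) : FreeGen n := FreeAlgebra.ι ℂ (Gen.E i m)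

def fF {n : ℕ} (i : ZMod n) (m : ℤ) : FreeGen n := FreeAlgebra.ι ℂ (Gen.F i m)

def fK {n : ℕ} (i : ZMod n) : FreeGen n := FreeAlgebra.ι ℂ (Gen.K i)

def fKinv {n : ℕ} (i : ZMod n) : FreeGen n := FreeAlgebra.ι ℂ (Gen.Kinv i)

def fH {n : ℕ} (i : ZMod n) (l : ℤ) (hl : l ≠ 0) : FreeGen n := FreeAlgebra.ι ℂ (Gen.H i l hl)

/-- `(q - q⁻¹) ∑_{l ≥ 1} H_{i,l} T ^ l`, where `T = z⁻¹`. -/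
def hPlus {n : ℕ} (q : ℂ) (i : ZMod n) : PowerSeries (FreeGen n) :=
  PowerSeries.mk fun l =>
    if h : l = 0 then 0 else (q - q⁻¹) • fH i (l : ℤ) (Int.natCast_ne_zero.mpr h)

/-- `-(q - q⁻¹) ∑_{l ≥ 1} H_{i,-l} T ^ l`, where `T = z`. -/
def hMinus {n : ℕ} (q : ℂ) (i : ZMod n) : PowerSeries (FreeGen n) :=
  PowerSeries.mk fun l =>
    if h : l = 0 then 0
    else (-(q - q⁻¹)) • fH i (-(l : ℤ)) (neg_ne_zero.mpr (Int.natCast_ne_zero.mpr h))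

/-- The coefficient of `z ^ (-r)` in
`K_i^+(z) = K_i exp((q - q⁻¹) ∑_{l ≥ 1} H_{i,l} z ^ (-l))`. -/
def fKplus {n : ℕ} (q : ℂ) (i : ZMod n) (r : ℤ) : FreeGen n :=
  if 0 ≤ r then fK i * expCoeff (hPlus q i) r.toNat else 0

/-- The coefficient of `z ^ (-r)` in
`K_i^-(z) = K_i⁻¹ exp(-(q - q⁻¹) ∑_{l ≥ 1} H_{i,-l} z ^ l)`. -/
def fKminus {n : ℕ} (q : ℂ) (i : ZMod n) (r : ℤ) : FreeGen n :=
  if r ≤ 0 then fKinv i * expCoeff (hMinus q i) (-r).toNat else 0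

/-- The cubic Serre expression for a current `X_i` (with itself and a neighbouring `X_j`),
before symmetrization: the coefficient of `z₁ ^ (-r₁) z₂ ^ (-r₂) w ^ (-s)` in
`X_i(z₁)X_i(z₂)X_j(w) - (q + q⁻¹) X_i(z₁)X_j(w)X_i(z₂) + X_j(w)X_i(z₁)X_i(z₂)`. -/
def serre {n : ℕ} (q : ℂ) (X : ZMod n → ℤ → FreeGen n) (i j : ZMod n) (r₁ r₂ s : ℤ) :
    FreeGen n :=
  X i r₁ * X i r₂ * X j s - (q + q⁻¹) • (X i r₁ * X j s * X i r₂) + X j s * X i r₁ * X i r₂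

/-- The defining relations of `E_n(q, d)` (with `q^{c/2} = 1`), written for the coefficients of
`z ^ (-r) w ^ (-s)` in the identities between currents. -/
inductive Rel (n : ℕ) (q d : ℂ) : FreeGen n → FreeGen n → Prop
  | K_mul_Kinv (i : ZMod n) : Rel n q d (fK i * fKinv i) 1
  | Kinv_mul_K (i : ZMod n) : Rel n q d (fKinv i * fK i) 1
  | KpKp (i j : ZMod n) (r s : ℤ) :
      Rel n q d (fKplus q i r * fKplus q j s) (fKplus q j s * fKplus q i r)
  | KmKm (i j : ZMod n) (r s : ℤ) :
      Rel n q d (fKminus q i r * fKminus q j s) (fKminus q j s * fKminus q i r)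
  | KmKp (i j : ZMod n) (r s : ℤ) :
      Rel n q d (fKminus q i r * fKplus q j s) (fKplus q j s * fKminus q i r)
  /-- `(q^a w - d^m z) K_i^+(z) E_j(w) = (w - d^m q^a z) E_j(w) K_i^+(z)` -/
  | KpE (i j : ZMod n) (r s : ℤ) :
      Rel n q d
        (q ^ cartan i j • (fKplus q i r * fE j (s + 1))
          - d ^ mMat i j • (fKplus q i (r + 1) * fE j s))
        (fE j (s + 1) * fKplus q i r
          - (d ^ mMat i j * q ^ cartan i j) • (fE j s * fKplus q i (r + 1)))
  | KmE (i j : ZMod n) (r s : ℤ) :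
      Rel n q d
        (q ^ cartan i j • (fKminus q i r * fE j (s + 1))
          - d ^ mMat i j • (fKminus q i (r + 1) * fE j s))
        (fE j (s + 1) * fKminus q i r
          - (d ^ mMat i j * q ^ cartan i j) • (fE j s * fKminus q i (r + 1)))
  /-- `(w - d^m q^a z) K_i^+(z) F_j(w) = (q^a w - d^m z) F_j(w) K_i^+(z)` -/
  | KpF (i j : ZMod n) (r s : ℤ) :
      Rel n q d
        (fKplus q i r * fF j (s + 1)
          - (d ^ mMat i j * q ^ cartan i j) • (fKplus q i (r + 1) * fF j s))
        (q ^ cartan i j • (fF j (s + 1) * fKplus q i r)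
          - d ^ mMat i j • (fF j s * fKplus q i (r + 1)))
  | KmF (i j : ZMod n) (r s : ℤ) :
      Rel n q d
        (fKminus q i r * fF j (s + 1)
          - (d ^ mMat i j * q ^ cartan i j) • (fKminus q i (r + 1) * fF j s))
        (q ^ cartan i j • (fF j (s + 1) * fKminus q i r)
          - d ^ mMat i j • (fF j s * fKminus q i (r + 1)))
  /-- `[E_i(z), F_i(w)] = (q - q⁻¹)⁻¹ (δ(w/z) K_i^+(w) - δ(z/w) K_i^-(z))` -/
  | EF_same (i : ZMod n) (r s : ℤ) :
      Rel n q d (fE i r * fF i s - fF i s * fE i r)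
        ((q - q⁻¹)⁻¹ • (fKplus q i (r + s) - fKminus q i (r + s)))
  | EF_diff (i j : ZMod n) (h : i ≠ j) (r s : ℤ) :
      Rel n q d (fE i r * fF j s - fF j s * fE i r) 0
  /-- `(d^m z - q^a w) E_i(z) E_j(w) = (d^m q^a z - w) E_j(w) E_i(z)` -/
  | EE (i j : ZMod n) (r s : ℤ) :
      Rel n q d
        (d ^ mMat i j • (fE i (r + 1) * fE j s) - q ^ cartan i j • (fE i r * fE j (s + 1)))
        ((d ^ mMat i j * q ^ cartan i j) • (fE j s * fE i (r + 1)) - fE j (s + 1) * fE i r)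
  /-- `(d^m z - q^{-a} w) F_i(z) F_j(w) = (d^m q^{-a} z - w) F_j(w) F_i(z)` -/
  | FF (i j : ZMod n) (r s : ℤ) :
      Rel n q d
        (d ^ mMat i j • (fF i (r + 1) * fF j s) - q ^ (-cartan i j) • (fF i r * fF j (s + 1)))
        ((d ^ mMat i j * q ^ (-cartan i j)) • (fF j s * fF i (r + 1)) - fF j (s + 1) * fF i r)
  | serreE (i j : ZMod n) (h : j = i + 1 ∨ j = i - 1) (r₁ r₂ s : ℤ) :
      Rel n q d (serre q fE i j r₁ r₂ s + serre q fE i j r₂ r₁ s) 0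
  | serreF (i j : ZMod n) (h : j = i + 1 ∨ j = i - 1) (r₁ r₂ s : ℤ) :
      Rel n q d (serre q fF i j r₁ r₂ s + serre q fF i j r₂ r₁ s) 0
  | commE (i j : ZMod n) (h : i ≠ j ∧ i ≠ j + 1 ∧ i ≠ j - 1) (r s : ℤ) :
      Rel n q d (fE i r * fE j s) (fE j s * fE i r)
  | commF (i j : ZMod n) (h : i ≠ j ∧ i ≠ j + 1 ∧ i ≠ j - 1) (r s : ℤ) :
      Rel n q d (fF i r * fF j s) (fF j s * fF i r)

/-- The quantum toroidal algebra `E_n = E_n(q, d)` of type `gl_n` (with `q^{c/2} = 1`). -/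
abbrev Toroidal (n : ℕ) (q d : ℂ) : Type := RingQuot (Rel n q d)

/-- The quotient map from the free algebra. -/
def mk (n : ℕ) (q d : ℂ) : FreeGen n →ₐ[ℂ] Toroidal n q d := RingQuot.mkAlgHom ℂ (Rel n q d)

/-! ## Modules over `E_n` -/

section Modules

variable {n : ℕ} {q d : ℂ} {V : Type*} [AddCommGroup V] [Module ℂ V]

/-- The `E_n`-module given by `ρ` is irreducible. -/
def IsIrreducibleAction (ρ : Toroidal n q d →ₐ[ℂ] Module.End ℂ V) : Prop :=
  @IsSimpleModule (Toroidal n q d) _ V _ (Module.compHom V ρ.toRingHom)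

/-- A pair of families of formal series `φ_i^±(z)`: `φ.1 i r` and `φ.2 i r` are the coefficients
of `z ^ (-r)` in `φ_i^+(z)` and `φ_i^-(z)`. -/
abbrev Weight (n : ℕ) : Type := (ZMod n → ℤ → ℂ) × (ZMod n → ℤ → ℂ)

/-- The space of vectors `v` with `K_i^±(z) v = φ_i^±(z) v` for all `i`. -/
def weightSpace (ρ : Toroidal n q d →ₐ[ℂ] Module.End ℂ V) (φ : Weight n) : Submodule ℂ V :=
  ⨅ (i : ZMod n) (r : ℤ),
    (ρ (mk n q d (fKplus q i r))).eigenspace (φ.1 i r) ⊓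
      (ρ (mk n q d (fKminus q i r))).eigenspace (φ.2 i r)

/-- The series `K_i^±(z)` are (simultaneously) diagonalizable. -/
def IsWeighted (ρ : Toroidal n q d →ₐ[ℂ] Module.End ℂ V) : Prop :=
  (⨆ φ : Weight n, weightSpace ρ φ) = ⊤

/-- The series `K_i^±(z)` are diagonalizable and their joint spectrum is simple. -/
def IsTame (ρ : Toroidal n q d →ₐ[ℂ] Module.End ℂ V) : Prop :=
  IsWeighted ρ ∧ ∀ φ : Weight n, Module.rank ℂ (weightSpace ρ φ) ≤ 1

/-- `v` is a lowest weight vector of weight `φ`: a singular vector of weight `φ` which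
generates the module. -/
def IsLowestWeightVector (ρ : Toroidal n q d →ₐ[ℂ] Module.End ℂ V) (φ : Weight n) (v : V) :
    Prop :=
  (∀ (i : ZMod n) (m : ℤ), ρ (mk n q d (fF i m)) v = 0) ∧ v ∈ weightSpace ρ φ ∧
    Submodule.span ℂ (Set.range fun x : Toroidal n q d => ρ x v) = ⊤

/-- `κ⁻¹ = ∏_i K_i⁻¹` (the factors commute). -/
def kappaInv (n : ℕ) (q d : ℂ) : Toroidal n q d :=
  ((List.range n).map fun j : ℕ => mk n q d (fKinv (j : ZMod n))).prod

/-- The central element `κ⁻¹` acts by the constant `K`. -/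
def HasLevel (ρ : Toroidal n q d →ₐ[ℂ] Module.End ℂ V) (K : ℂ) : Prop :=
  ∀ v : V, ρ (kappaInv n q d) v = K • v

/-- The degree in `ℤ ^ n` of a generator. -/
def genDegree : Gen n → (ZMod n → ℤ)
  | Gen.E i _ => Pi.single i 1
  | Gen.F i _ => -Pi.single i 1
  | Gen.H _ _ _ => 0
  | Gen.K _ => 0
  | Gen.Kinv _ => 0

/-- The subspaces `V_α`, `α ∈ ℤ ^ n`, make `V` a `ℤ ^ n`-graded module. -/
def IsGradedBy (ρ : Toroidal n q d →ₐ[ℂ] Module.End ℂ V)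
    (W : (ZMod n → ℤ) → Submodule ℂ V) : Prop :=
  iSupIndep W ∧ (⨆ α, W α) = ⊤ ∧
    ∀ (g : Gen n) (α : ZMod n → ℤ), ∀ v ∈ W α,
      ρ (mk n q d (FreeAlgebra.ι ℂ g)) v ∈ W (α + genDegree g)

end Modules

/-! ## Expansions of rational functions of `z` -/

/-- The coefficient of `z ^ (-r)` in the expansion of `R(z)` at `z = ∞`
(a Laurent series in `T = z⁻¹`). -/
def expandInf (R : RatFunc ℂ) (r : ℤ) : ℂ :=
  (R.eval (HahnSeries.C : ℂ →+* LaurentSeries ℂ) (HahnSeries.single (-1 : ℤ) (1 : ℂ))).coeff r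

/-- The coefficient of `z ^ (-r)` in the expansion of `R(z)` at `z = 0`. -/
def expandZero (R : RatFunc ℂ) (r : ℤ) : ℂ :=
  (R.eval (HahnSeries.C : ℂ →+* LaurentSeries ℂ) (HahnSeries.single (1 : ℤ) (1 : ℂ))).coeff (-r)

/-- The value `R(a)`. A rational function is evaluated in lowest terms. -/
def evalAt (R : RatFunc ℂ) (a : ℂ) : ℂ := R.eval (RingHom.id ℂ) a

/-- The weight `φ^±` given by the expansions of rational functions at `∞` and at `0`. -/
def ratWeight {n : ℕ} (R : ZMod n → RatFunc ℂ) : Weight n :=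
  (fun i r => expandInf (R i) r, fun i r => expandZero (R i) r)

/-- `ψ(x) = (q - q⁻¹ x) / (1 - x)` in a field. -/
def psi {F : Type*} [Field F] (q x : F) : F := (q - q⁻¹ * x) / (1 - x)

/-- `ψ(c / z)` as a rational function of `z`. -/
def psiZ (q c : ℂ) : RatFunc ℂ := psi (RatFunc.C q) (RatFunc.C c / RatFunc.X)

/-! ## The Fock module `F^{(k)}(u)`

A partition is a function `lam : ℕ → ℕ`; rows are numbered from `0`, so that `lam s` is the part
which is usually denoted `λ_{s+1}`. The products over all rows are finite after cancellation: if
`λ_N = 0` (rows from `0`) and `i ≡ N + 1 + k`, then the factors of the rows from `N` on cancel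
in pairs. -/

/-- The first row from `a` on after which all factors cancel. -/
def fockCut {n : ℕ} (k i : ZMod n) (lam : ℕ → ℕ) (a : ℕ) : ℕ :=
  sInf {N : ℕ | a ≤ N ∧ lam N = 0 ∧ i = ((N + 1 : ℕ) : ZMod n) + k}

/-- The eigenvalue of `K_i(z)` on `|λ⟩` in `F^{(k)}(u)`. -/
def fockK {n : ℕ} (q d : ℂ) (k i : ZMod n) (u : ℂ) (lam : ℕ → ℕ) : RatFunc ℂ :=
  ∏ s ∈ Finset.range (fockCut k i lam 0),
    ((if (lam s : ZMod n) + i = ((s + 1 : ℕ) : ZMod n) + k then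
        psiZ q (q1 q d ^ ((lam s : ℤ) - 1) * q3 q d ^ (s : ℤ) * u) else 1) *
      (if (lam s : ZMod n) + i + 1 = ((s + 1 : ℕ) : ZMod n) + k then
        (psiZ q (q1 q d ^ ((lam s : ℤ) - 1) * q3 q d ^ ((s : ℤ) - 1) * u))⁻¹ else 1))

/-- The contribution of row `s` to the matrix elements of `E_i(z)` and `F_i(z)` which add a box
to, or remove a box from, row `j`. Here `lam` is the smaller one of the two partitions. -/
def fockFactor {n : ℕ} (q d : ℂ) (k i : ZMod n) (lam : ℕ → ℕ) (j s : ℕ) : ℂ :=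
  (if (lam s : ZMod n) + i = ((s + 1 : ℕ) : ZMod n) + k then
      psi q (q1 q d ^ ((lam s : ℤ) - (lam j : ℤ) - 1) * q3 q d ^ ((s : ℤ) - (j : ℤ))) else 1) *
    (if (lam s : ZMod n) + i + 1 = ((s + 1 : ℕ) : ZMod n) + k then
      psi q (q1 q d ^ ((lam j : ℤ) - (lam s : ℤ)) * q3 q d ^ ((j : ℤ) - (s : ℤ))) else 1)

/-- The coefficient of the delta function in `⟨λ + 1_j| E_i(z) |λ⟩`. -/
def fockE {n : ℕ} (q d : ℂ) (k i : ZMod n) (lam : ℕ → ℕ) (j : ℕ) : ℂ :=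
  ∏ s ∈ Finset.range j, fockFactor q d k i lam j s

/-- The coefficient of the delta function in `⟨λ| F_i(z) |λ + 1_j⟩`. -/
def fockF {n : ℕ} (q d : ℂ) (k i : ZMod n) (lam : ℕ → ℕ) (j : ℕ) : ℂ :=
  ∏ s ∈ Finset.Ico (j + 1) (fockCut k i lam (j + 1)), fockFactor q d k i lam j s

/-- The support `z = q₁^{λ_j} q₃^{j} u` of these delta functions (rows from `0`): the coefficient
is multiplied by `δ(q₁^{λ_j} q₃^{j} u / z)`. -/
def fockSupport (q d : ℂ) (u : ℂ) (lam : ℕ → ℕ) (j : ℕ) : ℂ :=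
  q1 q d ^ (lam j : ℤ) * q3 q d ^ (j : ℤ) * u

/-! ## Plane partitions and the Macmahon space -/

/-- A plane partition, as a sequence of partitions (layers): `row p j` is the part number `j` of
layer number `p`, both numbered from `0`. -/
@[ext]
structure PlanePartition : Type where
  row : ℕ → ℕ → ℕ
  row_anti : ∀ p j, row p (j + 1) ≤ row p j
  layer_anti : ∀ p j, row (p + 1) j ≤ row p j
  finite_support : {pj : ℕ × ℕ | row pj.1 pj.2 ≠ 0}.Finite

/-- The empty plane partition. -/
def PlanePartition.empty : PlanePartition where
  row := fun _ _ => 0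
  row_anti := fun _ _ => le_rfl
  layer_anti := fun _ _ => le_rfl
  finite_support := by simp

/-- All layers from number `r` on are empty, that is, `|λ⟩` lies in the image of the `r`-fold
tensor product. -/
def PlanePartition.HasLayers (L : PlanePartition) (r : ℕ) : Prop :=
  ∀ p, r ≤ p → ∀ j, L.row p j = 0

/-- `M` is obtained from `L` by adding a box to row `j` of layer `p`. -/
def PlanePartition.AddBox (L M : PlanePartition) (p j : ℕ) : Prop :=
  ∀ p' j', M.row p' j' = L.row p' j' + if p' = p ∧ j' = j then 1 else 0

/-- The vector space with basis `|λ⟩` labeled by plane partitions. -/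
abbrev Macmahon : Type := PlanePartition →₀ ℂ

/-- The basis vector `|λ⟩`. -/
def ket (L : PlanePartition) : Macmahon := Finsupp.single L 1

/-- The color of the box added to row `j` of layer `p` of `L` is `i`. -/
def ColorAt {n : ℕ} (k i : ZMod n) (L : PlanePartition) (p j : ℕ) : Prop :=
  i + (L.row p j : ZMod n) = (j : ZMod n) + k

/-- The eigenvalue of `K_i(z)` on the product of the layers `a, …, b - 1` in
`F^{(k)}(u q₂^a) ⊗ ⋯ ⊗ F^{(k)}(u q₂^{b-1})`. -/
def tensorK {n : ℕ} (q d : ℂ) (k i : ZMod n) (u : ℂ) (L : PlanePartition) (a b : ℕ) :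
    RatFunc ℂ :=
  ∏ p ∈ Finset.Ico a b, fockK q d k i (u * q2 q ^ p) (L.row p)

/-- The point `z` at which the delta function is supported which goes with adding a box to row
`j` of layer `p` of `L`. -/
def boxSupport (q d u : ℂ) (L : PlanePartition) (p j : ℕ) : ℂ :=
  fockSupport q d (u * q2 q ^ p) (L.row p) j

/-- The stabilizing factor: `f_r(z) = (K⁻¹ - K u / z) / (q^{-r} - q^r u / z)` for color `k`,
and `1` for all other colors. -/
def stabFactor {n : ℕ} (q : ℂ) (k i : ZMod n) (u K : ℂ) (r : ℕ) : RatFunc ℂ :=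
  if i = k then
    (RatFunc.C K⁻¹ - RatFunc.C (K * u) / RatFunc.X) /
      (RatFunc.C (q ^ (-(r : ℤ))) - RatFunc.C (q ^ r * u) / RatFunc.X)
  else 1

/-- The stabilized eigenvalue of `K_i(z)` on `|λ⟩`, computed with `r` layers. -/
def macK {n : ℕ} (q d : ℂ) (k i : ZMod n) (u K : ℂ) (L : PlanePartition) (r : ℕ) : RatFunc ℂ :=
  stabFactor q k i u K r * tensorK q d k i u L 0 r

/-- The coefficient of the delta function in `⟨M| E_i(z) |L⟩`, where `M` is `L` with a box added
to row `j` of layer `p`; from `Δ E_i(z) = E_i(z) ⊗ 1 + K_i^-(z) ⊗ E_i(z)`. -/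
def macE {n : ℕ} (q d : ℂ) (k i : ZMod n) (u : ℂ) (L : PlanePartition) (p j : ℕ) : ℂ :=
  evalAt (tensorK q d k i u L 0 p) (boxSupport q d u L p j) * fockE q d k i (L.row p) j

/-- The stabilized coefficient of the delta function in `⟨L| F_i(z) |M⟩`, where `M` is `L` with a
box added to row `j` of layer `p`, computed with `r` layers; from
`Δ F_i(z) = F_i(z) ⊗ K_i^+(z) + 1 ⊗ F_i(z)`. -/
def macF {n : ℕ} (q d : ℂ) (k i : ZMod n) (u K : ℂ) (L : PlanePartition) (p j r : ℕ) : ℂ :=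
  fockF q d k i (L.row p) j *
    evalAt (stabFactor q k i u K r * tensorK q d k i u L (p + 1) r) (boxSupport q d u L p j)

/-- `ρ` is the stabilized action on the Macmahon space: `K_i^±(z)`, `E_i(z)`, `F_i(z)` act by the
formulas with any sufficiently large number `r` of layers. As `δ(x) = ∑_m x ^ m` over all
integers `m`, the coefficient of `z ^ (-m)` in `c δ(a / z)` is `a ^ m c`. -/
structure IsMacmahonAction {n : ℕ} {q d : ℂ} (k : ZMod n) (u K : ℂ)
    (ρ : Toroidal n q d →ₐ[ℂ] Module.End ℂ Macmahon) : Prop where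
  Kplus : ∀ (i : ZMod n) (m : ℤ) (L : PlanePartition) (r : ℕ), L.HasLayers r →
    ρ (mk n q d (fKplus q i m)) (ket L) = expandInf (macK q d k i u K L r) m • ket L
  Kminus : ∀ (i : ZMod n) (m : ℤ) (L : PlanePartition) (r : ℕ), L.HasLayers r →
    ρ (mk n q d (fKminus q i m)) (ket L) = expandZero (macK q d k i u K L r) m • ket L
  E : ∀ (i : ZMod n) (m : ℤ) (L M : PlanePartition) (p j : ℕ),
    L.AddBox M p j → ColorAt k i L p j →
      ρ (mk n q d (fE i m)) (ket L) M = boxSupport q d u L p j ^ m * macE q d k i u L p j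
  E_zero : ∀ (i : ZMod n) (m : ℤ) (L M : PlanePartition),
    (¬ ∃ p j, L.AddBox M p j ∧ ColorAt k i L p j) → ρ (mk n q d (fE i m)) (ket L) M = 0
  F : ∀ (i : ZMod n) (m : ℤ) (L M : PlanePartition) (p j r : ℕ),
    L.AddBox M p j → ColorAt k i L p j → M.HasLayers r →
      ρ (mk n q d (fF i m)) (ket M) L = boxSupport q d u L p j ^ m * macF q d k i u K L p j r
  F_zero : ∀ (i : ZMod n) (m : ℤ) (L M : PlanePartition),
    (¬ ∃ p j, L.AddBox M p j ∧ ColorAt k i L p j) → ρ (mk n q d (fF i m)) (ket M) L = 0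

/-- The number of boxes of color `i`; the box number `y` (from `0`) of row `j` of layer `p` has
color `k + j - y`. -/
def colorCount {n : ℕ} (k : ZMod n) (L : PlanePartition) (i : ZMod n) : ℕ :=
  Set.ncard {b : ℕ × ℕ × ℕ | b.2.2 < L.row b.1 b.2.1 ∧
    k + (b.2.1 : ZMod n) - (b.2.2 : ZMod n) = i}

/-- The part of degree `α` of the Macmahon space. -/
def macmahonGrading {n : ℕ} (k : ZMod n) (α : ZMod n → ℤ) : Submodule ℂ Macmahon :=
  Submodule.span ℂ {v | ∃ L : PlanePartition, (∀ i, (colorCount k L i : ℤ) = α i) ∧ v = ket L}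

/-- The lowest weight `((K⁻¹ - K u / z) / (1 - u / z))^{δ_{ik}}`. -/
def macmahonWeight {n : ℕ} (k : ZMod n) (u K : ℂ) (i : ZMod n) : RatFunc ℂ :=
  if i = k then
    (RatFunc.C K⁻¹ - RatFunc.C (K * u) / RatFunc.X) / (1 - RatFunc.C u / RatFunc.X)
  else 1

/-- `K` is generic: the factor `K⁻¹ - K u / z` does not vanish at the support
`z = q₃^x q₁^y q₂^w u` of a delta function belonging to a box `(x, y, w)` of color `k`, that is,
with `x ≡ y`. This holds whenever `K ^ 2 ∉ q₁^ℤ q₂^ℤ`. -/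
def GenericLevel (n : ℕ) (q d K : ℂ) : Prop :=
  ∀ x y w : ℕ, 1 ≤ x → 1 ≤ y → 1 ≤ w → (x : ZMod n) = (y : ZMod n) →
    K ^ 2 ≠ q3 q d ^ x * q1 q d ^ y * q2 q ^ w

end QuantumToroidal

end

noncomputable section

namespace QuantumToroidal

/-! ## Evaluating rational functions at Laurent series -/

/-! A plane partition is a finite lower set `S` of boxes `b = (p, j, y)` (layer, row, column). A box
has a position `bx b = q₁^y q₃^j q₂^p u` and a color `bcol b = k + j - y`; by genericity, positions
coincide only along the direction `(1, 1, 1)` (`xpos_eq_iff`). The vacuum factors of rows and layers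
telescope, and the stabilizing factor removes the last boundary term. So the eigenvalue of `K_i(z)`
on `S` is a level factor times `Rhat i S`, a vacuum factor times a product of rational functions `Gz
i b` over the boxes (`macK_eq`), whatever `r` is. Splitting the rows into those before `b`, the row
of `b` and those after `b` gives `Rhat = RE * rowF * RF` (`Rhat_eq`). The matrix element of `E`
adding `b` is the value of `RE` at `bx b`, and that of `F` is the value of `RF` times the level
factor (`macE_eq`, `macF_eq`).

A single `Gz` may have a zero or a pole at `bx b`, although `RE` and `RF` are regular and nonzero
there. Values are therefore replaced by leading coefficients, which are multiplicative without any
regularity. The matrix elements become products `wt v g S b = v b * ∏ c ∈ S, g c b` over boxes.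

For the relations among the `E`, or among the `F`, two or three boxes are added to a lower set `T`.
The weight of an order of adding them is a symmetric factor times a product over pairs, and a pair
contributes zero when a box would precede one that it covers. For every pair the contributions of
the two orders are in the ratio `num : den` (`exists_order_eq`), because a convex set of at most
three boxes has no accidental zeros of `num` and `den` (`covers_of_den_eq_zero`). The quadratic and
Serre relations are then polynomial identities in the positions. They are proved for lowering
operators and transposed to raising operators.

In `[E, F]` the off-diagonal terms cancel since `gE b a * gF a b = 1` for boxes that can be added
independently. On the diagonal, `wE * wF` is, up to `±(q - q⁻¹) bx b`, the residue of the eigenvalue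
at `bx b` (`residues`), and the two expansions of a rational function with simple poles differ by
delta functions weighted by residues (`expandInf_sub_expandZero`). It remains to see that the
eigenvalue has only simple poles, at corners of `S` of color `i`. Its order at the position of a
diagonal is an alternating sum of six heights of neighbouring diagonals (`count_sub_count`);
interlacing of heights bounds it below by `-1` and produces a corner when it is negative
(`diagOrd_spec`).

The same orders determine the number of boxes on every diagonal, hence `S`, so the joint spectrum is
simple (`exists_eig_ne`) and an invariant subspace contains the basis vectors occurring in its
elements. As `wE` never vanishes, and `wF` vanishes only with the level factor, which the genericity
of `K` excludes, every basis vector is linked to the vacuum in both directions. This gives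
irreducibility and generation by the vacuum. The level is computed from the vacuum alone, because
the columns of the affine Cartan matrix sum to zero. -/

theorem eval₂_ne_zero_of_notMem_range {z : LaurentSeries ℂ}
    (hz : ∀ c : ℂ, z ≠ HahnSeries.C c) {p : Polynomial ℂ} (hp : p ≠ 0) :
    p.eval₂ (HahnSeries.C : ℂ →+* LaurentSeries ℂ) z ≠ 0 := by
  -- Over `ℂ` the polynomial splits, so in the field of Laurent series it can vanish at `z` only if
  -- `z` is one of its constant roots.
  rw [(IsAlgClosed.splits p).eq_prod_roots, Polynomial.eval₂_mul, Polynomial.eval₂_C]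
  refine mul_ne_zero (by simpa using hp) ?_
  rw [← Polynomial.coe_eval₂RingHom, map_multiset_prod]
  refine Multiset.prod_ne_zero ?_
  simp only [Multiset.mem_map, not_exists, not_and, forall_exists_index, and_imp]
  rintro _ x _ rfl h
  simp only [Polynomial.coe_eval₂RingHom, Polynomial.eval₂_sub, Polynomial.eval₂_X,
    Polynomial.eval₂_C, sub_eq_zero] at h
  exact hz _ h

/-- Evaluation of rational functions at a nonconstant Laurent series. -/
def evalHom (z : LaurentSeries ℂ) (hz : ∀ c : ℂ, z ≠ HahnSeries.C c) :
    RatFunc ℂ →+* LaurentSeries ℂ where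
  toFun R := R.eval (HahnSeries.C : ℂ →+* LaurentSeries ℂ) z
  map_zero' := by simp
  map_one' := by simp
  map_mul' x y := RatFunc.eval_mul _ _
    (eval₂_ne_zero_of_notMem_range hz x.denom_ne_zero)
    (eval₂_ne_zero_of_notMem_range hz y.denom_ne_zero)
  map_add' x y := RatFunc.eval_add _ _
    (eval₂_ne_zero_of_notMem_range hz x.denom_ne_zero)
    (eval₂_ne_zero_of_notMem_range hz y.denom_ne_zero)

theorem evalHom_apply (z : LaurentSeries ℂ) (hz : ∀ c : ℂ, z ≠ HahnSeries.C c) (R : RatFunc ℂ) :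
    evalHom z hz R = R.eval (HahnSeries.C : ℂ →+* LaurentSeries ℂ) z := rfl

@[simp]
theorem evalHom_C (z : LaurentSeries ℂ) (hz : ∀ c : ℂ, z ≠ HahnSeries.C c) (c : ℂ) :
    evalHom z hz (RatFunc.C c) = HahnSeries.C c := by
  simp [evalHom_apply]

@[simp]
theorem evalHom_X (z : LaurentSeries ℂ) (hz : ∀ c : ℂ, z ≠ HahnSeries.C c) :
    evalHom z hz RatFunc.X = z := by
  simp [evalHom_apply]

theorem single_ne_C {m : ℤ} (hm : m ≠ 0) (c : ℂ) :
    (HahnSeries.single m (1 : ℂ) : LaurentSeries ℂ) ≠ HahnSeries.C c := by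
  intro h
  have := congrArg (fun f : LaurentSeries ℂ => f.coeff m) h
  simp [HahnSeries.C_apply, hm] at this

theorem C_add_single_ne_C (a c : ℂ) :
    (HahnSeries.C a + HahnSeries.single (1 : ℤ) (1 : ℂ) : LaurentSeries ℂ) ≠ HahnSeries.C c := by
  intro h
  have := congrArg (fun f : LaurentSeries ℂ => f.coeff 1) h
  simp [HahnSeries.C_apply] at this

/-- Expansion at `z = ∞`, in powers of `z⁻¹`. -/
def infHom : RatFunc ℂ →+* LaurentSeries ℂ :=
  evalHom (HahnSeries.single (-1 : ℤ) (1 : ℂ)) (single_ne_C (by decide))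

/-- Expansion at `z = 0`. -/
def zeroHom : RatFunc ℂ →+* LaurentSeries ℂ :=
  evalHom (HahnSeries.single (1 : ℤ) (1 : ℂ)) (single_ne_C (by decide))

/-- Expansion at `z = a`, in powers of `z - a`. -/
def locHom (a : ℂ) : RatFunc ℂ →+* LaurentSeries ℂ :=
  evalHom (HahnSeries.C a + HahnSeries.single (1 : ℤ) (1 : ℂ)) (C_add_single_ne_C a)

theorem expandInf_eq (R : RatFunc ℂ) (r : ℤ) : expandInf R r = (infHom R).coeff r := rfl

theorem expandZero_eq (R : RatFunc ℂ) (r : ℤ) : expandZero R r = (zeroHom R).coeff (-r) := rfl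

theorem expandInf_injective {R R' : RatFunc ℂ} (h : ∀ r, expandInf R r = expandInf R' r) :
    R = R' :=
  infHom.injective (HahnSeries.ext (funext h))

theorem expandInf_C_mul (c : ℂ) (R : RatFunc ℂ) (r : ℤ) :
    expandInf (RatFunc.C c * R) r = c * expandInf R r := by
  simp [expandInf_eq, infHom]

theorem expandZero_C_mul (c : ℂ) (R : RatFunc ℂ) (r : ℤ) :
    expandZero (RatFunc.C c * R) r = c * expandZero R r := by
  simp [expandZero_eq, zeroHom]

theorem expandInf_X_mul (R : RatFunc ℂ) (r : ℤ) :
    expandInf (RatFunc.X * R) r = expandInf R (r + 1) := by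
  simp only [expandInf_eq, infHom, map_mul, evalHom_X]
  conv_lhs => rw [show r = r + 1 + (-1) by ring]
  rw [HahnSeries.coeff_single_mul_add, one_mul]

theorem expandZero_X_mul (R : RatFunc ℂ) (r : ℤ) :
    expandZero (RatFunc.X * R) r = expandZero R (r + 1) := by
  simp only [expandZero_eq, zeroHom, map_mul, evalHom_X]
  conv_lhs => rw [show -r = -(r + 1) + 1 by ring]
  rw [HahnSeries.coeff_single_mul_add, one_mul]

theorem expandInf_add (R R' : RatFunc ℂ) (r : ℤ) :
    expandInf (R + R') r = expandInf R r + expandInf R' r := by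
  simp [expandInf_eq]

theorem expandZero_add (R R' : RatFunc ℂ) (r : ℤ) :
    expandZero (R + R') r = expandZero R r + expandZero R' r := by
  simp [expandZero_eq]

theorem expandInf_sub (R R' : RatFunc ℂ) (r : ℤ) :
    expandInf (R - R') r = expandInf R r - expandInf R' r := by
  simp [expandInf_eq]

theorem expandZero_sub (R R' : RatFunc ℂ) (r : ℤ) :
    expandZero (R - R') r = expandZero R r - expandZero R' r := by
  simp [expandZero_eq]

/-! ## Linear factors -/

/-- The linear factor `1 - c / z`. -/
def lin (c : ℂ) : RatFunc ℂ := 1 - RatFunc.C c / RatFunc.X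

theorem lin_mul_X (c : ℂ) : lin c * RatFunc.X = RatFunc.X - RatFunc.C c := by
  rw [lin, sub_mul, one_mul, div_mul_cancel₀ _ RatFunc.X_ne_zero]

theorem lin_eq (c : ℂ) : lin c = (RatFunc.X - RatFunc.C c) / RatFunc.X := by
  rw [eq_div_iff RatFunc.X_ne_zero, lin_mul_X]

theorem X_sub_C_ne_zero (c : ℂ) : (RatFunc.X - RatFunc.C c : RatFunc ℂ) ≠ 0 := by
  intro h
  have := congrArg infHom h
  simp only [infHom, map_sub, evalHom_X, evalHom_C, map_zero, sub_eq_zero] at this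
  exact single_ne_C (by decide) c this

theorem lin_ne_zero (c : ℂ) : lin c ≠ 0 := by
  rw [lin_eq]
  exact div_ne_zero (X_sub_C_ne_zero c) RatFunc.X_ne_zero

theorem C_ne_zero {c : ℂ} (hc : c ≠ 0) : (RatFunc.C c : RatFunc ℂ) ≠ 0 := by
  simpa using hc

/-! ### Order and leading coefficient at a point -/

/-- The order of vanishing at `z = a`. -/
def ordAt (a : ℂ) (R : RatFunc ℂ) : ℤ := (locHom a R).order

/-- The leading coefficient in the expansion at `z = a`. -/
def leadAt (a : ℂ) (R : RatFunc ℂ) : ℂ := (locHom a R).leadingCoeff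

/-- No regularity is assumed. This is what allows a value to be distributed over factors that
separately have zeros or poles at `a`. -/
theorem leadAt_mul (a : ℂ) (R R' : RatFunc ℂ) : leadAt a (R * R') = leadAt a R * leadAt a R' := by
  simp [leadAt, HahnSeries.leadingCoeff_mul]

theorem leadAt_ne_zero {a : ℂ} {R : RatFunc ℂ} (h : R ≠ 0) : leadAt a R ≠ 0 := by
  simpa [leadAt] using h

@[simp]
theorem leadAt_one (a : ℂ) : leadAt a 1 = 1 := by
  simp [leadAt]

theorem leadAt_prod {ι : Type*} (a : ℂ) (s : Finset ι) (f : ι → RatFunc ℂ) :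
    leadAt a (∏ x ∈ s, f x) = ∏ x ∈ s, leadAt a (f x) := by
  classical
  induction s using Finset.induction_on with
  | empty => simp
  | insert x s hx ih => rw [Finset.prod_insert hx, Finset.prod_insert hx, leadAt_mul, ih]

theorem leadAt_inv (a : ℂ) (R : RatFunc ℂ) : leadAt a R⁻¹ = (leadAt a R)⁻¹ := by
  by_cases h : R = 0
  · simp [h, leadAt]
  · refine eq_inv_of_mul_eq_one_left ?_
    rw [← leadAt_mul, inv_mul_cancel₀ h, leadAt_one]

theorem leadAt_div (a : ℂ) (R R' : RatFunc ℂ) : leadAt a (R / R') = leadAt a R / leadAt a R' := by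
  rw [div_eq_mul_inv, leadAt_mul, leadAt_inv, div_eq_mul_inv]

theorem ordAt_mul (a : ℂ) {R R' : RatFunc ℂ} (h : R ≠ 0) (h' : R' ≠ 0) :
    ordAt a (R * R') = ordAt a R + ordAt a R' := by
  rw [ordAt, map_mul, HahnSeries.order_mul (by simpa using h) (by simpa using h')]
  rfl

@[simp]
theorem ordAt_one (a : ℂ) : ordAt a 1 = 0 := by
  simp [ordAt]

theorem ordAt_inv (a : ℂ) (R : RatFunc ℂ) : ordAt a R⁻¹ = -ordAt a R := by
  by_cases h : R = 0
  · simp [h, ordAt]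
  · have := ordAt_mul a h (inv_ne_zero h)
    rw [mul_inv_cancel₀ h, ordAt_one] at this
    linarith

@[simp]
theorem leadAt_C (a c : ℂ) : leadAt a (RatFunc.C c) = c := by
  simp [leadAt, locHom, HahnSeries.C_apply]

@[simp]
theorem ordAt_C (a c : ℂ) : ordAt a (RatFunc.C c) = 0 := by
  rw [ordAt, locHom, evalHom_C, HahnSeries.order_C]

theorem C_add_single_order {b : ℂ} (hb : b ≠ 0) :
    (HahnSeries.C b + HahnSeries.single (1 : ℤ) (1 : ℂ) : LaurentSeries ℂ).order = 0 ∧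
    (HahnSeries.C b + HahnSeries.single (1 : ℤ) (1 : ℂ) : LaurentSeries ℂ).leadingCoeff = b := by
  have h : (HahnSeries.C b : LaurentSeries ℂ).orderTop <
      (HahnSeries.single (1 : ℤ) (1 : ℂ) : LaurentSeries ℂ).orderTop := by
    rw [HahnSeries.C_apply, HahnSeries.orderTop_single hb, HahnSeries.orderTop_single one_ne_zero]
    exact_mod_cast zero_lt_one
  have h2 := HahnSeries.leadingCoeff_add_eq_left h
  have h3 := HahnSeries.orderTop_add_eq_left h
  refine ⟨?_, by rw [h2]; simp [HahnSeries.C_apply]⟩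
  rw [HahnSeries.C_apply, HahnSeries.orderTop_single hb] at h3
  have hne : (HahnSeries.C b + HahnSeries.single (1 : ℤ) (1 : ℂ) : LaurentSeries ℂ) ≠ 0 := by
    rw [← HahnSeries.leadingCoeff_ne_zero, h2]
    simpa [HahnSeries.C_apply] using hb
  rw [HahnSeries.C_apply] at hne ⊢
  have := HahnSeries.order_eq_orderTop_of_ne_zero hne
  rw [h3] at this
  exact_mod_cast this

theorem locHom_X_sub_C (a c : ℂ) : locHom a (RatFunc.X - RatFunc.C c) =
    HahnSeries.C (a - c) + HahnSeries.single (1 : ℤ) (1 : ℂ) := by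
  simp [locHom]; ring

theorem order_leadAt_X_sub_C (a c : ℂ) :
    ordAt a (RatFunc.X - RatFunc.C c) = (if c = a then 1 else 0) ∧
    leadAt a (RatFunc.X - RatFunc.C c) = (if c = a then 1 else a - c) := by
  rw [ordAt, leadAt, locHom_X_sub_C]
  split_ifs with h
  · subst h; simp
  · exact C_add_single_order (sub_ne_zero.mpr (Ne.symm h))

theorem order_leadAt_X {a : ℂ} (ha : a ≠ 0) :
    ordAt a RatFunc.X = 0 ∧ leadAt a RatFunc.X = a := by
  simpa [ha.symm] using order_leadAt_X_sub_C a 0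

theorem ordAt_lin {a : ℂ} (ha : a ≠ 0) (c : ℂ) : ordAt a (lin c) = if c = a then 1 else 0 := by
  rw [lin_eq, div_eq_mul_inv, ordAt_mul a (X_sub_C_ne_zero c) (inv_ne_zero RatFunc.X_ne_zero),
    ordAt_inv, (order_leadAt_X ha).1, (order_leadAt_X_sub_C a c).1]
  simp

theorem leadAt_lin {a : ℂ} (ha : a ≠ 0) {c : ℂ} (hc : c ≠ a) : leadAt a (lin c) = 1 - c / a := by
  rw [lin_eq, leadAt_div, (order_leadAt_X ha).2, (order_leadAt_X_sub_C a c).2, if_neg hc]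
  field_simp

theorem leadAt_lin_self {a : ℂ} (ha : a ≠ 0) : leadAt a (lin a) = a⁻¹ := by
  rw [lin_eq, leadAt_div, (order_leadAt_X ha).2, (order_leadAt_X_sub_C a a).2, if_pos rfl]
  simp

/-! ### Values of rational functions at a point -/

/-- `R` is regular at `a`, with value `v`. -/
def HasValAt (a : ℂ) (R : RatFunc ℂ) (v : ℂ) : Prop :=
  ∃ P Q : Polynomial ℂ, Q.eval a ≠ 0 ∧
    R = algebraMap _ (RatFunc ℂ) P / algebraMap _ (RatFunc ℂ) Q ∧ v = P.eval a / Q.eval a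

theorem HasValAt.mul {a v v' : ℂ} {R R' : RatFunc ℂ} (h : HasValAt a R v) (h' : HasValAt a R' v') :
    HasValAt a (R * R') (v * v') := by
  obtain ⟨P, Q, hQ, rfl, rfl⟩ := h
  obtain ⟨P', Q', hQ', rfl, rfl⟩ := h'
  exact ⟨P * P', Q * Q', by simp [hQ, hQ'], by simp [div_mul_div_comm],
    by simp [div_mul_div_comm]⟩

theorem HasValAt.inv {a v : ℂ} {R : RatFunc ℂ} (h : HasValAt a R v) (hv : v ≠ 0) :
    HasValAt a R⁻¹ v⁻¹ := by
  obtain ⟨P, Q, hQ, rfl, rfl⟩ := h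
  exact ⟨Q, P, fun h => hv (by simp [h]), by simp, by simp⟩

theorem hasValAt_one (a : ℂ) : HasValAt a 1 1 :=
  ⟨1, 1, by simp, by simp, by simp⟩

theorem hasValAt_C (a c : ℂ) : HasValAt a (RatFunc.C c) c :=
  ⟨Polynomial.C c, 1, by simp, by simp, by simp⟩

theorem hasValAt_lin {a : ℂ} (ha : a ≠ 0) (c : ℂ) : HasValAt a (lin c) (1 - c / a) := by
  refine ⟨Polynomial.X - Polynomial.C c, Polynomial.X, by simpa, ?_, ?_⟩
  · rw [lin_eq]; simp
  · simp; field_simp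

theorem HasValAt.evalAt_eq {a v : ℂ} {R : RatFunc ℂ} (h : HasValAt a R v) : evalAt R a = v := by
  obtain ⟨P, Q, hQ, rfl, rfl⟩ := h
  have hQ0 : algebraMap (Polynomial ℂ) (RatFunc ℂ) Q ≠ 0 := by
    simpa using fun h : Q = 0 => hQ (by simp [h])
  set R := algebraMap (Polynomial ℂ) (RatFunc ℂ) P / algebraMap _ (RatFunc ℂ) Q with hR
  -- `evalAt` evaluates in lowest terms. The reduced denominator divides `Q`, so it does not vanish
  -- at `a`, and evaluation is multiplicative on `R * Q = P`.
  have hd : R.denom.eval₂ (RingHom.id ℂ) a ≠ 0 := by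
    intro h
    refine hQ ?_
    have := Polynomial.eval₂_eq_zero_of_dvd_of_eval₂_eq_zero (RingHom.id ℂ) a
      (RatFunc.denom_div_dvd P Q) h
    simpa [Polynomial.eval₂_id] using this
  have key : R * algebraMap (Polynomial ℂ) (RatFunc ℂ) Q = algebraMap _ _ P := by
    rw [hR, div_mul_cancel₀ _ hQ0]
  have := congrArg (RatFunc.eval (RingHom.id ℂ) a) key
  rw [RatFunc.eval_mul _ _ hd (by simp [RatFunc.denom_algebraMap]), RatFunc.eval_algebraMap,
    RatFunc.eval_algebraMap] at this
  rw [evalAt, eq_div_iff hQ]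
  simpa [Polynomial.eval₂_id] using this

/-- `R` is regular at `a`, with nonzero value `v`. -/
structure RegAt (a : ℂ) (R : RatFunc ℂ) (v : ℂ) : Prop where
  ne_zero : v ≠ 0
  val : HasValAt a R v
  ord : ordAt a R = 0
  lead : leadAt a R = v

theorem RegAt.ratFunc_ne_zero {a v : ℂ} {R : RatFunc ℂ} (h : RegAt a R v) : R ≠ 0 := by
  rintro rfl
  exact h.ne_zero (by rw [← h.lead, leadAt, map_zero, HahnSeries.leadingCoeff_zero])

theorem RegAt.evalAt_eq {a v : ℂ} {R : RatFunc ℂ} (h : RegAt a R v) : evalAt R a = v :=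
  h.val.evalAt_eq

theorem RegAt.mul {a v v' : ℂ} {R R' : RatFunc ℂ} (h : RegAt a R v) (h' : RegAt a R' v') :
    RegAt a (R * R') (v * v') :=
  ⟨mul_ne_zero h.ne_zero h'.ne_zero, h.val.mul h'.val,
    by rw [ordAt_mul a h.ratFunc_ne_zero h'.ratFunc_ne_zero, h.ord, h'.ord, add_zero],
    by rw [leadAt_mul, h.lead, h'.lead]⟩

theorem RegAt.inv {a v : ℂ} {R : RatFunc ℂ} (h : RegAt a R v) : RegAt a R⁻¹ v⁻¹ :=
  ⟨inv_ne_zero h.ne_zero, h.val.inv h.ne_zero, by rw [ordAt_inv, h.ord, neg_zero],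
    by rw [leadAt_inv, h.lead]⟩

theorem RegAt.div {a v v' : ℂ} {R R' : RatFunc ℂ} (h : RegAt a R v) (h' : RegAt a R' v') :
    RegAt a (R / R') (v / v') := by
  rw [div_eq_mul_inv, div_eq_mul_inv]
  exact h.mul h'.inv

theorem regAt_one (a : ℂ) : RegAt a 1 1 :=
  ⟨one_ne_zero, hasValAt_one a, ordAt_one a, leadAt_one a⟩

theorem regAt_C (a : ℂ) {c : ℂ} (hc : c ≠ 0) : RegAt a (RatFunc.C c) c :=
  ⟨hc, hasValAt_C a c, ordAt_C a c, leadAt_C a c⟩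

theorem regAt_lin {a : ℂ} (ha : a ≠ 0) {c : ℂ} (hc : c ≠ a) : RegAt a (lin c) (1 - c / a) :=
  ⟨fun h => hc ((div_eq_one_iff_eq ha).mp (sub_eq_zero.mp h).symm), hasValAt_lin ha c,
    by rw [ordAt_lin ha, if_neg hc], leadAt_lin ha hc⟩

theorem RegAt.prod {ι : Type*} {a : ℂ} {s : Finset ι} {f : ι → RatFunc ℂ} {v : ι → ℂ}
    (h : ∀ x ∈ s, RegAt a (f x) (v x)) : RegAt a (∏ x ∈ s, f x) (∏ x ∈ s, v x) := by
  classical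
  induction s using Finset.induction_on with
  | empty => simpa using regAt_one a
  | insert x s hx ih =>
    rw [Finset.prod_insert hx, Finset.prod_insert hx]
    exact (h x (by simp)).mul (ih fun y hy => h y (by simp [hy]))

theorem RegAt.ite {a v : ℂ} {R : RatFunc ℂ} {p : Prop} [Decidable p] (h : p → RegAt a R v) :
    RegAt a (if p then R else 1) (if p then v else 1) := by
  split_ifs with hp
  · exact h hp
  · exact regAt_one a

/-! ## Partial fractions -/

/-- The residue at `z = a`. -/
def resAt (a : ℂ) (R : RatFunc ℂ) : ℂ := (locHom a R).coeff (-1)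

theorem resAt_add (a : ℂ) (R R' : RatFunc ℂ) : resAt a (R + R') = resAt a R + resAt a R' := by
  simp [resAt]

theorem resAt_sum {ι : Type*} (a : ℂ) (s : Finset ι) (f : ι → RatFunc ℂ) :
    resAt a (∑ x ∈ s, f x) = ∑ x ∈ s, resAt a (f x) := by
  classical
  induction s using Finset.induction_on with
  | empty => simp [resAt]
  | insert x s hx ih => rw [Finset.sum_insert hx, Finset.sum_insert hx, resAt_add, ih]

theorem resAt_C_mul (a c : ℂ) (R : RatFunc ℂ) : resAt a (RatFunc.C c * R) = c * resAt a R := by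
  simp [resAt, locHom]

theorem resAt_of_ord_nonneg {a : ℂ} {R : RatFunc ℂ} (h : 0 ≤ ordAt a R) : resAt a R = 0 :=
  HahnSeries.coeff_eq_zero_of_lt_order (lt_of_lt_of_le (by decide) h)

theorem resAt_of_ord_eq {a : ℂ} {R : RatFunc ℂ} (h : ordAt a R = -1) :
    resAt a R = leadAt a R := by
  rw [leadAt, HahnSeries.leadingCoeff_eq, resAt]
  rw [ordAt] at h
  rw [h]

theorem resAt_inv_lin {a : ℂ} (ha : a ≠ 0) (c : ℂ) :
    resAt a (lin c)⁻¹ = if c = a then a else 0 := by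
  split_ifs with h
  · subst h
    rw [resAt_of_ord_eq (by rw [ordAt_inv, ordAt_lin ha, if_pos rfl]), leadAt_inv,
      leadAt_lin_self ha, inv_inv]
  · exact resAt_of_ord_nonneg (by rw [ordAt_inv, ordAt_lin ha, if_neg h, neg_zero])

/-- A polynomial in `1 / z`. -/
def invPoly : Polynomial ℂ →+* RatFunc ℂ := Polynomial.eval₂RingHom RatFunc.C RatFunc.X⁻¹

theorem invPoly_lin (c : ℂ) : invPoly (1 - Polynomial.C c * Polynomial.X) = lin c := by
  simp [invPoly, lin, div_eq_mul_inv]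

theorem invPoly_C (c : ℂ) : invPoly (Polynomial.C c) = RatFunc.C c := by
  simp [invPoly]

/-- Induction on the set of poles, in the variable `1 / z`: one simple fraction at `a` is split off
and the degree of the numerator drops by one. A pole at `0` is excluded because `lin 0 = 1`. -/
theorem exists_partialFraction (S : Finset ℂ) (h0 : (0 : ℂ) ∉ S) :
    ∀ P : Polynomial ℂ, P.natDegree ≤ S.card →
    ∃ (c0 : ℂ) (c : ℂ → ℂ), invPoly P / ∏ x ∈ S, lin x =
      RatFunc.C c0 + ∑ x ∈ S, RatFunc.C (c x) * (lin x)⁻¹ := by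
  classical
  induction S using Finset.induction_on with
  | empty =>
    intro P hP
    obtain ⟨c, rfl⟩ := Polynomial.natDegree_eq_zero.mp (Nat.le_zero.mp hP)
    exact ⟨c, 0, by simp [invPoly_C]⟩
  | insert a S ha ih =>
    intro P hP
    rw [Finset.mem_insert, not_or] at h0
    have ha0 : a ≠ 0 := fun h => h0.1 h.symm
    rw [Finset.card_insert_of_notMem ha] at hP
    set Q : Polynomial ℂ := ∏ x ∈ S, (1 - Polynomial.C x * Polynomial.X) with hQ
    have hQe : Q.eval a⁻¹ ≠ 0 := by
      rw [hQ, Polynomial.eval_prod, Finset.prod_ne_zero_iff]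
      intro x hx h
      simp only [Polynomial.eval_sub, Polynomial.eval_one, Polynomial.eval_mul, Polynomial.eval_C,
        Polynomial.eval_X, sub_eq_zero] at h
      have hxa : x = a := by field_simp at h; exact h.symm
      exact ha (hxa ▸ hx)
    have hQd : Q.natDegree ≤ S.card := by
      refine (Polynomial.natDegree_prod_le _ _).trans ?_
      refine (Finset.sum_le_sum (g := fun _ => 1) fun x _ => ?_).trans (by simp)
      compute_degree
    have hιQ : invPoly Q = ∏ x ∈ S, lin x := by
      rw [hQ, map_prod]; simp only [invPoly_lin]
    -- With this `e` the polynomial `P - e Q` vanishes at `1 / z = a⁻¹`, so the factor `1 - a / z`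
    -- cancels from what remains.
    set e : ℂ := P.eval a⁻¹ / Q.eval a⁻¹ with he
    have hroot : (P - Polynomial.C e * Q).IsRoot a⁻¹ := by
      simp [he, hQe]
    obtain ⟨P', hP'⟩ := Polynomial.dvd_iff_isRoot.mpr hroot
    have hdeg : (Polynomial.C (-a⁻¹) * P').natDegree ≤ S.card := by
      rw [Polynomial.natDegree_C_mul (by simpa using ha0)]
      by_cases hP0 : P' = 0
      · simp [hP0]
      have h1 : (P - Polynomial.C e * Q).natDegree ≤ S.card + 1 := by
        refine (Polynomial.natDegree_sub_le _ _).trans (max_le hP ?_)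
        exact (Polynomial.natDegree_C_mul_le _ _).trans (hQd.trans (Nat.le_succ _))
      rw [hP', Polynomial.natDegree_mul (Polynomial.X_sub_C_ne_zero _) hP0,
        Polynomial.natDegree_X_sub_C] at h1
      omega
    obtain ⟨c0, c, hc⟩ := ih h0.2 _ hdeg
    have hfac : P = Polynomial.C e * Q +
        (1 - Polynomial.C a * Polynomial.X) * (Polynomial.C (-a⁻¹) * P') := by
      have h2 : (1 - Polynomial.C a * Polynomial.X) * (Polynomial.C (-a⁻¹) * P') =
          (Polynomial.X - Polynomial.C a⁻¹) * P' := by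
        have : Polynomial.C a * Polynomial.C a⁻¹ = (1 : Polynomial ℂ) := by
          rw [← Polynomial.C_mul, mul_inv_cancel₀ ha0, Polynomial.C_1]
        rw [Polynomial.C_neg]
        linear_combination (Polynomial.X * P') * this
      rw [h2, ← hP']; ring
    refine ⟨c0, Function.update c a e, ?_⟩
    rw [Finset.prod_insert ha, Finset.sum_insert ha, Function.update_self]
    have hsum : ∑ x ∈ S, RatFunc.C (Function.update c a e x) * (lin x)⁻¹ =
        ∑ x ∈ S, RatFunc.C (c x) * (lin x)⁻¹ :=
      Finset.sum_congr rfl fun x hx => by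
        rw [Function.update_of_ne (fun h : x = a => ha (h ▸ hx))]
    have hprod : ∏ x ∈ S, lin x ≠ 0 := Finset.prod_ne_zero_iff.mpr fun x _ => lin_ne_zero x
    have hla := lin_ne_zero a
    rw [hsum, add_left_comm, ← hc]
    conv_lhs => rw [hfac]
    rw [map_add, map_mul, map_mul, invPoly_C, invPoly_lin, hιQ]
    field_simp

theorem geom_mul (x : ℂ) : (HahnSeries.ofPowerSeries ℤ ℂ (PowerSeries.mk fun n => x ^ n)) *
    (1 - HahnSeries.C x * HahnSeries.single (1 : ℤ) (1 : ℂ)) = 1 := by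
  have h : (PowerSeries.mk fun n => x ^ n) * (1 - PowerSeries.C x * PowerSeries.X) = 1 := by
    ext n
    rw [mul_sub, mul_one, mul_left_comm, map_sub, PowerSeries.coeff_C_mul]
    cases n with
    | zero => simp
    | succ n =>
      rw [PowerSeries.coeff_succ_mul_X, PowerSeries.coeff_mk, PowerSeries.coeff_mk,
        PowerSeries.coeff_one, if_neg n.succ_ne_zero]
      ring
  have := congrArg (HahnSeries.ofPowerSeries ℤ ℂ) h
  simpa using this

/-- Nonnegative powers of `x` here and, with a minus sign, negative powers in `expandZero_inv_lin`:
the expansions of `1 / (1 - x / z)` at `∞` and `0` differ by `δ(x / z)`. -/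
theorem expandInf_inv_lin (x : ℂ) (m : ℤ) :
    expandInf (lin x)⁻¹ m = if m < 0 then 0 else x ^ m := by
  have h : infHom (lin x) = 1 - HahnSeries.C x * HahnSeries.single (1 : ℤ) (1 : ℂ) := by
    rw [lin, div_eq_mul_inv]
    simp [infHom]
  rw [expandInf_eq, map_inv₀, h, ← eq_inv_of_mul_eq_one_left (geom_mul x),
    PowerSeries.coeff_coe]
  split_ifs with hm
  · rfl
  · rw [PowerSeries.coeff_mk, ← zpow_natCast, Int.natAbs_of_nonneg (not_lt.mp hm)]

theorem expandZero_inv_lin {x : ℂ} (hx : x ≠ 0) (m : ℤ) :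
    expandZero (lin x)⁻¹ m = if m < 0 then -x ^ m else 0 := by
  have h1 : (lin x)⁻¹ = RatFunc.X * (RatFunc.C (-x⁻¹) * (1 - RatFunc.C x⁻¹ * RatFunc.X)⁻¹) := by
    have hX : (RatFunc.X : RatFunc ℂ) ≠ 0 := RatFunc.X_ne_zero
    have : (1 - RatFunc.C x⁻¹ * RatFunc.X : RatFunc ℂ) =
        RatFunc.C (-x⁻¹) * (RatFunc.X - RatFunc.C x) := by
      have : (RatFunc.C x⁻¹ * RatFunc.C x : RatFunc ℂ) = 1 := by
        rw [← map_mul, inv_mul_cancel₀ hx, map_one]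
      rw [map_neg]
      linear_combination -this
    have h3 : (RatFunc.C (-x⁻¹) : RatFunc ℂ) ≠ 0 := C_ne_zero (by simpa using hx)
    rw [this, lin_eq, mul_inv, mul_inv_cancel_left₀ h3, inv_div, div_eq_mul_inv]
  have h : zeroHom (1 - RatFunc.C x⁻¹ * RatFunc.X) =
      1 - HahnSeries.C x⁻¹ * HahnSeries.single (1 : ℤ) (1 : ℂ) := by
    simp [zeroHom]
  rw [h1, expandZero_X_mul, expandZero_C_mul, expandZero_eq, map_inv₀, h,
    ← eq_inv_of_mul_eq_one_left (geom_mul x⁻¹), PowerSeries.coeff_coe]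
  by_cases hm : m < 0
  · rw [if_neg (by omega), if_pos hm, PowerSeries.coeff_mk, ← zpow_natCast,
      Int.natAbs_of_nonneg (by omega), inv_zpow', neg_neg, zpow_add₀ hx, zpow_one]
    field_simp
  · rw [if_pos (by omega), if_neg hm, mul_zero]

theorem expandInf_C (c : ℂ) (m : ℤ) : expandInf (RatFunc.C c) m = if m = 0 then c else 0 := by
  rw [expandInf_eq, infHom, evalHom_C, HahnSeries.C_apply, HahnSeries.coeff_single]
  split_ifs <;> rfl

theorem expandZero_C (c : ℂ) (m : ℤ) : expandZero (RatFunc.C c) m = if m = 0 then c else 0 := by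
  rw [expandZero_eq, zeroHom, evalHom_C, HahnSeries.C_apply, HahnSeries.coeff_single]
  simp only [neg_eq_zero]

theorem expandInf_sum {ι : Type*} (s : Finset ι) (f : ι → RatFunc ℂ) (m : ℤ) :
    expandInf (∑ x ∈ s, f x) m = ∑ x ∈ s, expandInf (f x) m := by
  simp [expandInf_eq]

theorem expandZero_sum {ι : Type*} (s : Finset ι) (f : ι → RatFunc ℂ) (m : ℤ) :
    expandZero (∑ x ∈ s, f x) m = ∑ x ∈ s, expandZero (f x) m := by
  simp [expandZero_eq]

/-- The difference of the two expansions is a sum of delta functions at the simple poles. -/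
theorem expandInf_sub_expandZero {S : Finset ℂ} (h0 : (0 : ℂ) ∉ S) {P : Polynomial ℂ}
    (hP : P.natDegree ≤ S.card) {R : RatFunc ℂ} (hR : R * ∏ x ∈ S, lin x = invPoly P) (m : ℤ) :
    expandInf R m - expandZero R m = ∑ x ∈ S, resAt x R / x * x ^ m := by
  obtain ⟨c0, c, h⟩ := exists_partialFraction S h0 P hP
  rw [← hR, mul_div_cancel_right₀ _ (Finset.prod_ne_zero_iff.mpr fun x _ => lin_ne_zero x)] at h
  have hx0 : ∀ x ∈ S, x ≠ 0 := fun x hx hx' => h0 (hx' ▸ hx)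
  have hres : ∀ x ∈ S, resAt x R / x = c x := by
    intro x hx
    have hx' := hx0 x hx
    rw [h, resAt_add, resAt_of_ord_nonneg (ordAt_C x c0).ge, zero_add, resAt_sum]
    rw [Finset.sum_congr rfl fun y _ => by rw [resAt_C_mul, resAt_inv_lin hx']]
    rw [Finset.sum_eq_single x (fun y _ hy => by simp [hy]) (fun h => absurd hx h)]
    rw [if_pos rfl, mul_div_cancel_right₀ _ hx']
  rw [Finset.sum_congr rfl fun x hx => by rw [hres x hx], h, expandInf_add, expandZero_add,
    expandInf_C, expandZero_C, add_sub_add_left_eq_sub, expandInf_sum, expandZero_sum,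
    ← Finset.sum_sub_distrib]
  refine Finset.sum_congr rfl fun x hx => ?_
  rw [expandInf_C_mul, expandZero_C_mul, expandInf_inv_lin, expandZero_inv_lin (hx0 x hx)]
  split_ifs <;> ring

/-! ## Plane partitions as finite lower sets of boxes -/

/-- A box: layer, row, column. -/
abbrev Box : Type := ℕ × ℕ × ℕ

/-- A finite lower set of boxes. -/
def Low (S : Finset Box) : Prop := ∀ b ∈ S, ∀ c : Box, c ≤ b → c ∈ S

/-- The box `b` covers the box `c`: it is the next one in one of the three directions. -/
def Covers (b c : Box) : Prop :=
  b = (c.1 + 1, c.2.1, c.2.2) ∨ b = (c.1, c.2.1 + 1, c.2.2) ∨ b = (c.1, c.2.1, c.2.2 + 1)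

theorem Covers.le {b c : Box} (h : Covers b c) : c ≤ b := by
  obtain ⟨p, j, y⟩ := c
  rcases h with rfl | rfl | rfl <;> simp [Prod.mk_le_mk]

theorem Covers.ne {b c : Box} (h : Covers b c) : c ≠ b := by
  obtain ⟨p, j, y⟩ := c
  rcases h with rfl | rfl | rfl <;> simp

/-- A smaller box is reached by unit steps downwards; induction on the difference of the coordinate
sums. -/
theorem low_iff_covers {S : Finset Box} :
    Low S ↔ ∀ b ∈ S, ∀ c, Covers b c → c ∈ S := by
  refine ⟨fun h b hb c hc => h b hb c hc.le, fun h => ?_⟩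
  have key : ∀ m : ℕ, ∀ b ∈ S, ∀ c : Box, c ≤ b → b.1 + b.2.1 + b.2.2 = m + (c.1 + c.2.1 + c.2.2) →
      c ∈ S := by
    intro m
    induction m with
    | zero =>
      rintro ⟨p, j, y⟩ hb ⟨p', j', y'⟩ hc hm
      simp only [Prod.mk_le_mk] at hc
      obtain ⟨h1, h2, h3⟩ := hc
      simp only at hm
      obtain rfl : p' = p := by omega
      obtain rfl : j' = j := by omega
      obtain rfl : y' = y := by omega
      exact hb
    | succ m ih =>
      rintro ⟨p, j, y⟩ hb ⟨p', j', y'⟩ hc hm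
      simp only [Prod.mk_le_mk] at hc
      obtain ⟨h1, h2, h3⟩ := hc
      simp only at hm
      by_cases hp : p' < p
      · obtain ⟨p, rfl⟩ : ∃ a, p = a + 1 := ⟨p - 1, by omega⟩
        refine ih (p, j, y) (h _ hb _ (Or.inl rfl)) _ ?_ (by simp only; omega)
        simp only [Prod.mk_le_mk]; omega
      by_cases hj : j' < j
      · obtain ⟨j, rfl⟩ : ∃ a, j = a + 1 := ⟨j - 1, by omega⟩
        refine ih (p, j, y) (h _ hb _ (Or.inr (Or.inl rfl))) _ ?_ (by simp only; omega)
        simp only [Prod.mk_le_mk]; omega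
      · obtain ⟨y, rfl⟩ : ∃ a, y = a + 1 := ⟨y - 1, by omega⟩
        refine ih (p, j, y) (h _ hb _ (Or.inr (Or.inr rfl))) _ ?_ (by simp only; omega)
        simp only [Prod.mk_le_mk]; omega
  intro b hb c hc
  refine key (b.1 + b.2.1 + b.2.2 - (c.1 + c.2.1 + c.2.2)) b hb c hc ?_
  have := hc.1; have := hc.2.1; have := hc.2.2
  omega

theorem Low.inter {S T : Finset Box} (hS : Low S) (hT : Low T) : Low (S ∩ T) := fun b hb c hc =>
  Finset.mem_inter.mpr ⟨hS b (Finset.mem_inter.mp hb).1 c hc, hT b (Finset.mem_inter.mp hb).2 c hc⟩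

theorem Low.union {S T : Finset Box} (hS : Low S) (hT : Low T) : Low (S ∪ T) := fun b hb c hc =>
  (Finset.mem_union.mp hb).elim (fun h => Finset.mem_union_left _ (hS b h c hc))
    (fun h => Finset.mem_union_right _ (hT b h c hc))

/-- A set between two lower sets is a lower set iff it is closed under predecessors. -/
theorem Low.between {T U S : Finset Box} (hT : Low T) (hS : Low S) (hTU : T ⊆ U) (hUS : U ⊆ S) :
    Low U ↔ ∀ b ∈ U \ T, ∀ c ∈ S \ U, ¬ Covers b c := by
  rw [low_iff_covers]
  constructor
  · intro h b hb c hc hbc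
    exact (Finset.mem_sdiff.mp hc).2 (h b (Finset.mem_sdiff.mp hb).1 c hbc)
  · intro h b hb c hbc
    by_contra hc
    by_cases hbT : b ∈ T
    · exact hc (hTU (hT b hbT c hbc.le))
    · exact h b (Finset.mem_sdiff.mpr ⟨hb, hbT⟩) c
        (Finset.mem_sdiff.mpr ⟨hS b (hUS hb) c hbc.le, hc⟩) hbc

namespace PlanePartition

theorem row_le_of_le (L : PlanePartition) {p p' j j' : ℕ} (hp : p ≤ p') (hj : j ≤ j') :
    L.row p' j' ≤ L.row p j :=
  (antitone_nat_of_succ_le (f := fun p => L.row p j') (fun p => L.layer_anti p j') hp).trans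
    (antitone_nat_of_succ_le (f := fun j => L.row p j) (fun j => L.row_anti p j) hj)

theorem finite_boxes (L : PlanePartition) : {b : Box | b.2.2 < L.row b.1 b.2.1}.Finite := by
  have : {b : Box | b.2.2 < L.row b.1 b.2.1} ⊆
      (fun x : (ℕ × ℕ) × ℕ => (x.1.1, x.1.2, x.2)) ''
        ({pj : ℕ × ℕ | L.row pj.1 pj.2 ≠ 0} ×ˢ {y | y < L.row 0 0}) := by
    rintro ⟨p, j, y⟩ hb
    simp only [Set.mem_ofPred_eq] at hb
    refine ⟨((p, j), y), ⟨?_, ?_⟩, rfl⟩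
    · simp only [Set.mem_ofPred_eq]; omega
    · exact hb.trans_le (L.row_le_of_le (Nat.zero_le p) (Nat.zero_le j))
  exact ((L.finite_support.prod (Set.finite_lt_nat _)).image _).subset this

/-- The set of boxes of a plane partition. -/
def boxes (L : PlanePartition) : Finset Box := L.finite_boxes.toFinset

theorem mem_boxes {L : PlanePartition} {b : Box} : b ∈ L.boxes ↔ b.2.2 < L.row b.1 b.2.1 := by
  simp [boxes]

theorem low_boxes (L : PlanePartition) : Low L.boxes := by
  rintro ⟨p, j, y⟩ hb ⟨p', j', y'⟩ hc
  simp only [mem_boxes, Prod.mk_le_mk] at *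
  have := L.row_le_of_le hc.1 hc.2.1
  omega

theorem boxes_injective : Function.Injective boxes := by
  intro L M h
  ext p j
  have h' : ∀ y, y < L.row p j ↔ y < M.row p j := fun y => by
    have := Finset.ext_iff.mp h (p, j, y)
    simpa [mem_boxes] using this
  have h1 := h' (L.row p j)
  have h2 := h' (M.row p j)
  omega

theorem exists_notMem (S : Finset Box) (p j : ℕ) : ∃ y, (p, j, y) ∉ S := by
  obtain ⟨y, hy⟩ := Infinite.exists_notMem_finset (S.image fun b => b.2.2)
  exact ⟨y, fun h => hy (Finset.mem_image.mpr ⟨_, h, rfl⟩)⟩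

open Classical in
-- In a lower set the columns occupied in a row form an initial segment, so the first missing column
-- is the length of the row.
theorem lt_find_iff {S : Finset Box} (hS : Low S) (p j y : ℕ) :
    y < Nat.find (exists_notMem S p j) ↔ (p, j, y) ∈ S := by
  rw [Nat.lt_find_iff]
  refine ⟨fun h => not_not.mp (h y le_rfl), fun h m hm => not_not.mpr (hS _ h _ ?_)⟩
  simp [Prod.mk_le_mk, hm]

open Classical in
/-- The plane partition with a given set of boxes. -/
def ofLow (S : Finset Box) (hS : Low S) : PlanePartition where
  row p j := Nat.find (exists_notMem S p j)
  row_anti p j := by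
    by_contra! h
    rw [lt_find_iff hS] at h
    refine Nat.find_spec (exists_notMem S p j) (hS _ h _ ?_)
    simp [Prod.mk_le_mk]
  layer_anti p j := by
    by_contra! h
    rw [lt_find_iff hS] at h
    refine Nat.find_spec (exists_notMem S p j) (hS _ h _ ?_)
    simp [Prod.mk_le_mk]
  finite_support := by
    refine (S.image fun b => (b.1, b.2.1)).finite_toSet.subset ?_
    rintro ⟨p, j⟩ h
    simp only [Set.mem_ofPred_eq] at h
    have := (lt_find_iff hS p j 0).mp (Nat.pos_of_ne_zero h)
    exact Finset.mem_coe.mpr (Finset.mem_image.mpr ⟨_, this, rfl⟩)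

@[simp]
theorem boxes_ofLow {S : Finset Box} (hS : Low S) : (ofLow S hS).boxes = S := by
  ext ⟨p, j, y⟩
  rw [mem_boxes]
  exact lt_find_iff hS p j y

@[simp]
theorem ofLow_boxes (L : PlanePartition) : ofLow L.boxes L.low_boxes = L :=
  boxes_injective (boxes_ofLow _)

@[simp]
theorem boxes_empty : PlanePartition.empty.boxes = ∅ := by
  ext b
  simp [mem_boxes, PlanePartition.empty]

theorem AddBox.boxes_eq {L M : PlanePartition} {p j : ℕ} (h : L.AddBox M p j) :
    M.boxes = insert (p, j, L.row p j) L.boxes ∧ (p, j, L.row p j) ∉ L.boxes := by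
  refine ⟨?_, by simp [mem_boxes]⟩
  ext ⟨p', j', y⟩
  rw [Finset.mem_insert, mem_boxes, mem_boxes, Prod.mk.injEq, Prod.mk.injEq]
  simp only [h p' j']
  by_cases hpj : p' = p ∧ j' = j
  · obtain ⟨rfl, rfl⟩ := hpj
    simp; omega
  · rw [if_neg hpj]
    have : ¬ (p' = p ∧ j' = j ∧ y = L.row p j) := fun h => hpj ⟨h.1, h.2.1⟩
    simp [this]

theorem addBox_of_boxes_eq {L M : PlanePartition} {b : Box} (hb : b ∉ L.boxes)
    (h : M.boxes = insert b L.boxes) : L.AddBox M b.1 b.2.1 ∧ L.row b.1 b.2.1 = b.2.2 := by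
  obtain ⟨p, j, y⟩ := b
  have h1 : ∀ p' j' y', y' < M.row p' j' ↔ (p' = p ∧ j' = j ∧ y' = y) ∨ y' < L.row p' j' := by
    intro p' j' y'
    have := Finset.ext_iff.mp h (p', j', y')
    simpa [mem_boxes] using this
  have h2 : L.row p j ≤ y := by simpa [mem_boxes] using hb
  have h3 := h1 p j
  simp only [true_and] at h3
  have h4 : L.row p j = y := by
    by_contra hne
    have a1 := (h3 y).mpr (Or.inl rfl)
    have a2 := (h3 (L.row p j)).mp (by omega)
    omega
  refine ⟨fun p' j' => ?_, h4⟩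
  have h5 := h1 p' j'
  simp only
  split_ifs with hpj
  · obtain ⟨rfl, rfl⟩ := hpj
    have a1 := h3 (L.row p' j')
    have a2 := h3 (L.row p' j' + 1)
    have a3 := h3 y
    omega
  · have a1 := h5 (L.row p' j')
    have a2 := h5 (M.row p' j')
    have a3 : ∀ z, ¬ (p' = p ∧ j' = j ∧ z = y) := fun z h => hpj ⟨h.1, h.2.1⟩
    have a4 := a3 (L.row p' j')
    have a5 := a3 (M.row p' j')
    omega

end PlanePartition

open PlanePartition

/-! ## Vectors labeled by finite sets of boxes -/

open Classical in
/-- The basis vector of a finite lower set, zero for other sets. -/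
def kv (S : Finset Box) : Macmahon := if h : Low S then ket (ofLow S h) else 0

theorem kv_boxes (L : PlanePartition) : kv L.boxes = ket L := by
  rw [kv, dif_pos L.low_boxes, ofLow_boxes]

theorem kv_of_not_low {S : Finset Box} (h : ¬ Low S) : kv S = 0 := dif_neg h

theorem kv_apply (S : Finset Box) (L : PlanePartition) : kv S L = if S = L.boxes then 1 else 0 := by
  classical
  by_cases h : Low S
  · rw [kv, dif_pos h, ket, Finsupp.single_apply]
    congr 1
    rw [eq_iff_iff]
    exact ⟨fun h' => by rw [← h', boxes_ofLow], fun h' => boxes_injective (by rw [boxes_ofLow, h'])⟩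
  · rw [kv_of_not_low h, if_neg fun h' : S = L.boxes => h (h' ▸ L.low_boxes)]
    rfl

theorem kv_empty : kv ∅ = ket PlanePartition.empty := by
  rw [← boxes_empty, kv_boxes]

theorem low_empty : Low ∅ := fun _ h => absurd h (Finset.notMem_empty _)

theorem macmahon_hom_ext {V : Type*} [AddCommGroup V] [Module ℂ V] {f g : Macmahon →ₗ[ℂ] V}
    (h : ∀ S, Low S → f (kv S) = g (kv S)) : f = g := by
  refine Finsupp.lhom_ext' fun L => LinearMap.ext_ring ?_
  have := h L.boxes L.low_boxes
  rwa [kv_boxes] at this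

/-- Linear maps are given by their values on basis vectors. -/
def liftKv (f : Finset Box → Macmahon) : Module.End ℂ Macmahon :=
  Finsupp.lift Macmahon ℂ PlanePartition fun L => f L.boxes

theorem liftKv_ket (f : Finset Box → Macmahon) (L : PlanePartition) :
    liftKv f (ket L) = f L.boxes := by
  simp [liftKv, ket]

theorem liftKv_kv (f : Finset Box → Macmahon) {S : Finset Box} (h : Low S) :
    liftKv f (kv S) = f S := by
  rw [kv, dif_pos h, liftKv_ket, boxes_ofLow]

/-- The boxes which can be added to `S`. -/
def addable (S : Finset Box) : Finset Box := by
  classical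
  exact ((insert (0, 0, 0) (S.image (fun b => (b.1 + 1, b.2.1, b.2.2)) ∪
    S.image (fun b => (b.1, b.2.1 + 1, b.2.2)) ∪
    S.image (fun b => (b.1, b.2.1, b.2.2 + 1)))).filter fun b => b ∉ S ∧ Low (insert b S))

/-- The explicit list of candidates in `addable` loses nothing: a box that can be added is the
origin or covers a box of `S`. -/
theorem mem_addable {S : Finset Box} {b : Box} : b ∈ addable S ↔ b ∉ S ∧ Low (insert b S) := by
  classical
  rw [addable, Finset.mem_filter, and_iff_right_iff_imp]
  rintro ⟨hb, hl⟩
  obtain ⟨p, j, y⟩ := b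
  have aux : ∀ c, Covers (p, j, y) c → c ∈ S := fun c hc =>
    (Finset.mem_insert.mp (hl _ (Finset.mem_insert_self _ _) c hc.le)).resolve_left hc.ne
  simp only [Finset.mem_insert, Finset.mem_union, Finset.mem_image]
  rcases p with _ | p
  · rcases j with _ | j
    · rcases y with _ | y
      · exact Or.inl rfl
      · exact Or.inr (Or.inr ⟨(0, 0, y), aux _ (Or.inr (Or.inr rfl)), rfl⟩)
    · exact Or.inr (Or.inl (Or.inr ⟨(0, j, y), aux _ (Or.inr (Or.inl rfl)), rfl⟩))
  · exact Or.inr (Or.inl (Or.inl ⟨(p, j, y), aux _ (Or.inl rfl), rfl⟩))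

/-! ## Operators adding and removing boxes -/

section Operators

variable {n : ℕ} (x : Box → ℂ) (col : Box → ZMod n) (w : Finset Box → Box → ℂ)

/-- The operator removing boxes of color `i`. -/
def Dn (i : ZMod n) (m : ℤ) : Module.End ℂ Macmahon :=
  liftKv fun S => ∑ b ∈ S, if col b = i then (x b ^ m * w (S.erase b) b) • kv (S.erase b) else 0

/-- The operator adding boxes of color `i`. -/
def Up (i : ZMod n) (m : ℤ) : Module.End ℂ Macmahon :=
  liftKv fun S => ∑ b ∈ addable S, if col b = i then (x b ^ m * w S b) • kv (insert b S) else 0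

theorem Dn_kv {S : Finset Box} (hS : Low S) (i : ZMod n) (m : ℤ) :
    Dn x col w i m (kv S) = ∑ b ∈ S, if col b = i then
      (x b ^ m * w (S.erase b) b) • kv (S.erase b) else 0 :=
  liftKv_kv _ hS

theorem Up_kv {S : Finset Box} (hS : Low S) (i : ZMod n) (m : ℤ) :
    Up x col w i m (kv S) = ∑ b ∈ addable S, if col b = i then
      (x b ^ m * w S b) • kv (insert b S) else 0 :=
  liftKv_kv _ hS

/-- The sum stays over all of `S`, so that iterated removals have a fixed index set and can be
compared term by term after renaming variables. -/
theorem Dn_kv_erase {S : Finset Box} (c : Box) (i : ZMod n) (m : ℤ) [Decidable (Low (S.erase c))] :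
    Dn x col w i m (kv (S.erase c)) = ∑ b ∈ S, if Low (S.erase c) ∧ b ≠ c ∧ col b = i then
      (x b ^ m * w ((S.erase c).erase b) b) • kv ((S.erase c).erase b) else 0 := by
  by_cases h : Low (S.erase c)
  · rw [Dn_kv x col w h, Finset.sum_congr (Finset.filter_ne' S c).symm fun _ _ => rfl,
      Finset.sum_filter]
    refine Finset.sum_congr rfl fun b _ => ?_
    by_cases hb : b = c <;> simp [hb, h]
  · simp [h, kv_of_not_low h]

open Classical in
/-- The weight of the path from `T` which adds `a` and then `b`. -/
def pathTwo (T : Finset Box) (a b : Box) : ℂ :=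
  if Low (insert a T) then w T a * w (insert a T) b else 0

open Classical in
/-- The weight of the path from `T` which adds `a`, then `b`, then `c`. -/
def pathThree (T : Finset Box) (a b c : Box) : ℂ :=
  if Low (insert a T) ∧ Low (insert b (insert a T)) then
    w T a * w (insert a T) b * w (insert b (insert a T)) c else 0

/-- Removing `b` and then `a` is read backwards, as adding `a` and then `b` to `S \ {a, b}`. A
forbidden intermediate set gives zero on both sides, through `kv` and through `pathTwo`. -/
theorem Dn_Dn_kv {S : Finset Box} (hS : Low S) (i j : ZMod n) (r s : ℤ) :
    (Dn x col w i r * Dn x col w j s) (kv S) = ∑ a ∈ S, ∑ b ∈ S,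
      if a ≠ b ∧ col a = i ∧ col b = j then
        (x a ^ r * x b ^ s * pathTwo w (S \ {a, b}) a b) • kv (S \ {a, b}) else 0 := by
  classical
  rw [Module.End.mul_apply, Dn_kv x col w hS, map_sum, Finset.sum_comm]
  refine Finset.sum_congr rfl fun b hb => ?_
  split_ifs with hj
  · rw [map_smul, Dn_kv_erase, Finset.smul_sum]
    refine Finset.sum_congr rfl fun a ha => ?_
    by_cases hab : a = b
    · simp [hab]
    by_cases hi : col a = i
    swap
    · simp [hi]
    have h1 : (S.erase b).erase a = S \ {a, b} := by ext; simp; tauto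
    have h2 : insert a (S \ {a, b}) = S.erase b := by
      ext c; by_cases hc : c = a
      · subst hc; simp [ha, hab]
      · simp [hc]; tauto
    rw [h1]
    by_cases hl : Low (S.erase b)
    · rw [if_pos ⟨hl, hab, hi⟩, if_pos ⟨hab, hi, hj⟩, smul_smul, pathTwo, h2, if_pos hl]
      congr 1; ring
    · rw [if_neg fun h => hl h.1, if_pos ⟨hab, hi, hj⟩, pathTwo, h2, if_neg hl]
      simp
  · simp [hj]

theorem Dn_Dn_Dn_kv {S : Finset Box} (hS : Low S) (i j k : ZMod n) (r s t : ℤ) :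
    (Dn x col w i r * Dn x col w j s * Dn x col w k t) (kv S) = ∑ a ∈ S, ∑ b ∈ S, ∑ c ∈ S,
      if (a ≠ b ∧ a ≠ c ∧ b ≠ c) ∧ col a = i ∧ col b = j ∧ col c = k then
        (x a ^ r * x b ^ s * x c ^ t * pathThree w (S \ {a, b, c}) a b c) • kv (S \ {a, b, c})
      else 0 := by
  classical
  -- The box `c` is removed first, so its sum has to be outermost.
  have hr : ∀ f : Box → Box → Box → Macmahon,
      ∑ a ∈ S, ∑ b ∈ S, ∑ c ∈ S, f a b c = ∑ c ∈ S, ∑ a ∈ S, ∑ b ∈ S, f a b c := by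
    intro f
    rw [Finset.sum_comm' (s := S) (t := fun _ => S) (t' := S) (s' := fun _ => S) (by tauto)]
    rw [Finset.sum_congr rfl fun _ _ => Finset.sum_comm]
    rw [Finset.sum_comm]
    exact Finset.sum_congr rfl fun _ _ => Finset.sum_comm
  rw [Module.End.mul_apply, Dn_kv x col w hS, map_sum, hr]
  refine Finset.sum_congr rfl fun c hc => ?_
  split_ifs with hk
  swap
  · simp [hk]
  rw [map_smul]
  by_cases hl : Low (S.erase c)
  swap
  · rw [kv_of_not_low hl, map_zero, smul_zero]
    refine (Finset.sum_eq_zero fun a ha => Finset.sum_eq_zero fun b hb => ?_).symm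
    split_ifs with h
    · obtain ⟨⟨hab, hac, hbc⟩, -, -, -⟩ := h
      have h2 : insert b (insert a (S \ {a, b, c})) = S.erase c := by
        ext d; by_cases hd : d = a
        · subst hd; simp [ha, hac]
        · by_cases hd' : d = b
          · subst hd'; simp [hb, hbc]
          · simp [hd, hd']; tauto
      rw [pathThree, h2, if_neg fun h => hl h.2]
      simp
    · rfl
  rw [Dn_Dn_kv x col w hl, Finset.smul_sum, ← Finset.filter_ne', Finset.sum_filter]
  refine Finset.sum_congr rfl fun a ha => ?_
  by_cases hac : a = c
  · simp [hac]
  rw [if_pos hac, Finset.smul_sum, Finset.sum_filter]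
  refine Finset.sum_congr rfl fun b hb => ?_
  by_cases hbc : b = c
  · simp [hbc]
  rw [if_pos hbc]
  by_cases h : a ≠ b ∧ col a = i ∧ col b = j
  swap
  · rw [if_neg h, if_neg (by tauto), smul_zero]
  rw [if_pos h, if_pos (by tauto), smul_smul, Finset.filter_ne']
  have h1 : (S.erase c) \ {a, b} = S \ {a, b, c} := by ext; simp; tauto
  have h2 : insert b (insert a (S \ {a, b, c})) = S.erase c := by
    ext d; by_cases hd : d = a
    · subst hd; simp [ha, hac]
    · by_cases hd' : d = b
      · subst hd'; simp [hb, hbc]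
      · simp [hd, hd']; tauto
  rw [h1, pathThree, h2, pathTwo]
  congr 1
  simp only [hl, and_true]
  split_ifs <;> ring

/-- The mode `m` enters only through `x b ^ m`, so raising a mode multiplies a term by the position
of its box. The relation between currents thus reduces to one identity between the two orders of
adding the same pair. -/
theorem Dn_quadratic {i j : ZMod n} {α β γ δ : ℂ}
    (hx : ∀ b, x b ≠ 0)
    (h : ∀ T a b, Low T → Low (insert a (insert b T)) → a ∉ T → b ∉ T → a ≠ b → col a = i →
      col b = j →
      (α * x a - β * x b) * pathTwo w T a b = (γ * x a - δ * x b) * pathTwo w T b a) (r s : ℤ) :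
    α • (Dn x col w i (r + 1) * Dn x col w j s) - β • (Dn x col w i r * Dn x col w j (s + 1)) =
      γ • (Dn x col w j s * Dn x col w i (r + 1)) - δ • (Dn x col w j (s + 1) * Dn x col w i r) := by
  classical
  refine macmahon_hom_ext fun S hS => ?_
  simp only [LinearMap.sub_apply, LinearMap.smul_apply, Dn_Dn_kv x col w hS]
  -- On the right-hand side the factor of color `j` stands first; exchanging the sums gives `a` the
  -- color `i` everywhere.
  rw [Finset.sum_comm (s := S) (t := S) (f := fun a b => if a ≠ b ∧ col a = j ∧ col b = i then _ else _),
    Finset.sum_comm (s := S) (t := S) (f := fun a b => if a ≠ b ∧ col a = j ∧ col b = i then _ else _)]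
  simp only [Finset.smul_sum, ← Finset.sum_sub_distrib]
  refine Finset.sum_congr rfl fun a ha => Finset.sum_congr rfl fun b hb => ?_
  by_cases hc : a ≠ b ∧ col a = i ∧ col b = j
  swap
  · rw [if_neg hc, if_neg hc, if_neg (by tauto), if_neg (by tauto)]; simp
  rw [if_pos hc, if_pos hc, if_pos (by tauto), if_pos (by tauto), Finset.pair_comm b a]
  by_cases hl : Low (S \ {a, b})
  swap
  · simp [kv_of_not_low hl]
  have h2 : insert a (insert b (S \ {a, b})) = S := by
    ext d; by_cases hd : d = a
    · subst hd; simp [ha]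
    · by_cases hd' : d = b
      · subst hd'; simp [hb]
      · simp [hd, hd']
  have := h (S \ {a, b}) a b hl (h2.symm ▸ hS) (by simp) (by simp) hc.1 hc.2.1 hc.2.2
  simp only [smul_smul, ← sub_smul, zpow_add_one₀ (hx _)]
  congr 1
  linear_combination (x a ^ r * x b ^ s) * this

theorem Dn_comm {i j : ZMod n}
    (h : ∀ T a b, Low T → Low (insert a (insert b T)) → a ∉ T → b ∉ T → a ≠ b → col a = i →
      col b = j → pathTwo w T a b = pathTwo w T b a) (r s : ℤ) :
    Dn x col w i r * Dn x col w j s = Dn x col w j s * Dn x col w i r := by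
  classical
  refine macmahon_hom_ext fun S hS => ?_
  rw [Dn_Dn_kv x col w hS, Dn_Dn_kv x col w hS, Finset.sum_comm]
  refine Finset.sum_congr rfl fun b hb => Finset.sum_congr rfl fun a ha => ?_
  by_cases hc : a ≠ b ∧ col a = i ∧ col b = j
  swap
  · rw [if_neg hc, if_neg (by tauto)]
  rw [if_pos hc, if_pos (by tauto), Finset.pair_comm b a]
  by_cases hl : Low (S \ {a, b})
  swap
  · simp [kv_of_not_low hl]
  have h2 : insert a (insert b (S \ {a, b})) = S := by
    ext d; by_cases hd : d = a
    · subst hd; simp [ha]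
    · by_cases hd' : d = b
      · subst hd'; simp [hb]
      · simp [hd, hd']
  rw [h (S \ {a, b}) a b hl (h2.symm ▸ hS) (by simp) (by simp) hc.1 hc.2.1 hc.2.2]
  congr 1; ring

/-- The cubic Serre expression for operators. -/
def serreOp (q : ℂ) (X : ZMod n → ℤ → Module.End ℂ Macmahon) (i j : ZMod n) (r₁ r₂ s : ℤ) :
    Module.End ℂ Macmahon :=
  X i r₁ * X i r₂ * X j s - (q + q⁻¹) • (X i r₁ * X j s * X i r₂) + X j s * X i r₁ * X i r₂

/-- The hypothesis runs over the six orders of adding `a`, `b`, `c`; symmetrizing in `r₁`, `r₂`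
corresponds to exchanging the two boxes of color `i`, so the monomial in the positions is a common
factor. -/
theorem Dn_serre {q : ℂ} {i j : ZMod n}
    (h : ∀ T a b c, Low T → Low (insert a (insert b (insert c T))) → a ∉ T → b ∉ T → c ∉ T →
      a ≠ b → a ≠ c → b ≠ c → col a = i → col b = i → col c = j →
      pathThree w T a b c - (q + q⁻¹) * pathThree w T a c b + pathThree w T c a b +
      (pathThree w T b a c - (q + q⁻¹) * pathThree w T b c a + pathThree w T c b a) = 0)
    (r₁ r₂ s : ℤ) :
    serreOp q (Dn x col w) i j r₁ r₂ s + serreOp q (Dn x col w) i j r₂ r₁ s = 0 := by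
  classical
  refine macmahon_hom_ext fun S hS => ?_
  have p12 : ∀ f : Box → Box → Box → Macmahon,
      ∑ a ∈ S, ∑ b ∈ S, ∑ c ∈ S, f a b c = ∑ a ∈ S, ∑ b ∈ S, ∑ c ∈ S, f b a c :=
    fun f => Finset.sum_comm
  have p23 : ∀ f : Box → Box → Box → Macmahon,
      ∑ a ∈ S, ∑ b ∈ S, ∑ c ∈ S, f a b c = ∑ a ∈ S, ∑ b ∈ S, ∑ c ∈ S, f a c b :=
    fun f => Finset.sum_congr rfl fun _ _ => Finset.sum_comm
  -- In all six sums the variables are renamed so that `a` carries `r₁`, `b` carries `r₂` and `c`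
  -- carries `s`.
  have e1 := Dn_Dn_Dn_kv x col w hS i i j r₁ r₂ s
  have e2 := Dn_Dn_Dn_kv x col w hS i j i r₁ s r₂
  rw [p23] at e2
  have e3 := Dn_Dn_Dn_kv x col w hS j i i s r₁ r₂
  rw [p12, p23] at e3
  have e4 := Dn_Dn_Dn_kv x col w hS i i j r₂ r₁ s
  rw [p12] at e4
  have e5 := Dn_Dn_Dn_kv x col w hS i j i r₂ s r₁
  rw [p23, p12] at e5
  have e6 := Dn_Dn_Dn_kv x col w hS j i i s r₂ r₁
  rw [p12, p23, p12] at e6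
  simp only [serreOp, LinearMap.add_apply, LinearMap.sub_apply, LinearMap.smul_apply,
    LinearMap.zero_apply]
  rw [e1, e2, e3, e4, e5, e6]
  simp only [Finset.smul_sum, ← Finset.sum_sub_distrib, ← Finset.sum_add_distrib]
  refine Finset.sum_eq_zero fun a ha => Finset.sum_eq_zero fun b hb =>
    Finset.sum_eq_zero fun c hc => ?_
  by_cases hcond : (a ≠ b ∧ a ≠ c ∧ b ≠ c) ∧ col a = i ∧ col b = i ∧ col c = j
  swap
  · rw [if_neg hcond, if_neg (by tauto), if_neg (by tauto), if_neg (by tauto), if_neg (by tauto),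
      if_neg (by tauto)]
    simp
  have s1 : ({a, c, b} : Finset Box) = {a, b, c} := by ext; simp; tauto
  have s2 : ({c, a, b} : Finset Box) = {a, b, c} := by ext; simp; tauto
  have s3 : ({b, a, c} : Finset Box) = {a, b, c} := by ext; simp; tauto
  have s4 : ({b, c, a} : Finset Box) = {a, b, c} := by ext; simp; tauto
  have s5 : ({c, b, a} : Finset Box) = {a, b, c} := by ext; simp; tauto
  rw [if_pos hcond, if_pos (by tauto), if_pos (by tauto), if_pos (by tauto), if_pos (by tauto),
    if_pos (by tauto), s1, s2, s3, s4, s5]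
  by_cases hl : Low (S \ {a, b, c})
  swap
  · simp [kv_of_not_low hl]
  have h2 : insert a (insert b (insert c (S \ {a, b, c}))) = S := by
    ext d; by_cases hd : d = a
    · subst hd; simp [ha]
    · by_cases hd' : d = b
      · subst hd'; simp [hb]
      · by_cases hd'' : d = c
        · subst hd''; simp [hc]
        · simp [hd, hd', hd'']
  obtain ⟨⟨hab, hac, hbc⟩, h3, h4, h5⟩ := hcond
  have := h (S \ {a, b, c}) a b c hl (h2.symm ▸ hS) (by simp) (by simp) (by simp) hab hac hbc
    h3 h4 h5
  simp only [smul_smul, ← sub_smul, ← add_smul]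
  convert zero_smul ℂ _
  linear_combination (x a ^ r₁ * x b ^ r₂ * x c ^ s) * this

/-! ## Adjointness -/

/-- `X` and `Y` are transposed to each other. -/
def Adj (X Y : Module.End ℂ Macmahon) : Prop := ∀ L M, X (ket L) M = Y (ket M) L

theorem apply_apply_eq_sum (X : Module.End ℂ Macmahon) (v : Macmahon) (M : PlanePartition) :
    X v M = v.sum fun P c => c * X (ket P) M := by
  conv_lhs => rw [← Finsupp.sum_single v, Finsupp.sum, map_sum, Finsupp.finsetSum_apply]
  refine Finset.sum_congr rfl fun P _ => ?_
  have : (Finsupp.single P (v P) : Macmahon) = v P • ket P := by simp [ket]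
  rw [this, map_smul, Finsupp.smul_apply, smul_eq_mul]

/-- Matrix entries of both products are sums over intermediate basis vectors, finite on either side;
they are compared on the union of the two supports. -/
theorem Adj.mul {X Y X' Y' : Module.End ℂ Macmahon} (h : Adj X Y) (h' : Adj X' Y') :
    Adj (X * X') (Y' * Y) := by
  classical
  intro L M
  rw [Module.End.mul_apply, Module.End.mul_apply, apply_apply_eq_sum X, apply_apply_eq_sum Y']
  have h1 : ((X' (ket L)).sum fun P c => c * X (ket P) M) =
      (X' (ket L)).sum fun P c => c * Y (ket M) P := by
    simp only [h _ M]
  have h2 : ((Y (ket M)).sum fun P c => c * Y' (ket P) L) =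
      (Y (ket M)).sum fun P c => c * X' (ket L) P := by
    simp only [← h' L _]
  rw [h1, h2, Finsupp.sum_of_support_subset _ (s := (X' (ket L)).support ∪ (Y (ket M)).support)
    Finset.subset_union_left _ (by simp),
    Finsupp.sum_of_support_subset _ (s := (X' (ket L)).support ∪ (Y (ket M)).support)
    Finset.subset_union_right _ (by simp)]
  exact Finset.sum_congr rfl fun _ _ => mul_comm _ _

theorem Adj.add {X Y X' Y' : Module.End ℂ Macmahon} (h : Adj X Y) (h' : Adj X' Y') :
    Adj (X + X') (Y + Y') := fun L M => by simp [h L M, h' L M]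

theorem Adj.sub {X Y X' Y' : Module.End ℂ Macmahon} (h : Adj X Y) (h' : Adj X' Y') :
    Adj (X - X') (Y - Y') := fun L M => by simp [h L M, h' L M]

theorem Adj.smul {X Y : Module.End ℂ Macmahon} (c : ℂ) (h : Adj X Y) :
    Adj (c • X) (c • Y) := fun L M => by simp [h L M]

theorem Adj.left_unique {X X' Y : Module.End ℂ Macmahon} (h : Adj X Y) (h' : Adj X' Y) : X = X' :=
  macmahon_hom_ext fun S hS => Finsupp.ext fun M => by
    rw [kv, dif_pos hS, h, h']

/-- With the same weight `w`, adding `b` to `L` and removing it from `L ∪ {b}` have the same matrix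
entry. Relations for lowering operators therefore give relations for raising operators; the actual
`E` and `F` use the two different weights `wE` and `wF`. -/
theorem adj_Up_Dn (i : ZMod n) (m : ℤ) : Adj (Up x col w i m) (Dn x col w i m) := by
  classical
  intro L M
  rw [← kv_boxes, ← kv_boxes, Up_kv x col w L.low_boxes, Dn_kv x col w M.low_boxes,
    Finsupp.finsetSum_apply, Finsupp.finsetSum_apply]
  have aux : ∀ (p : Prop) [Decidable p] (v : Macmahon) (N : PlanePartition),
      (if p then v else 0) N = if p then v N else 0 := fun p _ v N => by split_ifs <;> rfl
  simp only [aux, Finsupp.smul_apply, kv_apply, smul_eq_mul]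
  have key : ∀ b, (b ∈ addable L.boxes ∧ insert b L.boxes = M.boxes) ↔
      (b ∈ M.boxes ∧ M.boxes.erase b = L.boxes) := by
    intro b
    rw [mem_addable]
    constructor
    · rintro ⟨⟨h1, h2⟩, h3⟩
      rw [← h3]
      exact ⟨Finset.mem_insert_self _ _, Finset.erase_insert h1⟩
    · rintro ⟨h1, h2⟩
      have h3 : insert b L.boxes = M.boxes := by rw [← h2, Finset.insert_erase h1]
      exact ⟨⟨by rw [← h2]; simp, h3 ▸ M.low_boxes⟩, h3⟩
  have e1 : ∀ b ∈ addable L.boxes, (if col b = i then x b ^ m * w L.boxes b *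
        (if insert b L.boxes = M.boxes then 1 else 0) else 0) =
      if (insert b L.boxes = M.boxes) then (if col b = i then x b ^ m * w L.boxes b else 0) else 0 := by
    intro b _; split_ifs <;> simp
  have e2 : ∀ b ∈ M.boxes, (if col b = i then x b ^ m * w (M.boxes.erase b) b *
        (if M.boxes.erase b = L.boxes then 1 else 0) else 0) =
      if (M.boxes.erase b = L.boxes) then (if col b = i then x b ^ m * w L.boxes b else 0) else 0 := by
    intro b _; split_ifs with h1 h2 <;> simp_all
  rw [Finset.sum_congr rfl e1, Finset.sum_congr rfl e2,
    ← Finset.sum_filter (fun b => insert b L.boxes = M.boxes),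
    ← Finset.sum_filter (fun b => M.boxes.erase b = L.boxes)]
  refine Finset.sum_congr (Finset.ext fun b => ?_) fun _ _ => rfl
  rw [Finset.mem_filter, Finset.mem_filter, key]

theorem Up_quadratic {i j : ZMod n} {α β γ δ : ℂ}
    (hx : ∀ b, x b ≠ 0)
    (h : ∀ T a b, Low T → Low (insert a (insert b T)) → a ∉ T → b ∉ T → a ≠ b → col a = i →
      col b = j →
      (α * x a - β * x b) * pathTwo w T b a = (γ * x a - δ * x b) * pathTwo w T a b) (r s : ℤ) :
    α • (Up x col w i (r + 1) * Up x col w j s) - β • (Up x col w i r * Up x col w j (s + 1)) =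
      γ • (Up x col w j s * Up x col w i (r + 1)) - δ • (Up x col w j (s + 1) * Up x col w i r) := by
  have a := adj_Up_Dn x col w
  -- Transposition reverses products, so `(α, β)` and `(γ, δ)` exchange their roles.
  have e := Dn_quadratic x col w hx (α := γ) (β := δ) (γ := α) (δ := β) (i := i) (j := j)
    (fun T a b h1 h2 h3 h4 h5 h6 h7 => (h T a b h1 h2 h3 h4 h5 h6 h7).symm) r s
  refine Adj.left_unique ((((a i _).mul (a j _)).smul α).sub (((a i _).mul (a j _)).smul β)) ?_
  rw [← e]
  exact (((a j _).mul (a i _)).smul γ).sub (((a j _).mul (a i _)).smul δ)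

theorem Up_comm {i j : ZMod n}
    (h : ∀ T a b, Low T → Low (insert a (insert b T)) → a ∉ T → b ∉ T → a ≠ b → col a = i →
      col b = j → pathTwo w T a b = pathTwo w T b a) (r s : ℤ) :
    Up x col w i r * Up x col w j s = Up x col w j s * Up x col w i r := by
  have a := adj_Up_Dn x col w
  refine Adj.left_unique ((a i r).mul (a j s)) ?_
  rw [← Dn_comm x col w h]
  exact (a j s).mul (a i r)

theorem Up_serre {q : ℂ} {i j : ZMod n}
    (h : ∀ T a b c, Low T → Low (insert a (insert b (insert c T))) → a ∉ T → b ∉ T → c ∉ T →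
      a ≠ b → a ≠ c → b ≠ c → col a = i → col b = i → col c = j →
      pathThree w T a b c - (q + q⁻¹) * pathThree w T a c b + pathThree w T c a b +
      (pathThree w T b a c - (q + q⁻¹) * pathThree w T b c a + pathThree w T c b a) = 0)
    (r₁ r₂ s : ℤ) :
    serreOp q (Up x col w) i j r₁ r₂ s + serreOp q (Up x col w) i j r₂ r₁ s = 0 := by
  have a := adj_Up_Dn x col w
  have key : ∀ r₁ r₂, Adj (serreOp q (Up x col w) i j r₁ r₂ s)
      (serreOp q (Dn x col w) i j r₂ r₁ s) := by
    intro r₁ r₂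
    have h1 := ((a i r₁).mul (a i r₂)).mul (a j s)
    have h2 := (((a i r₁).mul (a j s)).mul (a i r₂)).smul (q + q⁻¹)
    have h3 := ((a j s).mul (a i r₁)).mul (a i r₂)
    have := (h1.sub h2).add h3
    have e : serreOp q (Dn x col w) i j r₂ r₁ s =
        Dn x col w j s * (Dn x col w i r₂ * Dn x col w i r₁) -
        (q + q⁻¹) • (Dn x col w i r₂ * (Dn x col w j s * Dn x col w i r₁)) +
        Dn x col w i r₂ * (Dn x col w i r₁ * Dn x col w j s) := by
      simp only [serreOp, mul_assoc]; abel
    rw [e]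
    exact this
  have h0 : Adj (0 : Module.End ℂ Macmahon) 0 := fun L M => by simp
  refine Adj.left_unique ((key r₁ r₂).add (key r₂ r₁)) ?_
  rw [Dn_serre x col w h r₂ r₁ s]
  exact h0

end Operators

/-! ## Generic parameters -/

/-- The weight of the position `(p, j, y)` (layer, row, column). -/
def xpos (q d u : ℂ) (p j y : ℤ) : ℂ := q1 q d ^ y * q3 q d ^ j * (u * q2 q ^ p)

/-- The weight of a box. -/
def bx (q d u : ℂ) (b : Box) : ℂ := xpos q d u b.1 b.2.1 b.2.2

/-- The color of a box. -/
def bcol {n : ℕ} (k : ZMod n) (b : Box) : ZMod n := k + (b.2.1 : ZMod n) - (b.2.2 : ZMod n)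

section Parameters

variable {q d u : ℂ}

theorem q1_ne_zero (hq : q ≠ 0) (hd : d ≠ 0) : q1 q d ≠ 0 := div_ne_zero hd hq

theorem q2_ne_zero (hq : q ≠ 0) : q2 q ≠ 0 := pow_ne_zero 2 hq

theorem q3_ne_zero (hq : q ≠ 0) (hd : d ≠ 0) : q3 q d ≠ 0 := div_ne_zero one_ne_zero (mul_ne_zero hd hq)

theorem q1_mul_q2_mul_q3 (hq : q ≠ 0) (hd : d ≠ 0) : q1 q d * q2 q * q3 q d = 1 := by
  rw [q1, q2, q3]; field_simp

theorem xpos_ne_zero (hq : q ≠ 0) (hd : d ≠ 0) (hu : u ≠ 0) (p j y : ℤ) : xpos q d u p j y ≠ 0 :=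
  mul_ne_zero (mul_ne_zero (zpow_ne_zero _ (q1_ne_zero hq hd)) (zpow_ne_zero _ (q3_ne_zero hq hd)))
    (mul_ne_zero hu (zpow_ne_zero _ (q2_ne_zero hq)))

theorem bx_ne_zero (hq : q ≠ 0) (hd : d ≠ 0) (hu : u ≠ 0) (b : Box) : bx q d u b ≠ 0 :=
  xpos_ne_zero hq hd hu _ _ _

theorem xpos_layer (hq : q ≠ 0) (p j y : ℤ) :
    xpos q d u (p + 1) j y = q2 q * xpos q d u p j y := by
  rw [xpos, xpos, zpow_add_one₀ (q2_ne_zero hq)]; ring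

theorem xpos_row (hq : q ≠ 0) (hd : d ≠ 0) (p j y : ℤ) :
    xpos q d u p (j + 1) y = q3 q d * xpos q d u p j y := by
  rw [xpos, xpos, zpow_add_one₀ (q3_ne_zero hq hd)]; ring

theorem xpos_col (hq : q ≠ 0) (hd : d ≠ 0) (p j y : ℤ) :
    xpos q d u p j (y + 1) = q1 q d * xpos q d u p j y := by
  rw [xpos, xpos, zpow_add_one₀ (q1_ne_zero hq hd)]; ring

/-- Since `q₁ q₂ q₃ = 1` is the only multiplicative relation, two positions agree exactly when their
coordinates differ by a multiple of `(1, 1, 1)`. -/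
theorem xpos_eq_iff (hq : q ≠ 0) (hd : d ≠ 0) (hu : u ≠ 0) (hgen : GenericParameters q d)
    {p j y p' j' y' : ℤ} :
    xpos q d u p j y = xpos q d u p' j' y' ↔ y - y' = p - p' ∧ p - p' = j - j' := by
  have h1 := q1_ne_zero hq hd
  have h2 := q2_ne_zero hq
  have h3 := q3_ne_zero hq hd
  have key : xpos q d u p j y = xpos q d u p' j' y' ↔
      q1 q d ^ (y - y') * q2 q ^ (p - p') * q3 q d ^ (j - j') = 1 := by
    rw [xpos, xpos, zpow_sub₀ h1, zpow_sub₀ h2, zpow_sub₀ h3]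
    have a1 := zpow_ne_zero y' h1
    have a2 := zpow_ne_zero p' h2
    have a3 := zpow_ne_zero j' h3
    rw [div_mul_div_comm, div_mul_div_comm, div_eq_one_iff_eq (by positivity)]
    constructor
    · intro h
      refine mul_left_cancel₀ hu ?_
      linear_combination h
    · intro h
      linear_combination u * h
  rw [key]
  constructor
  · exact hgen _ _ _
  · rintro ⟨h, h'⟩
    rw [h, ← h', ← mul_zpow, ← mul_zpow, q1_mul_q2_mul_q3 hq hd, one_zpow]

theorem q_sq_ne_one (hgen : GenericParameters q d) : q ^ 2 ≠ 1 := by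
  intro h
  have := hgen 0 1 0 (by simp [q2, h])
  omega

theorem q_sub_inv_ne_zero (hq : q ≠ 0) (hgen : GenericParameters q d) : q - q⁻¹ ≠ 0 := by
  intro h
  refine q_sq_ne_one hgen ?_
  field_simp at h
  linear_combination h

end Parameters

/-! ### The Cartan matrix and the matrix `m` on `ℤ/n` -/

section ZMod

variable {n : ℕ}

theorem zmod_one_ne_zero (hn : 3 ≤ n) : (1 : ZMod n) ≠ 0 := by
  have : Fact (1 < n) := ⟨by omega⟩
  exact one_ne_zero

theorem zmod_two_ne_zero (hn : 3 ≤ n) : (1 + 1 : ZMod n) ≠ 0 := by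
  intro h
  have : ((2 : ℕ) : ZMod n) = 0 := by push_cast; linear_combination h
  rw [ZMod.natCast_eq_zero_iff] at this
  exact absurd (Nat.le_of_dvd (by norm_num) this) (by omega)

theorem zmod_ne_add_one (hn : 3 ≤ n) (i : ZMod n) : i ≠ i + 1 := fun h =>
  zmod_one_ne_zero hn (by linear_combination -h)

theorem zmod_ne_add_two (hn : 3 ≤ n) (i : ZMod n) : i ≠ i + 1 + 1 := fun h =>
  zmod_two_ne_zero hn (by linear_combination -h)

theorem cartan_self (i : ZMod n) : cartan i i = 2 := if_pos rfl

theorem mMat_self (hn : 3 ≤ n) (i : ZMod n) : mMat i i = 0 := by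
  simp [mMat, zmod_one_ne_zero hn]

theorem cartan_succ (hn : 3 ≤ n) (i : ZMod n) : cartan i (i + 1) = -1 := by
  simp [cartan, zmod_one_ne_zero hn]

theorem mMat_succ (i : ZMod n) : mMat i (i + 1) = -1 := by
  simp [mMat]

theorem cartan_pred (hn : 3 ≤ n) (i : ZMod n) : cartan (i + 1) i = -1 := by
  simp [cartan, zmod_one_ne_zero hn]

theorem mMat_pred (hn : 3 ≤ n) (i : ZMod n) : mMat (i + 1) i = 1 := by
  simp [mMat, (zmod_ne_add_two hn i)]

theorem cartan_far {i j : ZMod n} (h1 : i ≠ j) (h2 : j ≠ i + 1) (h3 : i ≠ j + 1) :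
    cartan i j = 0 := by
  simp [cartan, h1, h2, h3]

theorem mMat_far {i j : ZMod n} (h2 : j ≠ i + 1) (h3 : i ≠ j + 1) : mMat i j = 0 := by
  simp [mMat, h2, h3]

theorem cartan_comm (i j : ZMod n) : cartan i j = cartan j i := by
  simp only [cartan, eq_comm (a := i) (b := j)]
  split_ifs <;> tauto

theorem mMat_antisymm (hn : 3 ≤ n) (i j : ZMod n) : mMat i j = -mMat j i := by
  by_cases h1 : j = i + 1
  · subst h1; rw [mMat_succ, mMat_pred hn]
  by_cases h2 : i = j + 1
  · subst h2; rw [mMat_succ, mMat_pred hn]; rfl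
  · rw [mMat_far h1 h2, mMat_far h2 h1]; rfl

end ZMod

/-! ## The structure function -/

section Structure

variable {n : ℕ} {q d u : ℂ} {k : ZMod n}

variable (q d u k) in
/-- The weight of the path which adds first `b` and then `a`, up to a symmetric factor. -/
def num (a b : Box) : ℂ :=
  d ^ mMat (bcol k a) (bcol k b) * q ^ cartan (bcol k a) (bcol k b) * bx q d u a - bx q d u b

variable (q d u k) in
/-- The weight of the path which adds first `a` and then `b`, up to a symmetric factor. -/
def den (a b : Box) : ℂ :=
  d ^ mMat (bcol k a) (bcol k b) * bx q d u a - q ^ cartan (bcol k a) (bcol k b) * bx q d u b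

/-- `cartan` is symmetric and `mMat` antisymmetric, so exchanging the boxes exchanges `num` and
`den` up to the same unit. -/
theorem num_swap (hn : 3 ≤ n) (hd : d ≠ 0) (a b : Box) :
    num q d u k b a = -(d ^ mMat (bcol k a) (bcol k b))⁻¹ * den q d u k a b := by
  have := zpow_ne_zero (mMat (bcol k a) (bcol k b)) hd
  rw [num, den, cartan_comm (bcol k b), mMat_antisymm hn (bcol k b), zpow_neg]
  field_simp
  ring

theorem den_swap (hn : 3 ≤ n) (hd : d ≠ 0) (a b : Box) :
    den q d u k b a = -(d ^ mMat (bcol k a) (bcol k b))⁻¹ * num q d u k a b := by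
  have := zpow_ne_zero (mMat (bcol k a) (bcol k b)) hd
  rw [num, den, cartan_comm (bcol k b), mMat_antisymm hn (bcol k b), zpow_neg]
  field_simp
  ring

theorem num_eq_zero_iff (hn : 3 ≤ n) (hd : d ≠ 0) (a b : Box) :
    num q d u k b a = 0 ↔ den q d u k a b = 0 := by
  have := zpow_ne_zero (mMat (bcol k a) (bcol k b)) hd
  rw [num_swap hn hd]
  simp [this]

theorem bcol_layer (p j y : ℕ) : bcol k (p + 1, j, y) = bcol k (p, j, y) := rfl

theorem bcol_row (p j y : ℕ) : bcol k (p, j + 1, y) = bcol k (p, j, y) + 1 := by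
  simp [bcol]; ring

theorem bcol_column (p j y : ℕ) : bcol k (p, j, y) = bcol k (p, j, y + 1) + 1 := by
  simp [bcol]; ring

/-- If two positions have the same diagonal, then they have the same color. -/
theorem bcol_eq_of_diag {a b : Box} {s : ℤ} (h : (a.2.1 : ℤ) - a.2.2 = b.2.1 - b.2.2 + s) :
    bcol k a = bcol k b + s := by
  have := congrArg (Int.cast : ℤ → ZMod n) h
  push_cast at this
  rw [bcol, bcol]
  linear_combination this

/-- A step in the layer, row or column direction multiplies the position by `q₂`, `q₃` or `q₁` and
shifts the color by `0`, `1` or `-1`; these are exactly the pairs at which `den` vanishes. -/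
theorem den_covers (hn : 3 ≤ n) (hq : q ≠ 0) (hd : d ≠ 0) {a b : Box} (h : Covers a b) :
    den q d u k a b = 0 := by
  obtain ⟨p, j, y⟩ := b
  rcases h with rfl | rfl | rfl <;> dsimp only
  · rw [den, bcol_layer, cartan_self, mMat_self hn, bx, bx]
    simp only [Nat.cast_add, Nat.cast_one]
    rw [xpos_layer hq, q2]; simp
  · rw [den, bcol_row, cartan_pred hn, mMat_pred hn, bx, bx]
    simp only [Nat.cast_add, Nat.cast_one]
    rw [xpos_row hq hd, q3, zpow_neg_one, zpow_one]; field_simp; ring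
  · rw [den, bcol_column p j y, cartan_succ hn, mMat_succ, bx, bx]
    simp only [Nat.cast_add, Nat.cast_one]
    rw [xpos_col hq hd, q1, zpow_neg_one, zpow_neg_one]; field_simp; simp

/-- The boxes where `den` vanishes are adjacent up to a diagonal shift. -/
theorem den_eq_zero (hn : 3 ≤ n) (hq : q ≠ 0) (hd : d ≠ 0) (hu : u ≠ 0)
    (hgen : GenericParameters q d) {a b : Box} (h : den q d u k a b = 0) :
    ∃ t : ℤ, ((a.1 : ℤ) = b.1 + t + 1 ∧ (a.2.1 : ℤ) = b.2.1 + t ∧ (a.2.2 : ℤ) = b.2.2 + t) ∨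
      ((a.1 : ℤ) = b.1 + t ∧ (a.2.1 : ℤ) = b.2.1 + t + 1 ∧ (a.2.2 : ℤ) = b.2.2 + t) ∨
      ((a.1 : ℤ) = b.1 + t ∧ (a.2.1 : ℤ) = b.2.1 + t ∧ (a.2.2 : ℤ) = b.2.2 + t + 1) := by
  by_cases h1 : bcol k a = bcol k b
  · rw [den, h1, cartan_self, mMat_self hn, zpow_zero, one_mul, sub_eq_zero] at h
    have h2 : bx q d u a = xpos q d u (b.1 + 1) b.2.1 b.2.2 := by
      rw [h, xpos_layer hq, q2, bx]; norm_cast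
    rw [bx, xpos_eq_iff hq hd hu hgen] at h2
    exact ⟨a.1 - b.1 - 1, Or.inl (by omega)⟩
  by_cases h2 : bcol k a = bcol k b + 1
  · rw [den, h2, cartan_pred hn, mMat_pred hn, zpow_one, zpow_neg_one, sub_eq_zero] at h
    have h3 : bx q d u a = xpos q d u b.1 (b.2.1 + 1) b.2.2 := by
      rw [xpos_row hq hd, q3, ← bx]; field_simp; field_simp at h; linear_combination h
    rw [bx, xpos_eq_iff hq hd hu hgen] at h3
    exact ⟨a.1 - b.1, Or.inr (Or.inl (by omega))⟩
  by_cases h3 : bcol k b = bcol k a + 1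
  · rw [den, h3, cartan_succ hn, mMat_succ, zpow_neg_one, zpow_neg_one, sub_eq_zero] at h
    have h4 : bx q d u a = xpos q d u b.1 b.2.1 (b.2.2 + 1) := by
      rw [xpos_col hq hd, q1, ← bx]; field_simp; field_simp at h; linear_combination h
    rw [bx, xpos_eq_iff hq hd hu hgen] at h4
    exact ⟨a.1 - b.1, Or.inr (Or.inr (by omega))⟩
  · rw [den, cartan_far h1 h3 h2, mMat_far h3 h2, zpow_zero, zpow_zero, one_mul, one_mul,
      sub_eq_zero, bx, bx, xpos_eq_iff hq hd hu hgen] at h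
    refine absurd ?_ h1
    have := bcol_eq_of_diag (k := k) (a := a) (b := b) (s := 0) (by omega)
    simpa using this

/-- A zero of `den` puts `a` at a cover of `b` shifted by `t (1, 1, 1)`. If `t ≠ 0`, one of the
boxes exceeds the other in at least two directions, and convexity forces a `2 × 2` square of four
boxes into `U`. -/
theorem covers_of_den_eq_zero (hn : 3 ≤ n) (hq : q ≠ 0) (hd : d ≠ 0) (hu : u ≠ 0)
    (hgen : GenericParameters q d) {U : Finset Box}
    (hU : ∀ a ∈ U, ∀ b ∈ U, ∀ c : Box, a ≤ c → c ≤ b → c ∈ U) (hcard : U.card ≤ 3)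
    {a b : Box} (ha : a ∈ U) (hb : b ∈ U) (h : den q d u k a b = 0) : Covers a b := by
  have square : ∀ (c c' : Box) (x y z : ℕ), c ∈ U → c' ∈ U → c = (x, y, z) →
      ((x + 1, y + 1, z) ≤ c' ∨ (x + 1, y, z + 1) ≤ c' ∨ (x, y + 1, z + 1) ≤ c') → False := by
    rintro _ ⟨x', y', z'⟩ x y z hc hc' rfl h
    simp only [Prod.mk_le_mk] at h
    have mem : ∀ e : Box, (x, y, z) ≤ e → e ≤ (x', y', z') → e ∈ U := fun e => hU _ hc _ hc' e
    rcases h with h | h | h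
    · have : ({(x, y, z), (x + 1, y, z), (x, y + 1, z), (x + 1, y + 1, z)} : Finset Box) ⊆ U := by
        intro e he
        simp only [Finset.mem_insert, Finset.mem_singleton] at he
        rcases he with rfl | rfl | rfl | rfl <;> refine mem _ ?_ ?_ <;>
          simp only [Prod.mk_le_mk] <;> omega
      have := Finset.card_le_card this
      rw [Finset.card_insert_of_notMem (by simp), Finset.card_insert_of_notMem (by simp),
        Finset.card_insert_of_notMem (by simp), Finset.card_singleton] at this
      omega
    · have : ({(x, y, z), (x + 1, y, z), (x, y, z + 1), (x + 1, y, z + 1)} : Finset Box) ⊆ U := by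
        intro e he
        simp only [Finset.mem_insert, Finset.mem_singleton] at he
        rcases he with rfl | rfl | rfl | rfl <;> refine mem _ ?_ ?_ <;>
          simp only [Prod.mk_le_mk] <;> omega
      have := Finset.card_le_card this
      rw [Finset.card_insert_of_notMem (by simp), Finset.card_insert_of_notMem (by simp),
        Finset.card_insert_of_notMem (by simp), Finset.card_singleton] at this
      omega
    · have : ({(x, y, z), (x, y + 1, z), (x, y, z + 1), (x, y + 1, z + 1)} : Finset Box) ⊆ U := by
        intro e he
        simp only [Finset.mem_insert, Finset.mem_singleton] at he
        rcases he with rfl | rfl | rfl | rfl <;> refine mem _ ?_ ?_ <;>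
          simp only [Prod.mk_le_mk] <;> omega
      have := Finset.card_le_card this
      rw [Finset.card_insert_of_notMem (by simp), Finset.card_insert_of_notMem (by simp),
        Finset.card_insert_of_notMem (by simp), Finset.card_singleton] at this
      omega
  obtain ⟨t, ht⟩ := den_eq_zero hn hq hd hu hgen h
  obtain ⟨p, j, y⟩ := a
  obtain ⟨p', j', y'⟩ := b
  simp only at ht
  rcases lt_trichotomy t 0 with h0 | h0 | h0
  · refine (square _ _ p j y ha hb rfl ?_).elim
    simp only [Prod.mk_le_mk]; omega
  · subst h0
    simp only [Covers, Prod.mk.injEq]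
    omega
  · refine (square _ _ p' j' y' hb ha rfl ?_).elim
    simp only [Prod.mk_le_mk]; omega

/-- The row of `a` comes before the row of `b`. -/
def RowLt (a b : Box) : Prop := a.1 < b.1 ∨ a.1 = b.1 ∧ a.2.1 < b.2.1

theorem RowLt.asymm {a b : Box} (h : RowLt a b) : ¬ RowLt b a := by
  unfold RowLt at *; omega

theorem Covers.asymm {a b : Box} (h : Covers a b) : ¬ Covers b a := fun h' =>
  h.ne (le_antisymm h.le h'.le)

variable (q d u k) in
/-- Two boxes are in good position: `den` vanishes only for the forbidden order, and boxes of the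
same row are adjacent. -/
structure Good (a b : Box) : Prop where
  left : den q d u k a b = 0 → Covers a b
  right : den q d u k b a = 0 → Covers b a
  row : ¬ RowLt a b → ¬ RowLt b a → Covers a b ∨ Covers b a

variable (q d u k) in
/-- The weight `g a b` is the contribution of the box `a` to the weight of adding `b`. -/
def IsStructure (g : Box → Box → ℂ) : Prop :=
  ∀ a b, (RowLt a b ∨ RowLt b a) → den q d u k b a ≠ 0 → num q d u k b a ≠ 0 →
    g a b * den q d u k b a = g b a * num q d u k b a

open Classical in
/-- The contribution of `a`, when `a` is added before `b`. -/
def order (g : Box → Box → ℂ) (a b : Box) : ℂ := if Covers a b then 0 else g a b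

/-- A forbidden order matches a zero: `den` vanishes when `b` covers `a`, and `num` when `a` covers
`b`, so `κ` can be read off from the other order. If neither holds, both are nonzero and
`IsStructure` gives the ratio. -/
theorem exists_order_eq (hn : 3 ≤ n) (hq : q ≠ 0) (hd : d ≠ 0) {g : Box → Box → ℂ}
    (hg : IsStructure q d u k g) {a b : Box} (h : Good q d u k a b) :
    ∃ κ, order g a b = κ * num q d u k b a ∧ order g b a = κ * den q d u k b a := by
  by_cases h1 : Covers b a
  · have h2 : ¬ Covers a b := h1.asymm
    have h3 : num q d u k b a ≠ 0 := fun h4 => h2 (h.left ((num_eq_zero_iff hn hd a b).mp h4))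
    refine ⟨g a b / num q d u k b a, ?_, ?_⟩
    · rw [order, if_neg h2, div_mul_cancel₀ _ h3]
    · rw [order, if_pos h1, den_covers hn hq hd h1, mul_zero]
  by_cases h2 : Covers a b
  · have h3 : den q d u k b a ≠ 0 := fun h4 => h1 (h.right h4)
    refine ⟨g b a / den q d u k b a, ?_, ?_⟩
    · rw [order, if_pos h2, (num_eq_zero_iff hn hd a b).mpr (den_covers hn hq hd h2), mul_zero]
    · rw [order, if_neg h1, div_mul_cancel₀ _ h3]
  have h3 : den q d u k b a ≠ 0 := fun h4 => h1 (h.right h4)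
  have h4 : num q d u k b a ≠ 0 := fun h4 => h2 (h.left ((num_eq_zero_iff hn hd a b).mp h4))
  -- Within one row `g` carries no information, but there `Good` makes the boxes adjacent, which is
  -- excluded by now.
  have h5 : RowLt a b ∨ RowLt b a := by
    by_contra! h6
    rcases h.row h6.1 h6.2 with h7 | h7
    exacts [h2 h7, h1 h7]
  refine ⟨g b a / den q d u k b a, ?_, ?_⟩
  · rw [order, if_neg h2, div_mul_eq_mul_div, ← hg a b h5 h3 h4, mul_div_cancel_right₀ _ h3]
  · rw [order, if_neg h1, div_mul_cancel₀ _ h3]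

/-- The weight of adding the box `b` to the set `T`. -/
def wt (v : Box → ℂ) (g : Box → Box → ℂ) (T : Finset Box) (b : Box) : ℂ := v b * ∏ c ∈ T, g c b

theorem wt_insert (v : Box → ℂ) (g : Box → Box → ℂ) {T : Finset Box} {a : Box} (ha : a ∉ T)
    (b : Box) : wt v g (insert a T) b = wt v g T b * g a b := by
  rw [wt, wt, Finset.prod_insert ha]; ring

theorem low_insert_iff {T S : Finset Box} {a : Box} (hT : Low T) (hS : Low S) (h : insert a T ⊆ S)
    (ha : a ∉ T) : Low (insert a T) ↔ ∀ c ∈ S, c ≠ a → c ∉ T → ¬ Covers a c := by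
  rw [Low.between hT hS (Finset.subset_insert a T) h]
  have h1 : insert a T \ T = {a} := by ext c; simp; grind
  rw [h1]
  simp only [Finset.mem_singleton, forall_eq, Finset.mem_sdiff, Finset.mem_insert, not_or, and_imp]

/-- The contributions of `T` to `a` and to `b` do not depend on the order; only the mutual
contribution does. The zero in `order` records that the intermediate set is not lower. -/
theorem pathTwo_wt {v : Box → ℂ} {g : Box → Box → ℂ} {T : Finset Box} {a b : Box} (hT : Low T)
    (hS : Low (insert a (insert b T))) (ha : a ∉ T) (hb : b ∉ T) (hab : a ≠ b) :
    pathTwo (wt v g) T a b = wt v g T a * wt v g T b * order g a b := by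
  have h1 : Low (insert a T) ↔ ¬ Covers a b := by
    rw [low_insert_iff hT hS (by intro c; simp; tauto) ha]
    constructor
    · intro h
      exact h b (by simp) hab.symm hb
    · intro h c hc hca hcT
      simp only [Finset.mem_insert, hca, hcT, false_or, or_false] at hc
      rwa [hc]
  rw [pathTwo, order]
  by_cases h2 : Covers a b
  · rw [if_neg (by tauto), if_pos h2, mul_zero]
  · rw [if_pos (by tauto), if_neg h2, wt_insert v g ha]; ring

theorem pathThree_wt {v : Box → ℂ} {g : Box → Box → ℂ} {T : Finset Box} {a b c : Box} (hT : Low T)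
    (hS : Low (insert a (insert b (insert c T)))) (ha : a ∉ T) (hb : b ∉ T) (hc : c ∉ T)
    (hab : a ≠ b) (hac : a ≠ c) (hbc : b ≠ c) :
    pathThree (wt v g) T a b c = wt v g T a * wt v g T b * wt v g T c *
      (order g a b * order g a c * order g b c) := by
  have h1 : Low (insert a T) ↔ ¬ Covers a b ∧ ¬ Covers a c := by
    rw [low_insert_iff hT hS (by intro c; simp; tauto) ha]
    constructor
    · intro h
      exact ⟨h b (by simp) hab.symm hb, h c (by simp) hac.symm hc⟩
    · intro h e he hea heT
      simp only [Finset.mem_insert, hea, heT, false_or, or_false] at he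
      rcases he with rfl | rfl
      exacts [h.1, h.2]
  have h2 : Low (insert a T) → (Low (insert b (insert a T)) ↔ ¬ Covers b c) := by
    intro hl
    rw [low_insert_iff hl hS (by intro c; simp; tauto) (by simp [hb, hab.symm])]
    constructor
    · intro h
      exact h c (by simp) hbc.symm (by simp [hc, hac.symm])
    · intro h e he heb heT
      simp only [Finset.mem_insert, not_or] at heT he
      simp only [heb, heT.1, heT.2, false_or, or_false] at he
      rwa [he]
  rw [pathThree, order, order, order]
  by_cases h3 : Covers a b
  · rw [if_neg (by tauto), if_pos h3]; ring
  by_cases h4 : Covers a c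
  · rw [if_neg (by tauto), if_pos h4]; ring
  have hl := h1.mpr ⟨h3, h4⟩
  by_cases h5 : Covers b c
  · rw [if_neg (by tauto), if_pos h5]; ring
  · rw [if_pos (by tauto), if_neg h3, if_neg h4, if_neg h5, wt_insert v g ha,
      wt_insert v g (by simp [hb, hab.symm]), wt_insert v g ha]
    ring

/-! ### Small convex sets of boxes -/

theorem sdiff_convex {T S : Finset Box} (hT : Low T) (hS : Low S) :
    ∀ a ∈ S \ T, ∀ b ∈ S \ T, ∀ c : Box, a ≤ c → c ≤ b → c ∈ S \ T := by
  intro a ha b hb c hac hcb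
  rw [Finset.mem_sdiff] at *
  exact ⟨hS b hb.1 c hcb, fun h => ha.2 (hT c h a hac)⟩

/-- Two distinct boxes of the same row in a small convex set are adjacent, or there is a box
between. -/
theorem row_adjacent {U : Finset Box} (hU : ∀ a ∈ U, ∀ b ∈ U, ∀ c : Box, a ≤ c → c ≤ b → c ∈ U)
    (hcard : U.card ≤ 3) {a b : Box} (ha : a ∈ U) (hb : b ∈ U) (hab : a ≠ b) (h1 : ¬ RowLt a b)
    (h2 : ¬ RowLt b a) :
    (Covers b a ∧ bcol k a = bcol k b + 1) ∨ (Covers a b ∧ bcol k b = bcol k a + 1) ∨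
      ∃ c ∈ U, c ≠ a ∧ c ≠ b ∧ (bcol k a = bcol k c + 1 ∧ bcol k c = bcol k b + 1 ∨
        bcol k b = bcol k c + 1 ∧ bcol k c = bcol k a + 1) := by
  have aux : ∀ p j y y', y < y' → ((p, j, y) : Box) ∈ U → ((p, j, y') : Box) ∈ U →
      y' = y + 1 ∨ (y' = y + 2 ∧ ((p, j, y + 1) : Box) ∈ U) := by
    intro p j y y' hy ha hb
    have mem : ∀ z, y ≤ z → z ≤ y' → ((p, j, z) : Box) ∈ U := fun z h h' =>
      hU _ ha _ hb _ (by simpa [Prod.mk_le_mk] using h) (by simpa [Prod.mk_le_mk] using h')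
    by_contra! h
    by_cases h3 : y' = y + 2
    · exact h.2 h3 (mem _ (by omega) (by omega))
    have : ({(p, j, y), (p, j, y + 1), (p, j, y + 2), (p, j, y + 3)} : Finset Box) ⊆ U := by
      intro e he
      simp only [Finset.mem_insert, Finset.mem_singleton] at he
      rcases he with rfl | rfl | rfl | rfl <;> exact mem _ (by omega) (by omega)
    have := Finset.card_le_card this
    rw [Finset.card_insert_of_notMem (by simp), Finset.card_insert_of_notMem (by simp),
      Finset.card_insert_of_notMem (by simp), Finset.card_singleton] at this
    omega
  obtain ⟨p, j, y⟩ := a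
  obtain ⟨p', j', y'⟩ := b
  simp only [RowLt, not_or, not_and, not_lt] at h1 h2
  obtain rfl : p = p' := by omega
  obtain rfl : j = j' := by omega
  have hy : y ≠ y' := fun h => hab (by rw [h])
  rcases lt_or_gt_of_ne hy with h | h
  · rcases aux _ _ _ _ h ha hb with rfl | ⟨rfl, hc⟩
    · exact Or.inl ⟨Or.inr (Or.inr rfl), bcol_column _ _ _⟩
    · exact Or.inr (Or.inr ⟨_, hc, by simp, by simp, Or.inl ⟨bcol_column _ _ _, bcol_column _ _ _⟩⟩)
  · rcases aux _ _ _ _ h hb ha with rfl | ⟨rfl, hc⟩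
    · exact Or.inr (Or.inl ⟨Or.inr (Or.inr rfl), bcol_column _ _ _⟩)
    · exact Or.inr (Or.inr ⟨_, hc, by simp, by simp, Or.inr ⟨bcol_column _ _ _, bcol_column _ _ _⟩⟩)

theorem good_two (hn : 3 ≤ n) (hq : q ≠ 0) (hd : d ≠ 0) (hu : u ≠ 0)
    (hgen : GenericParameters q d) {T : Finset Box} {a b : Box} (hT : Low T)
    (hS : Low (insert a (insert b T))) (ha : a ∉ T) (hb : b ∉ T) (hab : a ≠ b) :
    Good q d u k a b := by
  have hU := sdiff_convex hT hS
  have hUe : insert a (insert b T) \ T = {a, b} := by ext c; simp; grind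
  rw [hUe] at hU
  have hcard : ({a, b} : Finset Box).card ≤ 3 := Finset.card_le_two.trans (by norm_num)
  have ha' : a ∈ ({a, b} : Finset Box) := by simp
  have hb' : b ∈ ({a, b} : Finset Box) := by simp
  refine ⟨covers_of_den_eq_zero hn hq hd hu hgen hU hcard ha' hb',
    covers_of_den_eq_zero hn hq hd hu hgen hU hcard hb' ha', fun h1 h2 => ?_⟩
  rcases row_adjacent (k := k) hU hcard ha' hb' hab h1 h2 with h | h | ⟨c, hc, hca, hcb, -⟩
  · exact Or.inr h.1
  · exact Or.inl h.1
  · simp [hca, hcb] at hc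

/-- Consecutive boxes of a row differ in color by one, and neither `1` nor `2` vanishes modulo `n`.
As `a` and `b` have equal colors, the three boxes cannot form a row, so any two of them in one row
are adjacent. -/
theorem good_three (hn : 3 ≤ n) (hq : q ≠ 0) (hd : d ≠ 0) (hu : u ≠ 0)
    (hgen : GenericParameters q d) {T : Finset Box} {a b c : Box} (hT : Low T)
    (hS : Low (insert a (insert b (insert c T)))) (ha : a ∉ T) (hb : b ∉ T) (hc : c ∉ T)
    (hab : a ≠ b) (hac : a ≠ c) (hbc : b ≠ c) (hcol : bcol k a = bcol k b) :
    Good q d u k a b ∧ Good q d u k a c ∧ Good q d u k b c := by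
  have hU := sdiff_convex hT hS
  have hUe : insert a (insert b (insert c T)) \ T = {a, b, c} := by ext c; simp; grind
  rw [hUe] at hU
  have hcard : ({a, b, c} : Finset Box).card ≤ 3 := Finset.card_le_three
  have ha' : a ∈ ({a, b, c} : Finset Box) := by simp
  have hb' : b ∈ ({a, b, c} : Finset Box) := by simp
  have hc' : c ∈ ({a, b, c} : Finset Box) := by simp
  have e1 := zmod_ne_add_one hn
  have e2 := zmod_ne_add_two hn
  refine ⟨⟨covers_of_den_eq_zero hn hq hd hu hgen hU hcard ha' hb',
    covers_of_den_eq_zero hn hq hd hu hgen hU hcard hb' ha', fun h1 h2 => ?_⟩,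
    ⟨covers_of_den_eq_zero hn hq hd hu hgen hU hcard ha' hc',
    covers_of_den_eq_zero hn hq hd hu hgen hU hcard hc' ha', fun h1 h2 => ?_⟩,
    ⟨covers_of_den_eq_zero hn hq hd hu hgen hU hcard hb' hc',
    covers_of_den_eq_zero hn hq hd hu hgen hU hcard hc' hb', fun h1 h2 => ?_⟩⟩
  · rcases row_adjacent (k := k) hU hcard ha' hb' hab h1 h2 with h | h | ⟨e, -, -, -, h | h⟩
    · exact Or.inr h.1
    · exact Or.inl h.1
    · rw [h.2, hcol] at h; exact absurd h.1 (e2 _)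
    · rw [h.2, hcol] at h; exact absurd h.1 (e2 _)
  · rcases row_adjacent (k := k) hU hcard ha' hc' hac h1 h2 with h | h | ⟨e, he, hea, hec, h⟩
    · exact Or.inr h.1
    · exact Or.inl h.1
    · simp only [Finset.mem_insert, hea, hec, Finset.mem_singleton, false_or, or_false] at he
      rw [he, ← hcol] at h
      rcases h with h | h
      exacts [absurd h.1 (e1 _), absurd h.2 (e1 _)]
  · rcases row_adjacent (k := k) hU hcard hb' hc' hbc h1 h2 with h | h | ⟨e, he, hea, hec, h⟩
    · exact Or.inr h.1
    · exact Or.inl h.1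
    · simp only [Finset.mem_insert, hea, hec, Finset.mem_singleton, or_false] at he
      rw [he, ← hcol] at h
      rcases h with h | h
      exacts [absurd h.1 (e1 _), absurd h.2 (e1 _)]

theorem path_quadratic (hn : 3 ≤ n) (hq : q ≠ 0) (hd : d ≠ 0) (hu : u ≠ 0)
    (hgen : GenericParameters q d) (v : Box → ℂ) {g : Box → Box → ℂ}
    (hg : IsStructure q d u k g) {T : Finset Box} {a b : Box} (hT : Low T)
    (hS : Low (insert a (insert b T))) (ha : a ∉ T) (hb : b ∉ T) (hab : a ≠ b) :
    den q d u k a b * pathTwo (wt v g) T b a = num q d u k a b * pathTwo (wt v g) T a b := by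
  obtain ⟨κ, h1, h2⟩ := exists_order_eq hn hq hd hg
    ((good_two hn hq hd hu hgen (k := k) hT hS ha hb hab))
  rw [pathTwo_wt hT hS ha hb hab, pathTwo_wt hT (by rwa [Finset.insert_comm]) hb ha hab.symm, h1, h2,
    num_swap hn hd, den_swap hn hd]
  ring

theorem path_comm (hn : 3 ≤ n) (hq : q ≠ 0) (hd : d ≠ 0) (hu : u ≠ 0)
    (hgen : GenericParameters q d) (v : Box → ℂ) {g : Box → Box → ℂ}
    (hg : IsStructure q d u k g) {T : Finset Box} {a b : Box} (hT : Low T)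
    (hS : Low (insert a (insert b T))) (ha : a ∉ T) (hb : b ∉ T) (hab : a ≠ b)
    (h1 : bcol k a ≠ bcol k b) (h2 : bcol k b ≠ bcol k a + 1) (h3 : bcol k a ≠ bcol k b + 1) :
    pathTwo (wt v g) T a b = pathTwo (wt v g) T b a := by
  obtain ⟨κ, e1, e2⟩ := exists_order_eq hn hq hd hg
    ((good_two hn hq hd hu hgen (k := k) hT hS ha hb hab))
  rw [pathTwo_wt hT hS ha hb hab, pathTwo_wt hT (by rwa [Finset.insert_comm]) hb ha hab.symm, e1, e2,
    num, den, cartan_far h1.symm h3 h2, mMat_far h3 h2]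
  simp only [zpow_zero, one_mul]
  ring

/-- With the ratios of `exists_order_eq` all six paths share the one-box weights and the three
factors `κ`; what is left is a polynomial identity in the three positions. -/
theorem path_serre (hn : 3 ≤ n) (hq : q ≠ 0) (hd : d ≠ 0) (hu : u ≠ 0)
    (hgen : GenericParameters q d) (v : Box → ℂ) {g : Box → Box → ℂ}
    (hg : IsStructure q d u k g) {T : Finset Box} {a b c : Box} (hT : Low T)
    (hS : Low (insert a (insert b (insert c T)))) (ha : a ∉ T) (hb : b ∉ T) (hc : c ∉ T)
    (hab : a ≠ b) (hac : a ≠ c) (hbc : b ≠ c) (hcol : bcol k a = bcol k b)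
    (hcol' : bcol k c = bcol k a + 1 ∨ bcol k a = bcol k c + 1) :
    pathThree (wt v g) T a b c - (q + q⁻¹) * pathThree (wt v g) T a c b +
      pathThree (wt v g) T c a b + (pathThree (wt v g) T b a c -
      (q + q⁻¹) * pathThree (wt v g) T b c a + pathThree (wt v g) T c b a) = 0 := by
  obtain ⟨g1, g2, g3⟩ := good_three hn hq hd hu hgen hT hS ha hb hc hab hac hbc hcol
  obtain ⟨κ1, e1, e1'⟩ := exists_order_eq hn hq hd hg g1
  obtain ⟨κ2, e2, e2'⟩ := exists_order_eq hn hq hd hg g2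
  obtain ⟨κ3, e3, e3'⟩ := exists_order_eq hn hq hd hg g3
  have s1 : Low (insert a (insert c (insert b T))) := by rwa [Finset.insert_comm c b]
  have s2 : Low (insert c (insert a (insert b T))) := by rwa [Finset.insert_comm c a]
  have s3 : Low (insert b (insert a (insert c T))) := by rwa [Finset.insert_comm b a]
  have s4 : Low (insert b (insert c (insert a T))) := by rwa [Finset.insert_comm c a]
  have s5 : Low (insert c (insert b (insert a T))) := by rwa [Finset.insert_comm c b]
  rw [pathThree_wt hT hS ha hb hc hab hac hbc, pathThree_wt hT s1 ha hc hb hac hab hbc.symm,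
    pathThree_wt hT s2 hc ha hb hac.symm hbc.symm hab,
    pathThree_wt hT s3 hb ha hc hab.symm hbc hac,
    pathThree_wt hT s4 hb hc ha hbc hab.symm hac.symm,
    pathThree_wt hT s5 hc hb ha hbc.symm hac.symm hab.symm, e1, e1', e2, e2', e3, e3',
    num_swap hn hd a c, num_swap hn hd b c, den_swap hn hd a c, den_swap hn hd b c]
  have hca : cartan (bcol k a) (bcol k c) = -1 := by
    rcases hcol' with h | h <;> rw [h]
    exacts [cartan_succ hn _, cartan_pred hn _]
  have hy := zpow_ne_zero (mMat (bcol k a) (bcol k c)) hd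
  simp only [num, den, ← hcol, hca, cartan_self, mMat_self hn, zpow_zero, zpow_neg_one, one_mul]
  -- The two neighbouring colors differ only in this power of `d`, and the identity holds for every
  -- nonzero `y`.
  generalize d ^ mMat (bcol k a) (bcol k c) = y at hy
  rw [show q ^ (2 : ℤ) = q ^ 2 by norm_cast]
  field_simp
  ring

end Structure

/-! ## Eigenvalues of the currents `K_i(z)` -/

section Eigenvalues

variable {n : ℕ} {q d u : ℂ} {k : ZMod n}

variable (q d u k) in
/-- The factor by which the eigenvalue of `K_i(z)` changes when the box `b` is added. -/
def Gz (i : ZMod n) (b : Box) : RatFunc ℂ :=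
  RatFunc.C (q ^ cartan i (bcol k b)) *
    (lin (q ^ (-cartan i (bcol k b)) * d ^ (-mMat i (bcol k b)) * bx q d u b) /
      lin (q ^ cartan i (bcol k b) * d ^ (-mMat i (bcol k b)) * bx q d u b))

theorem Gz_ne_zero (hq : q ≠ 0) (i : ZMod n) (b : Box) : Gz q d u k i b ≠ 0 :=
  mul_ne_zero (C_ne_zero (zpow_ne_zero _ hq)) (div_ne_zero (lin_ne_zero _) (lin_ne_zero _))

/-- The ratio of eigenvalues that the relation between `K_i(z)` and `E_j(w)` prescribes, with `w` at
the position of the new box. -/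
theorem Gz_mul (hq : q ≠ 0) (hd : d ≠ 0) (i : ZMod n) (b : Box) :
    Gz q d u k i b * (RatFunc.C (q ^ cartan i (bcol k b) * bx q d u b) -
      RatFunc.C (d ^ mMat i (bcol k b)) * RatFunc.X) =
    RatFunc.C (bx q d u b) -
      RatFunc.C (d ^ mMat i (bcol k b) * q ^ cartan i (bcol k b)) * RatFunc.X := by
  rw [Gz]
  generalize cartan i (bcol k b) = a
  generalize mMat i (bcol k b) = m
  generalize bx q d u b = x
  have ha := zpow_ne_zero a hq
  have hm := zpow_ne_zero m hd
  have hX : (RatFunc.X : RatFunc ℂ) ≠ 0 := RatFunc.X_ne_zero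
  have h1 : RatFunc.C (q ^ a * x) - RatFunc.C (d ^ m) * RatFunc.X =
      -(RatFunc.C (d ^ m) * (lin (q ^ a * d ^ (-m) * x) * RatFunc.X)) := by
    rw [lin_mul_X, zpow_neg, show q ^ a * x = d ^ m * (q ^ a * (d ^ m)⁻¹ * x) by field_simp,
      map_mul RatFunc.C (d ^ m)]
    ring_nf
  have h2 : RatFunc.C x - RatFunc.C (d ^ m * q ^ a) * RatFunc.X =
      -(RatFunc.C (d ^ m * q ^ a) * (lin (q ^ (-a) * d ^ (-m) * x) * RatFunc.X)) := by
    have : x = d ^ m * q ^ a * (q ^ (-a) * d ^ (-m) * x) := by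
      rw [zpow_neg, zpow_neg]; field_simp
    conv_lhs => rw [this]
    rw [lin_mul_X, map_mul RatFunc.C (d ^ m * q ^ a)]
    ring
  rw [h1, h2, map_mul]
  have := lin_ne_zero (q ^ a * d ^ (-m) * x)
  field_simp

theorem leadAt_Gz (hq : q ≠ 0) (hd : d ≠ 0) (hu : u ≠ 0) {a b : Box}
    (h1 : den q d u k b a ≠ 0) (h2 : num q d u k b a ≠ 0) :
    leadAt (bx q d u b) (Gz q d u k (bcol k b) a) = num q d u k b a / den q d u k b a := by
  have hb := bx_ne_zero hq hd hu b
  rw [num] at h2 ⊢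
  rw [den] at h1 ⊢
  rw [Gz]
  generalize cartan (bcol k b) (bcol k a) = e at *
  generalize mMat (bcol k b) (bcol k a) = m at *
  generalize bx q d u b = x at *
  generalize bx q d u a = y at *
  have he := zpow_ne_zero e hq
  have hm := zpow_ne_zero m hd
  have h3 : q ^ (-e) * d ^ (-m) * y ≠ x := by
    rintro rfl
    apply h2
    rw [zpow_neg, zpow_neg]; field_simp; ring
  have h4 : q ^ e * d ^ (-m) * y ≠ x := by
    rintro rfl
    apply h1
    rw [zpow_neg]; field_simp; ring
  have h5 : 1 - q ^ e * d ^ (-m) * y / x ≠ 0 := by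
    intro h
    apply h4
    field_simp at h
    linear_combination -h
  rw [leadAt_mul, leadAt_C, leadAt_div, leadAt_lin hb h3, leadAt_lin hb h4, mul_div_assoc',
    div_eq_div_iff h5 h1, zpow_neg, zpow_neg]
  field_simp

/-- One of the two contributions of a pair is `num / den` by `leadAt_Gz` and the other is `1`. If
the rows are in the opposite order, the boxes are exchanged by `num_swap` and `den_swap`. -/
theorem isStructure_Gz_left (hn : 3 ≤ n) (hq : q ≠ 0) (hd : d ≠ 0) (hu : u ≠ 0)
    {g : Box → Box → ℂ}
    (h : ∀ a b, RowLt a b → g a b = leadAt (bx q d u b) (Gz q d u k (bcol k b) a))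
    (h' : ∀ a b, ¬ RowLt a b → g a b = 1) : IsStructure q d u k g := by
  have aux : ∀ a b, RowLt a b → den q d u k b a ≠ 0 → num q d u k b a ≠ 0 →
      g a b * den q d u k b a = g b a * num q d u k b a := by
    intro a b hab h1 h2
    rw [h a b hab, h' b a hab.asymm, leadAt_Gz hq hd hu h1 h2, one_mul, div_mul_cancel₀ _ h1]
  intro a b hab h1 h2
  rcases hab with hab | hab
  · exact aux a b hab h1 h2
  · have h3 : den q d u k a b ≠ 0 := fun h3 => h2 ((num_eq_zero_iff hn hd a b).mpr h3)
    have h4 : num q d u k a b ≠ 0 := fun h4 => h1 ((num_eq_zero_iff hn hd b a).mp h4)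
    have := aux b a hab h3 h4
    have hm := zpow_ne_zero (mMat (bcol k a) (bcol k b)) hd
    rw [num_swap hn hd a b, den_swap hn hd a b]
    linear_combination (d ^ mMat (bcol k a) (bcol k b))⁻¹ * this

theorem isStructure_Gz_right (hn : 3 ≤ n) (hq : q ≠ 0) (hd : d ≠ 0) (hu : u ≠ 0)
    {g : Box → Box → ℂ}
    (h : ∀ a b, RowLt b a → g a b = leadAt (bx q d u b) (Gz q d u k (bcol k b) a))
    (h' : ∀ a b, ¬ RowLt b a → g a b = 1) : IsStructure q d u k g := by
  have aux : ∀ a b, RowLt b a → den q d u k b a ≠ 0 → num q d u k b a ≠ 0 →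
      g a b * den q d u k b a = g b a * num q d u k b a := by
    intro a b hab h1 h2
    rw [h a b hab, h' b a hab.asymm, leadAt_Gz hq hd hu h1 h2, one_mul, div_mul_cancel₀ _ h1]
  intro a b hab h1 h2
  rcases hab with hab | hab
  · have h3 : den q d u k a b ≠ 0 := fun h3 => h2 ((num_eq_zero_iff hn hd a b).mpr h3)
    have h4 : num q d u k a b ≠ 0 := fun h4 => h1 ((num_eq_zero_iff hn hd b a).mp h4)
    have := aux b a hab h3 h4
    have hm := zpow_ne_zero (mMat (bcol k a) (bcol k b)) hd
    rw [num_swap hn hd a b, den_swap hn hd a b]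
    linear_combination (d ^ mMat (bcol k a) (bcol k b))⁻¹ * this
  · exact aux a b hab h1 h2

/-! ### The contribution of a row -/

theorem psiZ_eq (hq : q ≠ 0) (c : ℂ) : psiZ q c = RatFunc.C q * (lin (q⁻¹ * q⁻¹ * c) / lin c) := by
  rw [psiZ, psi, mul_div_assoc', lin, lin]
  have : (RatFunc.C q : RatFunc ℂ) ≠ 0 := C_ne_zero hq
  simp only [map_mul, map_inv₀]
  field_simp

theorem psiZ_ne_zero (hq : q ≠ 0) (c : ℂ) : psiZ q c ≠ 0 := by
  rw [psiZ_eq hq]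
  exact mul_ne_zero (C_ne_zero hq) (div_ne_zero (lin_ne_zero _) (lin_ne_zero _))

theorem regAt_psiZ (hq : q ≠ 0) {a c : ℂ} (ha : a ≠ 0) (h1 : c ≠ a) (h2 : c ≠ q2 q * a) :
    RegAt a (psiZ q c) (psi q (c / a)) := by
  have h3 : q⁻¹ * q⁻¹ * c ≠ a := by
    rintro rfl
    apply h2
    rw [q2]; field_simp
  rw [psiZ_eq hq]
  convert (regAt_C a hq).mul ((regAt_lin ha h3).div (regAt_lin ha h1)) using 1
  rw [psi, mul_div_assoc']
  field_simp

variable (q d u k) in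
/-- Half of the contribution of row `s` of layer `p` to the eigenvalue of `K_i(z)`, if the row has
length `l`. -/
def half (i : ZMod n) (p s l : ℕ) : RatFunc ℂ :=
  if (l : ZMod n) + i = (s : ZMod n) + k then psiZ q (xpos q d u p (s - 1) (l - 1)) else 1

variable (q d u k) in
/-- The contribution of row `s` of layer `p` to the eigenvalue of `K_i(z)`, if the row has
length `l`. -/
def rowF (i : ZMod n) (p s l : ℕ) : RatFunc ℂ := half q d u k i p (s + 1) l / half q d u k i p s l

theorem half_ne_zero (hq : q ≠ 0) (i : ZMod n) (p s l : ℕ) : half q d u k i p s l ≠ 0 := by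
  rw [half]; split_ifs
  exacts [psiZ_ne_zero hq _, one_ne_zero]

theorem half_succ_succ (i : ZMod n) (p s l : ℕ) : half q d u k i p (s + 1) (l + 1) =
    if i = bcol k (p, s, l) then psiZ q (xpos q d u p s l) else 1 := by
  rw [half]
  refine if_congr ?_ (by push_cast; simp) rfl
  simp only [bcol]
  push_cast
  constructor <;> intro h <;> linear_combination h

theorem half_eq_succ (i : ZMod n) (p s l : ℕ) : half q d u k i p s (l + 1) =
    if bcol k (p, s, l) = i + 1 then psiZ q (xpos q d u p (s - 1) l) else 1 := by
  rw [half]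
  refine if_congr ?_ (by push_cast; simp) rfl
  simp only [bcol]
  push_cast
  constructor <;> intro h <;> linear_combination -h

theorem half_succ_eq (i : ZMod n) (p s l : ℕ) : half q d u k i p (s + 1) l =
    if i = bcol k (p, s, l) + 1 then psiZ q (xpos q d u p s (l - 1)) else 1 := by
  rw [half]
  refine if_congr ?_ (by push_cast; simp) rfl
  simp only [bcol]
  push_cast
  constructor <;> intro h <;> linear_combination h

theorem half_eq_eq (i : ZMod n) (p s l : ℕ) : half q d u k i p s l =
    if i = bcol k (p, s, l) then psiZ q (xpos q d u p (s - 1) (l - 1)) else 1 := by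
  rw [half]
  refine if_congr ?_ rfl rfl
  simp only [bcol]
  constructor <;> intro h <;> linear_combination h

theorem xpos_pred (hq : q ≠ 0) (hd : d ≠ 0) (p j y : ℤ) :
    xpos q d u p (j - 1) (y - 1) = q ^ 2 * xpos q d u p j y := by
  rw [xpos, xpos, zpow_sub_one₀ (q1_ne_zero hq hd), zpow_sub_one₀ (q3_ne_zero hq hd), q1, q3]
  field_simp

/-- A new box affects the `ψ`-factors only if its color is `i` or a neighbour of `i`. For color `i`
itself the old factor disappears and a new one appears, and the common linear factor at the position
of the box cancels. -/
theorem rowF_succ (hn : 3 ≤ n) (hq : q ≠ 0) (hd : d ≠ 0) (i : ZMod n) (p s l : ℕ) :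
    rowF q d u k i p s (l + 1) = rowF q d u k i p s l * Gz q d u k i (p, s, l) := by
  have e1 := zmod_ne_add_one hn
  have e2 := zmod_ne_add_two hn
  have hCq : (RatFunc.C q : RatFunc ℂ) ≠ 0 := C_ne_zero hq
  rw [rowF, rowF, half_succ_succ, half_eq_succ, half_succ_eq, half_eq_eq i p s l, Gz]
  have hx : bx q d u (p, s, l) = xpos q d u p s l := rfl
  rw [hx]
  generalize bcol k (p, s, l) = c
  have hl := lin_ne_zero
  by_cases h1 : i = c
  · subst h1
    rw [if_pos rfl, if_neg (e1 i), if_neg (e1 i), if_pos rfl, cartan_self, mMat_self hn,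
      psiZ_eq hq, psiZ_eq hq, xpos_pred hq hd]
    set x := xpos q d u p s l
    have t1 : q⁻¹ * q⁻¹ * (q ^ 2 * x) = x := by field_simp
    have t2 : q ^ (-2 : ℤ) * d ^ (-0 : ℤ) * x = q⁻¹ * q⁻¹ * x := by
      simp; left; field_simp
    have t3 : q ^ (2 : ℤ) * d ^ (-0 : ℤ) * x = q ^ 2 * x := by simp
    have t4 : q ^ (2 : ℤ) = q * q := by norm_cast; ring
    rw [t1, t2, t3, t4, map_mul]
    have := hl x; have := hl (q ^ 2 * x); have := hl (q⁻¹ * q⁻¹ * x)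
    field_simp
  by_cases h2 : c = i + 1
  · subst h2
    rw [if_neg (e1 i), if_pos rfl, if_neg (e2 i), if_neg (e1 i), cartan_succ hn, mMat_succ,
      psiZ_eq hq]
    have t0 : xpos q d u p (s - 1) l = d * q * xpos q d u p s l := by
      rw [xpos, xpos, zpow_sub_one₀ (q3_ne_zero hq hd), q3]; field_simp
    rw [t0]
    set x := xpos q d u p s l
    have t1 : q⁻¹ * q⁻¹ * (d * q * x) = q ^ (-1 : ℤ) * d ^ (-(-1) : ℤ) * x := by
      simp; field_simp
    have t2 : q ^ (-(-1) : ℤ) * d ^ (-(-1) : ℤ) * x = d * q * x := by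
      rw [neg_neg, zpow_one, zpow_one]; ring
    rw [t1, t2, zpow_neg_one, map_inv₀]
    have a1 := hl (q⁻¹ * d ^ (-(-1) : ℤ) * x)
    have a2 := hl (d * q * x)
    generalize lin (q⁻¹ * d ^ (-(-1) : ℤ) * x) = A at *
    generalize lin (d * q * x) = B at *
    field_simp
  by_cases h3 : i = c + 1
  · subst h3
    rw [if_neg h1, if_neg h2, if_pos rfl, if_neg h1, cartan_pred hn, mMat_pred hn, psiZ_eq hq]
    have t0 : xpos q d u p s (l - 1) = q * d⁻¹ * xpos q d u p s l := by
      rw [xpos, xpos, zpow_sub_one₀ (q1_ne_zero hq hd), q1]; field_simp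
    rw [t0]
    set x := xpos q d u p s l
    have t1 : q⁻¹ * q⁻¹ * (q * d⁻¹ * x) = q ^ (-1 : ℤ) * d ^ (-1 : ℤ) * x := by
      simp; field_simp
    have t2 : q ^ (-(-1) : ℤ) * d ^ (-1 : ℤ) * x = q * d⁻¹ * x := by simp
    rw [t1, t2, zpow_neg_one, map_inv₀]
    have a1 := hl (q⁻¹ * d ^ (-1 : ℤ) * x)
    have a2 := hl (q * d⁻¹ * x)
    generalize lin (q⁻¹ * d ^ (-1 : ℤ) * x) = A at *
    generalize lin (q * d⁻¹ * x) = B at *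
    field_simp
  · rw [if_neg h1, if_neg h2, if_neg h3, if_neg h1, cartan_far h1 h2 h3, mMat_far h2 h3]
    simp [div_self (hl _)]

theorem rowF_eq_prod (hn : 3 ≤ n) (hq : q ≠ 0) (hd : d ≠ 0) (i : ZMod n) (p s l : ℕ) :
    rowF q d u k i p s l =
      rowF q d u k i p s 0 * ∏ y ∈ Finset.range l, Gz q d u k i (p, s, y) := by
  induction l with
  | zero => simp
  | succ l ih => rw [rowF_succ hn hq hd, ih, Finset.prod_range_succ, mul_assoc]

/-- For empty rows, `rowF` is a quotient of the same `half` at consecutive rows, so the product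
telescopes. -/
theorem prod_rowF_zero (hq : q ≠ 0) (i : ZMod n) (p : ℕ) {a b : ℕ} (hab : a ≤ b) :
    ∏ s ∈ Finset.Ico a b, rowF q d u k i p s 0 =
      half q d u k i p b 0 / half q d u k i p a 0 := by
  induction b, hab using Nat.le_induction with
  | base => simp [div_self (half_ne_zero hq _ _ _ _)]
  | succ b hab ih =>
    rw [Finset.prod_Ico_succ_top hab, ih, rowF]
    have := half_ne_zero (u := u) (d := d) (k := k) hq i p b 0
    field_simp

theorem prod_boxes_layer (L : PlanePartition) (f : Box → RatFunc ℂ) (p : ℕ) (A : Finset ℕ) :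
    ∏ s ∈ A, ∏ y ∈ Finset.range (L.row p s), f (p, s, y) =
      ∏ b ∈ L.boxes with b.1 = p ∧ b.2.1 ∈ A, f b := by
  rw [Finset.prod_sigma']
  refine Finset.prod_nbij' (fun x => (p, x.1, x.2)) (fun b => ⟨b.2.1, b.2.2⟩) ?_ ?_ ?_ ?_ ?_
  · rintro ⟨s, y⟩ h
    simp only [Finset.mem_sigma, Finset.mem_range] at h
    simp [PlanePartition.mem_boxes, h]
  · rintro ⟨p', s, y⟩ h
    simp only [Finset.mem_filter, PlanePartition.mem_boxes] at h
    obtain ⟨h1, rfl, h2⟩ := h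
    simp [h1, h2]
  · rintro ⟨s, y⟩ h; rfl
  · rintro ⟨p', s, y⟩ h
    simp only [Finset.mem_filter] at h
    obtain ⟨h1, rfl, h2⟩ := h
    rfl
  · rintro ⟨s, y⟩ h; rfl

theorem prod_rowF (hn : 3 ≤ n) (hq : q ≠ 0) (hd : d ≠ 0) (i : ZMod n) (L : PlanePartition) (p : ℕ)
    {a b : ℕ} (hab : a ≤ b) :
    ∏ s ∈ Finset.Ico a b, rowF q d u k i p s (L.row p s) =
      half q d u k i p b 0 / half q d u k i p a 0 *
        ∏ c ∈ L.boxes with c.1 = p ∧ c.2.1 ∈ Finset.Ico a b, Gz q d u k i c := by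
  rw [← prod_boxes_layer, ← prod_rowF_zero hq i p hab, ← Finset.prod_mul_distrib]
  exact Finset.prod_congr rfl fun s _ => rowF_eq_prod hn hq hd i p s _

/-! ### The eigenvalue of a layer -/

theorem fockCut_spec (hn : 3 ≤ n) (i : ZMod n) (L : PlanePartition) (p a : ℕ) :
    a ≤ fockCut k i (L.row p) a ∧ L.row p (fockCut k i (L.row p) a) = 0 ∧
      i = ((fockCut k i (L.row p) a + 1 : ℕ) : ZMod n) + k := by
  have : NeZero n := ⟨by omega⟩
  have hne : {N : ℕ | a ≤ N ∧ L.row p N = 0 ∧ i = ((N + 1 : ℕ) : ZMod n) + k}.Nonempty := by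
    obtain ⟨J, hJ⟩ : ∃ J, L.row p J = 0 := by
      by_contra! h
      refine (Set.infinite_of_injective_forall_mem (f := fun j : ℕ => (p, j)) ?_ ?_)
        L.finite_support
      · intro j j' h; simpa using h
      · intro j; exact h j
    -- This row has the residue required by the color and lies beyond both `a` and the zero `J`.
    refine ⟨n * (a + J) + (i - 1 - k).val, ?_, ?_, ?_⟩
    · nlinarith
    · have : J ≤ n * (a + J) + (i - 1 - k).val := by nlinarith
      have := L.row_le_of_le (le_refl p) this
      omega
    · push_cast
      rw [ZMod.natCast_zmod_val]
      simp
      ring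
  exact Nat.sInf_mem hne

/-- At a cut of the right residue the boundary term of the telescoping product is trivial; this
justifies truncating the infinite products there. -/
theorem half_cut (hn : 3 ≤ n) {i : ZMod n} {N : ℕ} (h : i = ((N + 1 : ℕ) : ZMod n) + k) (p : ℕ) :
    half q d u k i p N 0 = 1 := by
  rw [half, if_neg]
  subst h
  push_cast
  intro h
  exact zmod_one_ne_zero hn (by linear_combination h)

theorem fockK_eq_prod (i : ZMod n) (L : PlanePartition) (p : ℕ) :
    fockK q d k i (u * q2 q ^ p) (L.row p) =
      ∏ s ∈ Finset.range (fockCut k i (L.row p) 0), rowF q d u k i p s (L.row p s) := by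
  rw [fockK]
  refine Finset.prod_congr rfl fun s _ => ?_
  rw [rowF, div_eq_mul_inv, half, half]
  congr 1
  · refine if_congr Iff.rfl ?_ rfl
    rw [xpos]; congr 1; push_cast; simp
  · have : ((L.row p s : ZMod n) + i + 1 = ((s + 1 : ℕ) : ZMod n) + k) ↔
        ((L.row p s : ZMod n) + i = (s : ZMod n) + k) := by
      push_cast
      constructor <;> intro h <;> linear_combination h
    rw [if_congr this rfl rfl, apply_ite Inv.inv, inv_one]
    refine if_congr Iff.rfl ?_ rfl
    rw [xpos]; congr 2

theorem fockK_eq (hn : 3 ≤ n) (hq : q ≠ 0) (hd : d ≠ 0) (i : ZMod n) (L : PlanePartition) (p : ℕ) :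
    fockK q d k i (u * q2 q ^ p) (L.row p) =
      (half q d u k i p 0 0)⁻¹ * ∏ b ∈ L.boxes with b.1 = p, Gz q d u k i b := by
  obtain ⟨-, h1, h2⟩ := fockCut_spec (k := k) hn i L p 0
  rw [fockK_eq_prod, Finset.range_eq_Ico, prod_rowF hn hq hd _ _ _ (Nat.zero_le _),
    half_cut hn h2, one_div]
  congr 1
  refine Finset.prod_congr (Finset.filter_congr fun b hb => ?_) fun _ _ => rfl
  rw [and_iff_left_iff_imp]
  rintro rfl
  rw [PlanePartition.mem_boxes] at hb
  simp only [Finset.mem_Ico, Nat.zero_le, true_and]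
  by_contra! h
  have := L.row_le_of_le (le_refl b.1) h
  omega

theorem half_zero_inv (hq : q ≠ 0) (hd : d ≠ 0) (i : ZMod n) (p : ℕ) :
    (half q d u k i p 0 0)⁻¹ = if i = k then
      RatFunc.C q⁻¹ * (lin (u * q2 q ^ (p + 1)) / lin (u * q2 q ^ p)) else 1 := by
  rw [half]
  simp only [Nat.cast_zero, zero_add]
  split_ifs with h
  · rw [xpos_pred hq hd, psiZ_eq hq, xpos]
    have t1 : q ^ 2 * (q1 q d ^ (0 : ℤ) * q3 q d ^ (0 : ℤ) * (u * q2 q ^ (p : ℤ))) =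
        u * q2 q ^ (p + 1) := by
      simp [q2]; ring
    have t2 : q⁻¹ * q⁻¹ * (u * q2 q ^ (p + 1)) = u * q2 q ^ p := by
      rw [pow_succ, q2]; field_simp
    rw [t1, t2, mul_inv, inv_div, map_inv₀]
  · simp

/-- The pole of the vacuum of a layer cancels against the zero of the preceding one. The zero of the
last layer survives, and it is what the stabilizing factor removes. -/
theorem prod_half_zero_inv (hq : q ≠ 0) (hd : d ≠ 0) (i : ZMod n) {a b : ℕ} (hab : a ≤ b) :
    ∏ p ∈ Finset.Ico a b, (half q d u k i p 0 0)⁻¹ = if i = k then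
      RatFunc.C (q ^ a * (q ^ b)⁻¹) * (lin (u * q2 q ^ b) / lin (u * q2 q ^ a)) else 1 := by
  induction b, hab using Nat.le_induction with
  | base =>
    have : q ^ a ≠ 0 := pow_ne_zero a hq
    simp [div_self (lin_ne_zero _), this]
  | succ b hab ih =>
    rw [Finset.prod_Ico_succ_top hab, ih, half_zero_inv hq hd]
    split_ifs with h
    · have h1 := lin_ne_zero (u * q2 q ^ b)
      have h2 := lin_ne_zero (u * q2 q ^ a)
      have h3 : q ^ a * (q ^ (b + 1))⁻¹ = q ^ a * (q ^ b)⁻¹ * q⁻¹ := by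
        rw [pow_succ, mul_inv]; ring
      rw [h3, map_mul RatFunc.C (q ^ a * (q ^ b)⁻¹)]
      field_simp
    · simp

theorem tensorK_eq (hn : 3 ≤ n) (hq : q ≠ 0) (hd : d ≠ 0) (i : ZMod n) (L : PlanePartition)
    (a b : ℕ) :
    tensorK q d k i u L a b = (∏ p ∈ Finset.Ico a b, (half q d u k i p 0 0)⁻¹) *
      ∏ c ∈ L.boxes with a ≤ c.1 ∧ c.1 < b, Gz q d u k i c := by
  have h1 : ∀ p ∈ Finset.Ico a b, fockK q d k i (u * q2 q ^ p) (L.row p) =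
      (half q d u k i p 0 0)⁻¹ * ∏ b ∈ L.boxes with b.1 = p, Gz q d u k i b :=
    fun p _ => fockK_eq hn hq hd i L p
  rw [tensorK, Finset.prod_congr rfl h1, Finset.prod_mul_distrib]
  congr 1
  rw [← Finset.prod_fiberwise_of_maps_to (s := L.boxes.filter fun c => a ≤ c.1 ∧ c.1 < b)
    (t := Finset.Ico a b) (g := fun c => c.1) (by simp)]
  refine Finset.prod_congr rfl fun p hp => ?_
  rw [Finset.filter_filter]
  refine Finset.prod_congr (Finset.filter_congr fun c _ => ?_) fun _ _ => rfl
  rw [Finset.mem_Ico] at hp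
  constructor
  · rintro rfl; exact ⟨hp, rfl⟩
  · exact fun h => h.2

variable (u k) in
/-- The vacuum eigenvalue, without the factor depending on the level. -/
def vac (i : ZMod n) : RatFunc ℂ := if i = k then (lin u)⁻¹ else 1

variable (q d u k) in
/-- The eigenvalue of `K_i(z)` on a set of boxes, without the factor depending on the level. -/
def Rhat (i : ZMod n) (S : Finset Box) : RatFunc ℂ := vac u k i * ∏ b ∈ S, Gz q d u k i b

variable (u k) in
/-- The factor depending on the level. -/
def levelFactor (K : ℂ) (i : ZMod n) : RatFunc ℂ :=
  if i = k then RatFunc.C K⁻¹ - RatFunc.C (K * u) / RatFunc.X else 1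

theorem stabFactor_eq (hq : q ≠ 0) (K : ℂ) (i : ZMod n) (r : ℕ) :
    stabFactor q k i u K r = levelFactor u k K i *
      (if i = k then RatFunc.C (q ^ r) * (lin (u * q2 q ^ r))⁻¹ else 1) := by
  rw [stabFactor, levelFactor]
  split_ifs with h
  · have h1 : (RatFunc.C (q ^ (-(r : ℤ))) - RatFunc.C (q ^ r * u) / RatFunc.X : RatFunc ℂ) =
        RatFunc.C (q ^ r)⁻¹ * lin (u * q2 q ^ r) := by
      have : (RatFunc.C q : RatFunc ℂ) ≠ 0 := C_ne_zero hq
      rw [lin, q2, zpow_neg, zpow_natCast]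
      simp only [map_mul, map_pow, map_inv₀]
      field_simp
      ring
    rw [h1, div_eq_mul_inv, mul_inv, ← map_inv₀, inv_inv]
  · simp

/-- The denominator of `f_r` cancels the boundary term of the `r` vacuum layers, and all boxes lie
in these layers, so `r` disappears. -/
theorem macK_eq (hn : 3 ≤ n) (hq : q ≠ 0) (hd : d ≠ 0) (K : ℂ) (i : ZMod n) (L : PlanePartition)
    {r : ℕ} (hr : L.HasLayers r) :
    macK q d k i u K L r = levelFactor u k K i * Rhat q d u k i L.boxes := by
  rw [macK, stabFactor_eq hq, tensorK_eq hn hq hd _ _ 0 r,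
    prod_half_zero_inv hq hd _ (Nat.zero_le r), Rhat, vac]
  have h1 : L.boxes.filter (fun c => 0 ≤ c.1 ∧ c.1 < r) = L.boxes := by
    refine Finset.filter_true_of_mem fun b hb => ⟨Nat.zero_le _, ?_⟩
    by_contra! h
    rw [PlanePartition.mem_boxes, hr _ h] at hb
    omega
  rw [h1]
  split_ifs with h
  · have := lin_ne_zero (u * q2 q ^ r)
    have h2 : (RatFunc.C q : RatFunc ℂ) ≠ 0 := C_ne_zero hq
    have := lin_ne_zero u
    simp only [pow_zero, mul_one, one_mul, map_pow, map_inv₀]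
    field_simp
  · simp

end Eigenvalues

/-! ## Matrix elements of `E_i(z)` and `F_i(z)` -/

section MatrixElements

variable {n : ℕ} {q d u : ℂ} {k : ZMod n}

theorem RegAt.exists_prod {ι : Type*} {a : ℂ} {s : Finset ι} {f : ι → RatFunc ℂ}
    (h : ∀ x ∈ s, ∃ v, RegAt a (f x) v) : ∃ v, RegAt a (∏ x ∈ s, f x) v := by
  choose! v hv using h
  exact ⟨_, RegAt.prod hv⟩

theorem regAt_half (hq : q ≠ 0) (hd : d ≠ 0) (hu : u ≠ 0) (hgen : GenericParameters q d)
    (i : ZMod n) {p s l : ℕ} {b : Box}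
    (h1 : ¬ ((l : ℤ) - 1 - b.2.2 = p - b.1 ∧ (p : ℤ) - b.1 = s - 1 - b.2.1))
    (h2 : ¬ ((l : ℤ) - 1 - b.2.2 = p - (b.1 + 1) ∧ (p : ℤ) - (b.1 + 1) = s - 1 - b.2.1)) :
    RegAt (bx q d u b) (half q d u k i p s l)
      (if (l : ZMod n) + i = (s : ZMod n) + k then
        psi q (xpos q d u p (s - 1) (l - 1) / bx q d u b) else 1) := by
  rw [half]
  refine RegAt.ite fun _ => regAt_psiZ hq (bx_ne_zero hq hd hu b) ?_ ?_
  · rwa [bx, Ne, xpos_eq_iff hq hd hu hgen]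
  · rwa [bx, ← xpos_layer hq, Ne, xpos_eq_iff hq hd hu hgen]

/-- The conditions under which the contribution of a row is regular at the position of `b`. -/
theorem exists_regAt_rowF (hq : q ≠ 0) (hd : d ≠ 0) (hu : u ≠ 0) (hgen : GenericParameters q d)
    (i : ZMod n) {p s l : ℕ} {b : Box}
    (h : RowLt (p, s, l) b ∧ (s ≤ b.2.1 → b.2.2 < l) ∨
      RowLt b (p, s, l) ∧ (b.2.1 ≤ s → l ≤ b.2.2)) :
    RegAt (bx q d u b) (rowF q d u k i p s l)
      ((if (l : ZMod n) + i = ((s + 1 : ℕ) : ZMod n) + k then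
        psi q (xpos q d u p ((s + 1 : ℕ) - 1) (l - 1) / bx q d u b) else 1) /
      (if (l : ZMod n) + i = (s : ZMod n) + k then
        psi q (xpos q d u p (s - 1) (l - 1) / bx q d u b) else 1)) := by
  simp only [RowLt] at h
  refine RegAt.div (regAt_half hq hd hu hgen i ?_ ?_) (regAt_half hq hd hu hgen i ?_ ?_) <;>
    push_cast <;> omega

/-- Converts the inverse `ψ`-factors of the eigenvalue into the factors with inverted argument that
occur in the matrix elements. -/
theorem psi_inv_eq {t : ℂ} (hq : q ≠ 0) (ht : t ≠ 0) (h1 : t ≠ 1) :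
    (psi q (q ^ 2 * t))⁻¹ = psi q t⁻¹ := by
  have h2 : 1 - t ≠ 0 := sub_ne_zero.mpr h1.symm
  have h3 : 1 - t⁻¹ ≠ 0 := by
    intro h; apply h2; field_simp at h; linear_combination -h
  rw [psi, psi, inv_div]
  have h4 : q - q⁻¹ * (q ^ 2 * t) = q * (1 - t) := by field_simp
  rw [h4, div_eq_div_iff (mul_ne_zero hq h2) h3]
  field_simp
  ring

theorem leadAt_rowF_eq_fockFactor (hq : q ≠ 0) (hd : d ≠ 0) (hu : u ≠ 0)
    (hgen : GenericParameters q d) (i : ZMod n) (lam : ℕ → ℕ) {p j s : ℕ} {b : Box}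
    (hb : b = (p, j, lam j))
    (h : RowLt (p, s, lam s) b ∧ (s ≤ b.2.1 → b.2.2 < lam s) ∨
      RowLt b (p, s, lam s) ∧ (b.2.1 ≤ s → lam s ≤ b.2.2)) :
    RegAt (bx q d u b) (rowF q d u k i p s (lam s)) (fockFactor q d k i lam j s) := by
  convert exists_regAt_rowF (u := u) (k := k) hq hd hu hgen i h using 1
  subst hb
  have g1 := q1_ne_zero hq hd
  have g3 := q3_ne_zero hq hd
  have g2 := q2_ne_zero hq
  have f1 := zpow_ne_zero (lam j : ℤ) g1
  have f3 := zpow_ne_zero (j : ℤ) g3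
  have f2 := zpow_ne_zero (p : ℤ) g2
  rw [fockFactor, div_eq_mul_inv]
  congr 1
  · refine if_congr Iff.rfl ?_ rfl
    congr 1
    rw [bx, xpos, xpos]
    dsimp only
    push_cast
    rw [add_sub_cancel_right, show (lam s : ℤ) - lam j - 1 = lam s - 1 - lam j by ring,
      zpow_sub₀ g1, zpow_sub₀ g3]
    field_simp
  · have : ((lam s : ZMod n) + i + 1 = ((s + 1 : ℕ) : ZMod n) + k) ↔
        ((lam s : ZMod n) + i = (s : ZMod n) + k) := by
      push_cast
      constructor <;> intro h <;> linear_combination h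
    rw [if_congr this rfl rfl, apply_ite Inv.inv, inv_one]
    refine if_congr Iff.rfl ?_ rfl
    set t : ℂ := q1 q d ^ ((lam s : ℤ) - lam j) * q3 q d ^ ((s : ℤ) - j) with ht
    have e1 : xpos q d u p (s - 1) ((lam s : ℤ) - 1) / bx q d u (p, j, lam j) = q ^ 2 * t := by
      rw [xpos_pred hq hd, ht, bx, xpos, xpos, zpow_sub₀ g1, zpow_sub₀ g3]
      dsimp only
      field_simp
    have e2 : q1 q d ^ ((lam j : ℤ) - lam s) * q3 q d ^ ((j : ℤ) - s) = t⁻¹ := by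
      rw [ht, mul_inv, ← zpow_neg, ← zpow_neg, neg_sub, neg_sub]
    rw [e1, e2, psi_inv_eq hq]
    · exact mul_ne_zero (zpow_ne_zero _ g1) (zpow_ne_zero _ g3)
    · intro h1
      -- The exponent of `q₂` is zero, so `t = 1` would force `s = j`, against the strict order of
      -- the rows.
      have := hgen ((lam s : ℤ) - lam j) 0 ((s : ℤ) - j) (by rw [zpow_zero, mul_one, ← ht, h1])
      simp only [RowLt] at h
      omega

variable (q d u k) in
/-- The vacuum part of the rows before `b`. -/
def vacE (i : ZMod n) (b : Box) : RatFunc ℂ :=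
  (∏ p ∈ Finset.Ico 0 b.1, (half q d u k i p 0 0)⁻¹) *
    (half q d u k i b.1 b.2.1 0 / half q d u k i b.1 0 0)

variable (q d u k) in
/-- The vacuum part of the rows after `b`. -/
def vacF (i : ZMod n) (b : Box) : RatFunc ℂ :=
  (half q d u k i b.1 (b.2.1 + 1) 0)⁻¹ *
    (if i = k then RatFunc.C (q ^ (b.1 + 1)) * (lin (u * q2 q ^ (b.1 + 1)))⁻¹ else 1)

theorem vac_eq (hq : q ≠ 0) (hd : d ≠ 0) (i : ZMod n) (b : Box) :
    vac u k i = vacE q d u k i b * rowF q d u k i b.1 b.2.1 0 * vacF q d u k i b := by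
  have h0 := fun s => half_ne_zero (u := u) (d := d) (k := k) hq i b.1 s 0
  have h1 : vacE q d u k i b * rowF q d u k i b.1 b.2.1 0 * vacF q d u k i b =
      (∏ p ∈ Finset.Ico 0 (b.1 + 1), (half q d u k i p 0 0)⁻¹) *
    (if i = k then RatFunc.C (q ^ (b.1 + 1)) * (lin (u * q2 q ^ (b.1 + 1)))⁻¹ else 1) := by
    rw [vacE, vacF, rowF, Finset.prod_Ico_succ_top (Nat.zero_le _)]
    have := h0 0; have := h0 b.2.1; have := h0 (b.2.1 + 1)
    field_simp
  rw [h1, prod_half_zero_inv hq hd _ (Nat.zero_le _), vac]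
  split_ifs with h
  · have := lin_ne_zero (u * q2 q ^ (b.1 + 1))
    have h2 : (RatFunc.C q : RatFunc ℂ) ≠ 0 := C_ne_zero hq
    have := lin_ne_zero u
    simp only [pow_zero, mul_one, one_mul, map_pow, map_inv₀]
    field_simp
  · simp

open Classical in
variable (q d u k) in
/-- The contribution of a box to the matrix elements of `E_i(z)`. -/
def gE (a b : Box) : ℂ :=
  if RowLt a b then leadAt (bx q d u b) (Gz q d u k (bcol k b) a) else 1

open Classical in
variable (q d u k) in
/-- The contribution of a box to the matrix elements of `F_i(z)`. -/
def gF (a b : Box) : ℂ :=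
  if RowLt b a then leadAt (bx q d u b) (Gz q d u k (bcol k b) a) else 1

variable (q d u k) in
/-- The matrix element of `E_i(z)` adding the box `b` to `S`. -/
def wE : Finset Box → Box → ℂ :=
  wt (fun b => leadAt (bx q d u b) (vacE q d u k (bcol k b) b)) (gE q d u k)

variable (q d u k) in
/-- The value of the level factor at the position of a box. -/
def levelAt (K : ℂ) (b : Box) : ℂ := if bcol k b = k then K⁻¹ - K * u / bx q d u b else 1

variable (q d u k) in
/-- The matrix element of `F_i(z)` removing the box `b` from `S ∪ {b}`. -/
def wF (K : ℂ) : Finset Box → Box → ℂ :=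
  wt (fun b => levelAt q d u k K b * leadAt (bx q d u b) (vacF q d u k (bcol k b) b)) (gF q d u k)

theorem isStructure_gE (hn : 3 ≤ n) (hq : q ≠ 0) (hd : d ≠ 0) (hu : u ≠ 0) :
    IsStructure q d u k (gE q d u k) :=
  isStructure_Gz_left hn hq hd hu (fun _ _ h => if_pos h) (fun _ _ h => if_neg h)

theorem isStructure_gF (hn : 3 ≤ n) (hq : q ≠ 0) (hd : d ≠ 0) (hu : u ≠ 0) :
    IsStructure q d u k (gF q d u k) :=
  isStructure_Gz_right hn hq hd hu (fun _ _ h => if_pos h) (fun _ _ h => if_neg h)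

theorem vacE_ne_zero (hq : q ≠ 0) (i : ZMod n) (b : Box) : vacE q d u k i b ≠ 0 := by
  have h0 := fun p s => half_ne_zero (u := u) (d := d) (k := k) hq i p s 0
  exact mul_ne_zero (Finset.prod_ne_zero_iff.mpr fun p _ => inv_ne_zero (h0 _ _))
    (div_ne_zero (h0 _ _) (h0 _ _))

theorem vacF_ne_zero (hq : q ≠ 0) (i : ZMod n) (b : Box) : vacF q d u k i b ≠ 0 := by
  refine mul_ne_zero (inv_ne_zero (half_ne_zero hq _ _ _ _)) ?_
  split_ifs
  · exact mul_ne_zero (C_ne_zero (pow_ne_zero _ hq)) (inv_ne_zero (lin_ne_zero _))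
  · exact one_ne_zero

theorem wE_ne_zero (hq : q ≠ 0) (S : Finset Box) (b : Box) : wE q d u k S b ≠ 0 := by
  refine mul_ne_zero (leadAt_ne_zero (vacE_ne_zero hq _ _)) (Finset.prod_ne_zero_iff.mpr fun c _ => ?_)
  rw [gE]
  split_ifs
  exacts [leadAt_ne_zero (Gz_ne_zero hq _ _), one_ne_zero]

/-- Leading coefficients of nonzero functions do not vanish, so the level factor is the only
possible zero. -/
theorem wF_ne_zero (hq : q ≠ 0) {K : ℂ} {b : Box} (hK : levelAt q d u k K b ≠ 0)
    (S : Finset Box) : wF q d u k K S b ≠ 0 := by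
  refine mul_ne_zero (mul_ne_zero hK (leadAt_ne_zero (vacF_ne_zero hq _ _)))
    (Finset.prod_ne_zero_iff.mpr fun c _ => ?_)
  rw [gF]
  split_ifs
  exacts [leadAt_ne_zero (Gz_ne_zero hq _ _), one_ne_zero]

open Classical in
variable (q d u k) in
/-- The eigenvalue on the rows before `b`. -/
def RE (i : ZMod n) (S : Finset Box) (b : Box) : RatFunc ℂ :=
  vacE q d u k i b * ∏ c ∈ S with RowLt c b, Gz q d u k i c

open Classical in
variable (q d u k) in
/-- The eigenvalue on the rows after `b`, without the factor depending on the level. -/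
def RF (i : ZMod n) (S : Finset Box) (b : Box) : RatFunc ℂ :=
  vacF q d u k i b * ∏ c ∈ S with RowLt b c, Gz q d u k i c

theorem wE_eq (S : Finset Box) (b : Box) :
    wE q d u k S b = leadAt (bx q d u b) (RE q d u k (bcol k b) S b) := by
  classical
  rw [wE, wt, RE, leadAt_mul, leadAt_prod, Finset.prod_filter]
  rfl

theorem wF_eq (K : ℂ) (S : Finset Box) (b : Box) : wF q d u k K S b =
    levelAt q d u k K b * leadAt (bx q d u b) (RF q d u k (bcol k b) S b) := by
  classical
  rw [wF, wt, RF, leadAt_mul, leadAt_prod, Finset.prod_filter, mul_assoc]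
  rfl

open PlanePartition

/-- The new box belongs to the plane partition `M`, so the rows weakly before it in both directions
already reach its column. -/
theorem row_gt_of_addBox {L M : PlanePartition} {p j : ℕ} (h : L.AddBox M p j) {p' s : ℕ}
    (hp : p' ≤ p) (hs : s ≤ j) (hne : ¬ (p' = p ∧ s = j)) : L.row p j < L.row p' s := by
  have h1 := M.row_le_of_le hp hs
  have h2 := h p j
  have h3 := h p' s
  rw [if_neg hne] at h3
  rw [if_pos ⟨rfl, rfl⟩] at h2
  omega

theorem RE_boxes (hn : 3 ≤ n) (hq : q ≠ 0) (hd : d ≠ 0) (i : ZMod n) (L : PlanePartition)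
    (p j y : ℕ) : RE q d u k i L.boxes (p, j, y) = tensorK q d k i u L 0 p *
      ∏ s ∈ Finset.Ico 0 j, rowF q d u k i p s (L.row p s) := by
  classical
  rw [RE, vacE, tensorK_eq hn hq hd, prod_rowF hn hq hd _ _ _ (Nat.zero_le j)]
  dsimp only
  have : L.boxes.filter (fun c => RowLt c (p, j, y)) =
      L.boxes.filter (fun c => 0 ≤ c.1 ∧ c.1 < p) ∪
      L.boxes.filter (fun c => c.1 = p ∧ c.2.1 ∈ Finset.Ico 0 j) := by
    ext c
    simp only [Finset.mem_filter, Finset.mem_union, RowLt, Finset.mem_Ico]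
    grind
  rw [this, Finset.prod_union]
  · ring
  · rw [Finset.disjoint_filter]
    intro c _ h1 h2
    omega

/-- Regularity is checked for whole rows: factors of single boxes can have zeros and poles at `bx b`
that cancel only within a row. -/
theorem regAt_tensorK (hq : q ≠ 0) (hd : d ≠ 0) (hu : u ≠ 0)
    (hgen : GenericParameters q d) (i : ZMod n) (L : PlanePartition) (b : Box) (a c : ℕ)
    (h : ∀ p, a ≤ p → p < c → ∀ s, RowLt (p, s, L.row p s) b ∧ (s ≤ b.2.1 → b.2.2 < L.row p s) ∨
      RowLt b (p, s, L.row p s) ∧ (b.2.1 ≤ s → L.row p s ≤ b.2.2)) :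
    ∃ v, RegAt (bx q d u b) (tensorK q d k i u L a c) v := by
  refine RegAt.exists_prod fun p hp => ?_
  rw [Finset.mem_Ico] at hp
  rw [fockK_eq_prod]
  exact RegAt.exists_prod fun s _ => ⟨_, exists_regAt_rowF hq hd hu hgen i (h p hp.1 hp.2 s)⟩

/-- All rows before `b` are regular at its position, so the value there is the leading coefficient
of `RE`, which factors over boxes. The vanishing of the order is used again for the residues. -/
theorem macE_eq (hn : 3 ≤ n) (hq : q ≠ 0) (hd : d ≠ 0) (hu : u ≠ 0)
    (hgen : GenericParameters q d) {L M : PlanePartition} {p j : ℕ} (h : L.AddBox M p j)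
    {b : Box} (hb : b = (p, j, L.row p j)) :
    macE q d k (bcol k b) u L p j = wE q d u k L.boxes b ∧
      ordAt (bx q d u b) (RE q d u k (bcol k b) L.boxes b) = 0 := by
  have hrow : ∀ p' s, p' < p ∨ p' = p ∧ s < j →
      RowLt (p', s, L.row p' s) b ∧ (s ≤ b.2.1 → b.2.2 < L.row p' s) := by
    intro p' s hps
    subst hb
    refine ⟨hps, fun hs => row_gt_of_addBox h (by omega) hs (by omega)⟩
  obtain ⟨v, hv⟩ := regAt_tensorK hq hd hu hgen (k := k) (bcol k b) L b 0 p
    (fun p' _ hp' s => Or.inl (hrow p' s (Or.inl hp')))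
  have hF : RegAt (bx q d u b) (∏ s ∈ Finset.Ico 0 j, rowF q d u k (bcol k b) p s (L.row p s))
      (∏ s ∈ Finset.Ico 0 j, fockFactor q d k (bcol k b) (L.row p) j s) :=
    RegAt.prod fun s hs => leadAt_rowF_eq_fockFactor hq hd hu hgen _ _ hb
      (Or.inl (hrow p s (Or.inr ⟨rfl, (Finset.mem_Ico.mp hs).2⟩)))
  have hsupp : boxSupport q d u L p j = bx q d u b := by
    rw [hb, boxSupport, fockSupport, bx, xpos]; simp
  have hRE : RegAt (bx q d u b) (RE q d u k (bcol k b) L.boxes b) (v * fockE q d k (bcol k b) (L.row p) j) := by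
    rw [fockE, Finset.range_eq_Ico]
    have := hv.mul hF
    rw [← RE_boxes hn hq hd _ L p j (L.row p j), ← hb] at this
    exact this
  exact ⟨by rw [macE, wE_eq, hRE.lead, hsupp, hv.evalAt_eq], hRE.ord⟩

/-- The vacuum of the layers above `p`, together with the stabilizing factor without its numerator,
telescopes to `vacF`, in which `r` no longer occurs. -/
theorem RF_boxes (hn : 3 ≤ n) (hq : q ≠ 0) (hd : d ≠ 0) (i : ZMod n) (L : PlanePartition)
    {p j y r N : ℕ} (hr : p < r) (hL : L.HasLayers r) (hj : j + 1 ≤ N) (hN : L.row p N = 0)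
    (hNi : i = ((N + 1 : ℕ) : ZMod n) + k) :
    RF q d u k i L.boxes (p, j, y) = (∏ s ∈ Finset.Ico (j + 1) N, rowF q d u k i p s (L.row p s)) *
      ((if i = k then RatFunc.C (q ^ r) * (lin (u * q2 q ^ r))⁻¹ else 1) *
        tensorK q d k i u L (p + 1) r) := by
  classical
  rw [RF, vacF, tensorK_eq hn hq hd, prod_rowF hn hq hd _ _ _ hj, half_cut hn hNi,
    prod_half_zero_inv hq hd _ hr]
  dsimp only
  have : L.boxes.filter (fun c => RowLt (p, j, y) c) =
      L.boxes.filter (fun c => p + 1 ≤ c.1 ∧ c.1 < r) ∪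
      L.boxes.filter (fun c => c.1 = p ∧ c.2.1 ∈ Finset.Ico (j + 1) N) := by
    ext ⟨p', s, y'⟩
    rw [Finset.mem_union, Finset.mem_filter, Finset.mem_filter, Finset.mem_filter]
    simp only [RowLt, Finset.mem_Ico, mem_boxes]
    have h1 : y' < L.row p' s → p' < r := by
      intro h; by_contra! h'; rw [hL _ h'] at h; omega
    have h2 : y' < L.row p s → s < N := by
      intro h; by_contra! h'; have := L.row_le_of_le (le_refl p) h'; omega
    constructor
    · rintro ⟨h3, h4 | ⟨rfl, h4⟩⟩
      · exact Or.inl ⟨h3, h4, h1 h3⟩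
      · exact Or.inr ⟨h3, rfl, h4, h2 h3⟩
    · rintro (⟨h3, h4, h5⟩ | ⟨h3, rfl, h4, h5⟩)
      · exact ⟨h3, Or.inl h4⟩
      · exact ⟨h3, Or.inr ⟨rfl, h4⟩⟩
  rw [this, Finset.prod_union]
  · split_ifs with h
    · have := lin_ne_zero (u * q2 q ^ r)
      have h2 : (RatFunc.C q : RatFunc ℂ) ≠ 0 := C_ne_zero hq
      have := lin_ne_zero (u * q2 q ^ (p + 1))
      have := half_ne_zero (u := u) (d := d) (k := k) hq i p (j + 1) 0
      simp only [map_pow, map_inv₀, map_mul]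
      field_simp
    · ring
  · rw [Finset.disjoint_filter]
    intro c _ h1 h2
    omega

/-- The level factor may vanish at a box for special `K`, so only `HasValAt`, which admits the value
zero, is available. -/
theorem hasValAt_levelFactor (hq : q ≠ 0) (hd : d ≠ 0) (hu : u ≠ 0) (K : ℂ) (b : Box) :
    HasValAt (bx q d u b) (levelFactor u k K (bcol k b)) (levelAt q d u k K b) := by
  have hb := bx_ne_zero hq hd hu b
  rw [levelFactor, levelAt]
  split_ifs
  · refine ⟨Polynomial.C K⁻¹ * Polynomial.X - Polynomial.C (K * u), Polynomial.X, by simpa, ?_, ?_⟩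
    · rw [sub_div' RatFunc.X_ne_zero]; simp
    · simp; field_simp
  · exact hasValAt_one _

theorem macF_eq (hn : 3 ≤ n) (hq : q ≠ 0) (hd : d ≠ 0) (hu : u ≠ 0)
    (hgen : GenericParameters q d) (K : ℂ) {L M : PlanePartition} {p j r : ℕ} (h : L.AddBox M p j)
    (hr : M.HasLayers r) {b : Box} (hb : b = (p, j, L.row p j)) :
    macF q d k (bcol k b) u K L p j r = wF q d u k K L.boxes b ∧
      ordAt (bx q d u b) (RF q d u k (bcol k b) L.boxes b) = 0 := by
  have hx := bx_ne_zero hq hd hu b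
  have hpr : p < r := by
    by_contra! h'
    have := h p j
    rw [hr p h', if_pos ⟨rfl, rfl⟩] at this
    omega
  have hL : L.HasLayers r := fun p' hp' j' => by
    have := h p' j'
    rw [hr p' hp'] at this
    omega
  have hrow : ∀ p' s, p < p' ∨ p = p' ∧ j < s →
      RowLt b (p', s, L.row p' s) ∧ (b.2.1 ≤ s → L.row p' s ≤ b.2.2) := by
    intro p' s hps
    subst hb
    refine ⟨hps, fun hs => L.row_le_of_le (by omega) hs⟩
  obtain ⟨c1, c2, c3⟩ := fockCut_spec (k := k) hn (bcol k b) L p (j + 1)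
  obtain ⟨v, hv⟩ := regAt_tensorK hq hd hu hgen (k := k) (bcol k b) L b (p + 1) r
    (fun p' hp' _ s => Or.inr (hrow p' s (Or.inl hp')))
  have hF : RegAt (bx q d u b) (∏ s ∈ Finset.Ico (j + 1) (fockCut k (bcol k b) (L.row p) (j + 1)),
      rowF q d u k (bcol k b) p s (L.row p s)) (fockF q d k (bcol k b) (L.row p) j) :=
    RegAt.prod fun s hs => leadAt_rowF_eq_fockFactor hq hd hu hgen _ _ hb
      (Or.inr (hrow p s (Or.inr ⟨rfl, (Finset.mem_Ico.mp hs).1⟩)))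
  have hsupp : boxSupport q d u L p j = bx q d u b := by
    rw [hb, boxSupport, fockSupport, bx, xpos]; simp
  obtain ⟨v', hv'⟩ : ∃ v', RegAt (bx q d u b) (if bcol k b = k then
      RatFunc.C (q ^ r) * (lin (u * q2 q ^ r))⁻¹ else 1) v' := by
    refine ⟨_, RegAt.ite fun _ => (regAt_C _ (pow_ne_zero _ hq)).mul (regAt_lin hx ?_).inv⟩
    -- The remaining pole is the position `(r, 0, 0)`. For it to be the position of `b`, with `p <
    -- r`, the column of `b` would have to be negative.
    have : u * q2 q ^ r = xpos q d u r 0 0 := by rw [xpos]; simp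
    rw [this, bx, Ne, xpos_eq_iff hq hd hu hgen, hb]
    dsimp only
    omega
  have hRF := hF.mul (hv'.mul hv)
  rw [← RF_boxes hn hq hd _ L hpr hL c1 c2 c3 (y := L.row p j), ← hb] at hRF
  refine ⟨?_, hRF.ord⟩
  rw [macF, hsupp, stabFactor_eq hq, mul_assoc, wF_eq, hRF.lead,
    ((hasValAt_levelFactor hq hd hu K b).mul (hv'.mul hv).val).evalAt_eq]
  ring

theorem Rhat_eq (hn : 3 ≤ n) (hq : q ≠ 0) (hd : d ≠ 0) (i : ZMod n) (L : PlanePartition)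
    (p j y : ℕ) : Rhat q d u k i L.boxes =
      RE q d u k i L.boxes (p, j, y) * rowF q d u k i p j (L.row p j) *
        RF q d u k i L.boxes (p, j, y) := by
  classical
  rw [Rhat, vac_eq hq hd i (p, j, y), rowF_eq_prod hn hq hd i p j (L.row p j), RE, RF]
  have h1 := prod_boxes_layer L (Gz q d u k i) p {j}
  rw [Finset.prod_singleton] at h1
  rw [h1]
  dsimp only
  have h2 : L.boxes = L.boxes.filter (fun c => RowLt c (p, j, y)) ∪
      (L.boxes.filter (fun c => c.1 = p ∧ c.2.1 ∈ ({j} : Finset ℕ)) ∪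
        L.boxes.filter (fun c => RowLt (p, j, y) c)) := by
    ext c
    simp only [Finset.mem_filter, Finset.mem_union, RowLt, Finset.mem_singleton]
    grind
  conv_lhs => rw [h2]
  rw [Finset.prod_union, Finset.prod_union]
  · ring
  · rw [Finset.disjoint_filter]
    intro c _ h1 h2
    simp only [Finset.mem_singleton, RowLt] at h1 h2
    omega
  · rw [Finset.disjoint_union_right, Finset.disjoint_filter, Finset.disjoint_filter]
    constructor
    · intro c _ h1 h2
      simp only [Finset.mem_singleton, RowLt] at h1 h2
      omega
    · intro c _ h1 h2
      exact h1.asymm h2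

end MatrixElements

/-! ## Heights of diagonals -/

section Heights

/-- The position is in `S` or has a negative coordinate. -/
def InExt (S : Finset Box) (p j y : ℤ) : Prop :=
  p < 0 ∨ j < 0 ∨ y < 0 ∨ (p.toNat, j.toNat, y.toNat) ∈ S

theorem InExt.mono {S : Finset Box} (hS : Low S) {p j y p' j' y' : ℤ} (h : InExt S p j y)
    (hp : p' ≤ p) (hj : j' ≤ j) (hy : y' ≤ y) : InExt S p' j' y' := by
  by_cases h0 : p' < 0 ∨ j' < 0 ∨ y' < 0
  · unfold InExt; tauto
  · rcases h with h | h | h | h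
    · omega
    · omega
    · omega
    · refine Or.inr (Or.inr (Or.inr (hS _ h _ ?_)))
      simp only [Prod.mk_le_mk]; omega

theorem inExt_natCast {S : Finset Box} (b : Box) : InExt S b.1 b.2.1 b.2.2 ↔ b ∈ S := by
  obtain ⟨p, j, y⟩ := b
  unfold InExt
  simp only [Int.toNat_natCast]
  constructor
  · rintro (h | h | h | h)
    · omega
    · omega
    · omega
    · exact h
  · exact fun h => Or.inr (Or.inr (Or.inr h))

/-- The diagonal of a box. -/
def diag (b : Box) : ℤ × ℤ := ((b.2.2 : ℤ) - b.1, (b.2.1 : ℤ) - b.1)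

/-- The number of boxes on a diagonal. -/
def diagCount (S : Finset Box) (D : ℤ × ℤ) : ℕ := (S.filter fun b => diag b = D).card

/-- The layer in which a diagonal leaves `S`. -/
def height (S : Finset Box) (a b : ℤ) : ℤ := max 0 (max (-a) (-b)) + diagCount S (a, b)

/-- Along a diagonal the extended set is closed downwards, so it ends at a threshold `h`. The layers
with nonnegative coordinates start at `max 0 (max (-a) (-b))`, and the actual boxes fill the
interval from there to `h`. -/
theorem lt_height_iff {S : Finset Box} (hS : Low S) (a b p : ℤ) :
    p < height S a b ↔ InExt S p (p + b) (p + a) := by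
  obtain ⟨h, hh, hmin⟩ : ∃ h : ℤ, ¬ InExt S h (h + b) (h + a) ∧
      ∀ z, ¬ InExt S z (z + b) (z + a) → h ≤ z := by
    refine Int.exists_least_of_bdd ⟨0, fun z hz => ?_⟩ ?_
    · by_contra! h
      exact hz (Or.inl h)
    · refine ⟨|a| + |b| + (S.sup fun c => c.1) + 1, fun hz => ?_⟩
      have ha := neg_abs_le a
      have hb := neg_abs_le b
      have ha' := abs_nonneg a
      have hb' := abs_nonneg b
      rcases hz with hz | hz | hz | hz
      · omega
      · omega
      · omega
      · have := Finset.le_sup (f := fun c : Box => c.1) hz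
        simp only at this
        omega
  have hspec : ∀ z, z < h ↔ InExt S z (z + b) (z + a) := by
    intro z
    constructor
    · intro hz; by_contra hc; exact absurd (hmin z hc) (not_le.mpr hz)
    · intro hz; by_contra! hc
      exact hh (hz.mono hS hc (by omega) (by omega))
  have h0 : max 0 (max (-a) (-b)) ≤ h := by
    by_contra! hc
    apply hh
    unfold InExt
    omega
  have hcard : (diagCount S (a, b) : ℤ) = h - max 0 (max (-a) (-b)) := by
    have : diagCount S (a, b) = (Finset.Ico (max 0 (max (-a) (-b))) h).card := by
      refine Finset.card_nbij' (fun c => (c.1 : ℤ)) (fun p => (p.toNat, (p + b).toNat, (p + a).toNat))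
        ?_ ?_ ?_ ?_
      · rintro ⟨p, j, y⟩ hc
        simp only [Finset.coe_filter, Set.mem_ofPred_eq, diag, Prod.mk.injEq] at hc
        have := (hspec p).mpr (by
          have := (inExt_natCast (S := S) (p, j, y)).mpr hc.1
          convert this using 1 <;> simp only <;> omega)
        simp only [Finset.coe_Ico, Set.mem_Ico]
        omega
      · intro p hp
        simp only [Finset.coe_Ico, Set.mem_Ico] at hp
        have := (hspec p).mp hp.2
        simp only [Finset.coe_filter, Set.mem_ofPred_eq, diag, Prod.mk.injEq]
        refine ⟨?_, ?_, ?_⟩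
        · rcases this with h1 | h1 | h1 | h1
          · omega
          · omega
          · omega
          · exact h1
        · omega
        · omega
      · rintro ⟨p, j, y⟩ hc
        simp only [Finset.coe_filter, Set.mem_ofPred_eq, diag, Prod.mk.injEq] at hc
        simp only [Prod.mk.injEq]
        omega
      · intro p hp
        simp only [Finset.coe_Ico, Set.mem_Ico] at hp
        simp only
        omega
    rw [this, Int.card_Ico]
    omega
  rw [height, hcard, ← hspec]
  omega

/-- The box `(p, j + 1, y)` lies between `(p, j, y)` and the next box `(p + 1, j + 1, y + 1)` of the
same diagonal, so the heights interlace. The column and layer versions are analogous. -/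
theorem height_row {S : Finset Box} (hS : Low S) (a b : ℤ) :
    height S a (b + 1) ≤ height S a b ∧ height S a b ≤ height S a (b + 1) + 1 := by
  constructor
  · by_contra! h
    rw [lt_height_iff hS] at h
    exact lt_irrefl _ ((lt_height_iff hS a b _).mpr (h.mono hS le_rfl (by omega) le_rfl))
  · by_contra! h
    rw [lt_height_iff hS] at h
    exact lt_irrefl _ ((lt_height_iff hS a (b + 1) _).mpr
      (h.mono hS (by omega) (by omega) (by omega)))

theorem height_col {S : Finset Box} (hS : Low S) (a b : ℤ) :
    height S (a + 1) b ≤ height S a b ∧ height S a b ≤ height S (a + 1) b + 1 := by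
  constructor
  · by_contra! h
    rw [lt_height_iff hS] at h
    exact lt_irrefl _ ((lt_height_iff hS a b _).mpr (h.mono hS le_rfl le_rfl (by omega)))
  · by_contra! h
    rw [lt_height_iff hS] at h
    exact lt_irrefl _ ((lt_height_iff hS (a + 1) b _).mpr
      (h.mono hS (by omega) (by omega) (by omega)))

theorem height_layer {S : Finset Box} (hS : Low S) (a b : ℤ) :
    height S (a + 1) (b + 1) ≤ height S a b ∧ height S a b ≤ height S (a + 1) (b + 1) + 1 := by
  constructor
  · by_contra! h
    rw [lt_height_iff hS] at h
    exact lt_irrefl _ ((lt_height_iff hS a b _).mpr (h.mono hS le_rfl (by omega) (by omega)))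
  · by_contra! h
    rw [lt_height_iff hS] at h
    exact lt_irrefl _ ((lt_height_iff hS (a + 1) (b + 1) _).mpr
      (h.mono hS (by omega) (by omega) (by omega)))

/-- The boxes which can be removed from `S`. -/
def removable (S : Finset Box) : Finset Box := by
  classical exact S.filter fun b => Low (S.erase b)

theorem mem_removable {S : Finset Box} {b : Box} : b ∈ removable S ↔ b ∈ S ∧ Low (S.erase b) := by
  classical
  rw [removable, Finset.mem_filter]

/-- The order of vanishing of the eigenvalue on a diagonal. -/
def diagOrd (S : Finset Box) (a b : ℤ) : ℤ :=
  height S a (b + 1) + height S (a + 1) b + height S (a - 1) (b - 1) -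
    height S a (b - 1) - height S (a - 1) b - height S (a + 1) (b + 1)

theorem diagOrd_spec {S : Finset Box} (hS : Low S) (a b : ℤ) :
    -1 ≤ diagOrd S a b ∧ (diagOrd S a b < 0 →
      (∃ c ∈ addable S, diag c = (a, b)) ∨ ∃ c ∈ removable S, diag c = (a, b)) := by
  have r1 := height_row hS a b
  have r2 := height_row hS a (b - 1)
  have r3 := height_row hS (a - 1) (b - 1)
  have r4 := height_row hS (a + 1) b
  have c1 := height_col hS a b
  have c2 := height_col hS (a - 1) b
  have c3 := height_col hS (a - 1) (b - 1)
  have c4 := height_col hS a (b + 1)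
  have l1 := height_layer hS a b
  have l2 := height_layer hS (a - 1) (b - 1)
  have l3 := height_layer hS (a - 1) b
  have l4 := height_layer hS a (b - 1)
  rw [sub_add_cancel] at r2 r3 c2 c3 l2 l3 l4
  rw [sub_add_cancel] at l2
  unfold diagOrd
  refine ⟨by omega, fun hneg => ?_⟩
  -- The interlacing leaves two configurations. In the first, all predecessors of the next position
  -- on the diagonal are present, so it can be added; in the second, the last position has no cover
  -- in `S`, so it can be removed.
  have hcase : (height S (a + 1) (b + 1) = height S a b ∧ height S (a - 1) b = height S a b + 1 ∧
      height S a (b - 1) = height S a b + 1) ∨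
      (height S a (b + 1) = height S a b - 1 ∧ height S (a + 1) b = height S a b - 1 ∧
      height S (a - 1) (b - 1) = height S a b) := by omega
  have hspec := lt_height_iff hS
  set h := height S a b with hh
  have hin : InExt S (h - 1) (h - 1 + b) (h - 1 + a) := (hspec a b (h - 1)).mp (by omega)
  have hout : ¬ InExt S h (h + b) (h + a) := fun h1 => by
    have := (hspec a b h).mpr h1; omega
  rcases hcase with ⟨e1, e2, e3⟩ | ⟨e1, e2, e3⟩
  · have i1 := (hspec (a + 1) (b + 1) (h - 1)).mp (by omega)
    have i2 := (hspec (a - 1) b h).mp (by omega)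
    have i3 := (hspec a (b - 1) h).mp (by omega)
    clear r1 r2 r3 r4 c1 c2 c3 c4 l1 l2 l3 l4 e1 e2 e3 hneg hspec hin
    have hpos : 0 ≤ h ∧ 0 ≤ h + b ∧ 0 ≤ h + a := by
      unfold InExt at hout; omega
    clear_value h
    obtain ⟨p, rfl⟩ := Int.eq_ofNat_of_zero_le hpos.1
    obtain ⟨j, hj⟩ := Int.eq_ofNat_of_zero_le hpos.2.1
    obtain ⟨y, hy⟩ := Int.eq_ofNat_of_zero_le hpos.2.2
    rw [hj, hy] at hout
    have hout' : (p, j, y) ∉ S := fun h1 => hout ((inExt_natCast (p, j, y)).mpr h1)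
    refine Or.inl ⟨(p, j, y), mem_addable.mpr ⟨hout', ?_⟩, ?_⟩
    · rw [low_iff_covers]
      intro c hc c' hcc
      rcases Finset.mem_insert.mp hc with rfl | hc
      · refine Finset.mem_insert_of_mem ((inExt_natCast c').mp ?_)
        obtain ⟨p', j', y'⟩ := c'
        simp only [Covers, Prod.mk.injEq] at hcc
        rcases hcc with ⟨rfl, rfl, rfl⟩ | ⟨rfl, rfl, rfl⟩ | ⟨rfl, rfl, rfl⟩
        · convert i1 using 1 <;> push_cast at * <;> omega
        · convert i3 using 1 <;> push_cast at * <;> omega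
        · convert i2 using 1 <;> push_cast at * <;> omega
      · exact Finset.mem_insert_of_mem (hS c hc c' hcc.le)
    · simp only [diag, Prod.mk.injEq]; omega
  · have i1 : ¬ InExt S (h - 1) (h + b) (h - 1 + a) := fun h1 => by
      have := (hspec a (b + 1) (h - 1)).mpr (by convert h1 using 1; omega); omega
    have i2 : ¬ InExt S (h - 1) (h - 1 + b) (h + a) := fun h1 => by
      have := (hspec (a + 1) b (h - 1)).mpr (by convert h1 using 1; omega); omega
    have i3 : ¬ InExt S h (h - 1 + b) (h - 1 + a) := fun h1 => by
      have := (hspec (a - 1) (b - 1) h).mpr (by convert h1 using 1 <;> omega); omega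
    clear r1 r2 r3 r4 c1 c2 c3 c4 l1 l2 l3 l4 e1 e2 e3 hneg hspec hout
    have hpos : 0 ≤ h - 1 ∧ 0 ≤ h - 1 + b ∧ 0 ≤ h - 1 + a := by
      unfold InExt at i1 i2 i3; omega
    clear_value h
    obtain ⟨p, hp⟩ := Int.eq_ofNat_of_zero_le hpos.1
    obtain ⟨j, hj⟩ := Int.eq_ofNat_of_zero_le hpos.2.1
    obtain ⟨y, hy⟩ := Int.eq_ofNat_of_zero_le hpos.2.2
    rw [hj, hy, hp] at hin
    have hin' : (p, j, y) ∈ S := (inExt_natCast (p, j, y)).mp hin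
    refine Or.inr ⟨(p, j, y), mem_removable.mpr ⟨hin', ?_⟩, ?_⟩
    · rw [low_iff_covers]
      intro c hc c' hcc
      rw [Finset.mem_erase] at hc ⊢
      refine ⟨?_, hS c hc.2 c' hcc.le⟩
      rintro rfl
      have h2 := (inExt_natCast c).mpr hc.2
      rcases hcc with rfl | rfl | rfl
      · apply i3; convert h2 using 1; push_cast; omega
      · apply i1; convert h2 using 1; push_cast; omega
      · apply i2; convert h2 using 1; push_cast; omega
    · simp only [diag, Prod.mk.injEq]; omega

/-- The offsets of the six heights cancel except at the origin, where they leave `-1`, the vacuum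
pole at `u`. -/
theorem diagOrd_eq (S : Finset Box) (a b : ℤ) :
    diagOrd S a b = (diagCount S (a, b + 1) : ℤ) + diagCount S (a + 1, b) +
      diagCount S (a - 1, b - 1) - diagCount S (a, b - 1) - diagCount S (a - 1, b) -
      diagCount S (a + 1, b + 1) - (if a = 0 ∧ b = 0 then 1 else 0) := by
  unfold diagOrd height
  split_ifs <;> omega

/-- There is at most one corner on each diagonal. -/
theorem corner_unique {S : Finset Box} (hS : Low S) {b c : Box} (hb : b ∈ addable S ∪ removable S)
    (hc : c ∈ addable S ∪ removable S) (h : diag b = diag c) : b = c := by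
  have aux : ∀ b c : Box, b ∈ addable S ∪ removable S → c ∈ addable S ∪ removable S →
      ∀ t : ℕ, c = (b.1 + t + 1, b.2.1 + t + 1, b.2.2 + t + 1) → False := by
    rintro ⟨p, j, y⟩ c hb hc t rfl
    -- The farther corner forces this box into `S`, and with it the nearer corner and its cover `(p
    -- + 1, j, y)`. Then the nearer corner is neither addable nor removable.
    have hc' : ((p + t + 1, j + t + 1, y + t) : Box) ∈ S := by
      rcases Finset.mem_union.mp hc with hc | hc
      · have := (mem_addable.mp hc).2 _ (Finset.mem_insert_self _ _) (p + t + 1, j + t + 1, y + t)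
          (by simp [Prod.mk_le_mk])
        simpa using this
      · exact hS _ (mem_removable.mp hc).1 _ (by simp [Prod.mk_le_mk])
    have h1 : ((p, j, y) : Box) ∈ S := hS _ hc' _ (by simp only [Prod.mk_le_mk]; omega)
    have h2 : ((p + 1, j, y) : Box) ∈ S := hS _ hc' _ (by simp only [Prod.mk_le_mk]; omega)
    rcases Finset.mem_union.mp hb with hb | hb
    · exact (mem_addable.mp hb).1 h1
    · have := (mem_removable.mp hb).2 (p + 1, j, y) (by simp [h2]) (p, j, y)
        (by simp [Prod.mk_le_mk])
      simp at this
  obtain ⟨p, j, y⟩ := b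
  obtain ⟨p', j', y'⟩ := c
  simp only [diag, Prod.mk.injEq] at h
  rcases lt_trichotomy p p' with h1 | h1 | h1
  · refine (aux _ _ hb hc (p' - p - 1) ?_).elim
    simp only [Prod.mk.injEq]; omega
  · simp only [Prod.mk.injEq]; omega
  · refine (aux _ _ hc hb (p - p' - 1) ?_).elim
    simp only [Prod.mk.injEq]; omega

end Heights

/-! ## The poles of the eigenvalues -/

section Poles

/-- The hypothesis says `B ≤ A + S` as multisets: the factors over `S` cancel all poles not
cancelled by zeros, and the leftover multiset `D` gives the polynomial. -/
theorem exists_invPoly_of_count {A B : Multiset ℂ} {S : Finset ℂ}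
    (h : ∀ x ∈ B, B.count x ≤ A.count x + if x ∈ S then 1 else 0) :
    ∃ P : Polynomial ℂ, P.natDegree + Multiset.card B ≤ Multiset.card A + S.card ∧
      (A.map lin).prod / (B.map lin).prod * ∏ x ∈ S, lin x = invPoly P := by
  have hle : B ≤ A + S.val := by
    rw [Multiset.le_iff_count]
    intro x
    by_cases hx : x ∈ B
    · rw [Multiset.count_add, Multiset.count_eq_of_nodup S.nodup]
      exact h x hx
    · rw [Multiset.count_eq_zero_of_notMem hx]; exact Nat.zero_le _
  obtain ⟨D, hD⟩ := Multiset.le_iff_exists_add.mp hle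
  refine ⟨(D.map fun x => 1 - Polynomial.C x * Polynomial.X).prod, ?_, ?_⟩
  · have h1 : (D.map fun x => (1 - Polynomial.C x * Polynomial.X : Polynomial ℂ)).prod.natDegree ≤
        Multiset.card D := by
      refine (Polynomial.natDegree_multiset_prod_le _).trans ?_
      rw [Multiset.map_map]
      refine (Multiset.sum_map_le_sum_map _ (fun _ => 1) fun x _ => ?_).trans (by simp)
      simp only [Function.comp]
      compute_degree
    have := congrArg Multiset.card hD
    rw [Multiset.card_add, Multiset.card_add, Finset.card_val] at this
    omega
  · have hB : (B.map lin).prod ≠ 0 := by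
      refine Multiset.prod_ne_zero fun h0 => ?_
      obtain ⟨c, _, hc⟩ := Multiset.mem_map.mp h0
      exact lin_ne_zero c hc
    have key : (A.map lin).prod * ∏ x ∈ S, lin x = (B.map lin).prod * (D.map lin).prod := by
      rw [← Multiset.prod_add, ← Multiset.map_add, ← hD, Multiset.map_add, Multiset.prod_add]
      rfl
    have h2 : invPoly (D.map fun x => 1 - Polynomial.C x * Polynomial.X).prod =
        (D.map lin).prod := by
      rw [map_multiset_prod, Multiset.map_map]
      simp only [Function.comp_def, invPoly_lin]
    rw [h2, div_mul_eq_mul_div, key, mul_div_cancel_left₀ _ hB]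

/-! ### Zeros and poles located on diagonals -/

variable {n : ℕ} {q d u : ℂ} {k : ZMod n}

variable (q d u) in
/-- The position belonging to a diagonal. -/
def dpos (D : ℤ × ℤ) : ℂ := xpos q d u 0 D.2 D.1

theorem xpos_eq_dpos (hq : q ≠ 0) (hd : d ≠ 0) (hu : u ≠ 0) (hgen : GenericParameters q d)
    (p j y : ℤ) : xpos q d u p j y = dpos q d u (y - p, j - p) :=
  (xpos_eq_iff hq hd hu hgen).mpr (by omega)

theorem dpos_injective (hq : q ≠ 0) (hd : d ≠ 0) (hu : u ≠ 0) (hgen : GenericParameters q d) :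
    Function.Injective (dpos q d u) := by
  rintro ⟨a, b⟩ ⟨a', b'⟩ h
  have := (xpos_eq_iff hq hd hu hgen).mp h
  simp only [Prod.mk.injEq]; omega

theorem bx_eq_dpos (hq : q ≠ 0) (hd : d ≠ 0) (hu : u ≠ 0) (hgen : GenericParameters q d)
    (b : Box) : bx q d u b = dpos q d u (diag b) :=
  xpos_eq_dpos hq hd hu hgen _ _ _

/-- The color of a diagonal. -/
def dcol (k : ZMod n) (D : ℤ × ℤ) : ZMod n := k + (D.2 : ZMod n) - (D.1 : ZMod n)

theorem bcol_eq_dcol (b : Box) : bcol k b = dcol k (diag b) := by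
  simp only [bcol, dcol, diag]; push_cast; ring

variable (q d u k) in
/-- The zero of `Gz`. -/
def zeroPos (i : ZMod n) (b : Box) : ℂ :=
  q ^ (-cartan i (bcol k b)) * d ^ (-mMat i (bcol k b)) * bx q d u b

variable (q d u k) in
/-- The pole of `Gz`. -/
def polePos (i : ZMod n) (b : Box) : ℂ :=
  q ^ cartan i (bcol k b) * d ^ (-mMat i (bcol k b)) * bx q d u b

theorem color_cases (i c : ZMod n) : i = c ∨ c = i + 1 ∨ i = c + 1 ∨
    (i ≠ c ∧ c ≠ i + 1 ∧ i ≠ c + 1) := by tauto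

/-- In terms of diagonals, the zero and the pole of `Gz` are neighbours of the diagonal of the box,
determined by its color relative to `i`. For distant colors the two coincide. -/
theorem zeroPos_polePos (hn : 3 ≤ n) (hq : q ≠ 0) (hd : d ≠ 0) (hu : u ≠ 0)
    (hgen : GenericParameters q d) (i : ZMod n) (b : Box) :
    (i = bcol k b ∧ zeroPos q d u k i b = dpos q d u (diag b + (1, 1)) ∧
      polePos q d u k i b = dpos q d u (diag b - (1, 1))) ∨
    (bcol k b = i + 1 ∧ zeroPos q d u k i b = dpos q d u (diag b - (0, 1)) ∧
      polePos q d u k i b = dpos q d u (diag b + (1, 0))) ∨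
    (i = bcol k b + 1 ∧ zeroPos q d u k i b = dpos q d u (diag b - (1, 0)) ∧
      polePos q d u k i b = dpos q d u (diag b + (0, 1))) ∨
    ((i ≠ bcol k b ∧ bcol k b ≠ i + 1 ∧ i ≠ bcol k b + 1) ∧
      zeroPos q d u k i b = dpos q d u (diag b) ∧ polePos q d u k i b = dpos q d u (diag b)) := by
  obtain ⟨p, j, y⟩ := b
  have key := xpos_eq_dpos hq hd hu hgen
  have hl := fun p j y => xpos_layer (d := d) (u := u) hq p j y
  have hr := fun p j y => xpos_row (u := u) hq hd p j y
  have hc := fun p j y => xpos_col (u := u) hq hd p j y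
  have e1 : ∀ a b c : ℤ, xpos q d u a b c = xpos q d u (a - 1 + 1) b c := by simp
  have e2 : ∀ a b c : ℤ, xpos q d u a b c = xpos q d u a (b - 1 + 1) c := by simp
  have e3 : ∀ a b c : ℤ, xpos q d u a b c = xpos q d u a b (c - 1 + 1) := by simp
  have z1 : ∀ a b c : ℤ, zeroPos q d u k i (p, j, y) = xpos q d u a b c →
      zeroPos q d u k i (p, j, y) = dpos q d u (c - a, b - a) := fun a b c h => h.trans (key _ _ _)
  have z2 : ∀ a b c : ℤ, polePos q d u k i (p, j, y) = xpos q d u a b c →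
      polePos q d u k i (p, j, y) = dpos q d u (c - a, b - a) := fun a b c h => h.trans (key _ _ _)
  rcases color_cases i (bcol k (p, j, y)) with h | h | h | h
  · refine Or.inl ⟨h, ?_, ?_⟩
    · convert z1 (p - 1) j y ?_ using 2
      · simp only [diag, Prod.mk_add_mk, Prod.mk.injEq]; omega
      · rw [zeroPos, ← h, cartan_self, mMat_self hn, bx, e1, hl, q2, zpow_neg, neg_zero, zpow_zero,
          mul_one, show (2 : ℤ) = ((2 : ℕ) : ℤ) from rfl, zpow_natCast,
          inv_mul_cancel_left₀ (pow_ne_zero 2 hq)]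
    · convert z2 (p + 1) j y ?_ using 2
      · simp only [diag, Prod.mk_sub_mk, Prod.mk.injEq]; omega
      · rw [polePos, ← h, cartan_self, mMat_self hn, bx, hl, q2]
        norm_cast
        simp
  · refine Or.inr (Or.inl ⟨h, ?_, ?_⟩)
    · convert z1 p (j - 1) y ?_ using 2
      · simp only [diag, Prod.mk_sub_mk, Prod.mk.injEq]; omega
      · rw [zeroPos, h, cartan_succ hn, mMat_succ, bx, e2, hr, q3]
        norm_num
        field_simp
    · convert z2 p j (y + 1) ?_ using 2
      · simp only [diag, Prod.mk_add_mk, Prod.mk.injEq]; omega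
      · rw [polePos, h, cartan_succ hn, mMat_succ, bx, hc, q1, neg_neg, zpow_one, zpow_neg_one]
        ring
  · refine Or.inr (Or.inr (Or.inl ⟨h, ?_, ?_⟩))
    · convert z1 p j (y - 1) ?_ using 2
      · simp only [diag, Prod.mk_sub_mk, Prod.mk.injEq]; omega
      · rw [zeroPos, h, cartan_pred hn, mMat_pred hn, bx, e3, hc, q1]
        norm_num
        field_simp
    · convert z2 p (j + 1) y ?_ using 2
      · simp only [diag, Prod.mk_add_mk, Prod.mk.injEq]; omega
      · rw [polePos, h, cartan_pred hn, mMat_pred hn, bx, hr, q3]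
        norm_num
  · refine Or.inr (Or.inr (Or.inr ⟨h, ?_, ?_⟩))
    · rw [zeroPos, cartan_far h.1 h.2.1 h.2.2, mMat_far h.2.1 h.2.2, bx_eq_dpos hq hd hu hgen]
      simp
    · rw [polePos, cartan_far h.1 h.2.1 h.2.2, mMat_far h.2.1 h.2.2, bx_eq_dpos hq hd hu hgen]
      simp

theorem dcol_shift (D : ℤ × ℤ) : dcol k (D - (1, 1)) = dcol k D ∧ dcol k (D + (1, 1)) = dcol k D ∧
    dcol k (D + (0, 1)) = dcol k D + 1 ∧ dcol k D = dcol k (D - (0, 1)) + 1 ∧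
    dcol k D = dcol k (D + (1, 0)) + 1 ∧ dcol k (D - (1, 0)) = dcol k D + 1 := by
  simp only [dcol, Prod.fst_sub, Prod.snd_sub, Prod.fst_add, Prod.snd_add]
  push_cast
  refine ⟨?_, ?_, ?_, ?_, ?_, ?_⟩ <;> ring

/-- As `D` has color `i`, the color of each listed diagonal matches exactly one of the cases of
`zeroPos_polePos`. -/
theorem zeroPos_eq_iff (hn : 3 ≤ n) (hq : q ≠ 0) (hd : d ≠ 0) (hu : u ≠ 0)
    (hgen : GenericParameters q d) {i : ZMod n} {D : ℤ × ℤ} (hD : dcol k D = i) (b : Box) :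
    zeroPos q d u k i b = dpos q d u D ↔
      diag b = D - (1, 1) ∨ diag b = D + (0, 1) ∨ diag b = D + (1, 0) := by
  have inj : ∀ D', dpos q d u D' = dpos q d u D ↔ D' = D := fun D' =>
    (dpos_injective hq hd hu hgen).eq_iff
  obtain ⟨s1, s2, s3, s4, s5, s6⟩ := dcol_shift (k := k) D
  have n1 := zmod_ne_add_one hn
  have n2 := zmod_ne_add_two hn
  subst hD
  rcases zeroPos_polePos (k := k) hn hq hd hu hgen (dcol k D) b with
    ⟨h, h1, -⟩ | ⟨h, h1, -⟩ | ⟨h, h1, -⟩ | ⟨h, h1, -⟩ <;> rw [h1, inj] <;>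
    rw [bcol_eq_dcol] at h
  · rw [← eq_sub_iff_add_eq]
    refine ⟨Or.inl, ?_⟩
    rintro (e | e | e)
    · exact e
    · rw [e, s3] at h; exact absurd h (n1 _)
    · rw [e] at h; rw [← h] at s5; exact absurd s5 (n1 _)
  · rw [sub_eq_iff_eq_add]
    refine ⟨fun e => Or.inr (Or.inl e), ?_⟩
    rintro (e | e | e)
    · rw [e, s1] at h; exact absurd h (n1 _)
    · exact e
    · rw [e] at h; rw [h] at s5; exact absurd s5 (n2 _)
  · rw [sub_eq_iff_eq_add]
    refine ⟨fun e => Or.inr (Or.inr e), ?_⟩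
    rintro (e | e | e)
    · rw [e, s1] at h; exact absurd h (n1 _)
    · rw [e, s3] at h; exact absurd h (n2 _)
    · exact e
  · refine ⟨fun e => absurd (by rw [e]) h.1, ?_⟩
    rintro (e | e | e) <;> rw [e] at h
    · exact absurd s1.symm h.1
    · exact absurd s3 h.2.1
    · exact absurd s5 h.2.2

theorem polePos_eq_iff (hn : 3 ≤ n) (hq : q ≠ 0) (hd : d ≠ 0) (hu : u ≠ 0)
    (hgen : GenericParameters q d) {i : ZMod n} {D : ℤ × ℤ} (hD : dcol k D = i) (b : Box) :
    polePos q d u k i b = dpos q d u D ↔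
      diag b = D + (1, 1) ∨ diag b = D - (0, 1) ∨ diag b = D - (1, 0) := by
  have inj : ∀ D', dpos q d u D' = dpos q d u D ↔ D' = D := fun D' =>
    (dpos_injective hq hd hu hgen).eq_iff
  obtain ⟨s1, s2, s3, s4, s5, s6⟩ := dcol_shift (k := k) D
  have n1 := zmod_ne_add_one hn
  have n2 := zmod_ne_add_two hn
  subst hD
  rcases zeroPos_polePos (k := k) hn hq hd hu hgen (dcol k D) b with
    ⟨h, -, h1⟩ | ⟨h, -, h1⟩ | ⟨h, -, h1⟩ | ⟨h, -, h1⟩ <;> rw [h1, inj] <;>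
    rw [bcol_eq_dcol] at h
  · rw [sub_eq_iff_eq_add]
    refine ⟨Or.inl, ?_⟩
    rintro (e | e | e)
    · exact e
    · rw [e] at h; rw [← h] at s4; exact absurd s4 (n1 _)
    · rw [e, s6] at h; exact absurd h (n1 _)
  · rw [← eq_sub_iff_add_eq]
    refine ⟨fun e => Or.inr (Or.inr e), ?_⟩
    rintro (e | e | e)
    · rw [e, s2] at h; exact absurd h (n1 _)
    · rw [e] at h; rw [h] at s4; exact absurd s4 (n2 _)
    · exact e
  · rw [← eq_sub_iff_add_eq]
    refine ⟨fun e => Or.inr (Or.inl e), ?_⟩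
    rintro (e | e | e)
    · rw [e, s2] at h; exact absurd h (n1 _)
    · exact e
    · rw [e, s6] at h; exact absurd h (n2 _)
  · refine ⟨fun e => absurd (by rw [e]) h.1, ?_⟩
    rintro (e | e | e) <;> rw [e] at h
    · exact absurd s2.symm h.1
    · exact absurd s4 h.2.2
    · exact absurd s6 h.2.1

variable (q d u k) in
/-- The zeros of the eigenvalue. -/
def zerosOf (i : ZMod n) (S : Finset Box) : Multiset ℂ := S.val.map (zeroPos q d u k i)

variable (q d u k) in
/-- The poles of the eigenvalue. -/
def polesOf (i : ZMod n) (S : Finset Box) : Multiset ℂ :=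
  S.val.map (polePos q d u k i) + if i = k then {u} else 0

theorem count_map_pos (S : Finset Box) (f : Box → ℂ) (x : ℂ) {D₁ D₂ D₃ : ℤ × ℤ}
    (h12 : D₁ ≠ D₂) (h13 : D₁ ≠ D₃) (h23 : D₂ ≠ D₃)
    (h : ∀ b, f b = x ↔ diag b = D₁ ∨ diag b = D₂ ∨ diag b = D₃) :
    (S.val.map f).count x = diagCount S D₁ + diagCount S D₂ + diagCount S D₃ := by
  rw [Multiset.count_map]
  have h0 : (Multiset.filter (fun a => x = f a) S.val).card =
      (S.filter fun b => diag b = D₁ ∨ diag b = D₂ ∨ diag b = D₃).card := by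
    rw [Finset.card_def, Finset.filter_val]
    congr 1
    refine Multiset.filter_congr fun b _ => ?_
    rw [eq_comm, h]
  rw [h0, Finset.filter_or, Finset.filter_or, Finset.card_union_of_disjoint,
    Finset.card_union_of_disjoint, diagCount, diagCount, diagCount, add_assoc]
  · exact Finset.disjoint_filter.mpr fun b _ h1 h2 => h23 (h1.symm.trans h2)
  · rw [← Finset.filter_or]
    refine Finset.disjoint_filter.mpr fun b _ h1 h2 => ?_
    rcases h2 with h2 | h2
    exacts [h12 (h1.symm.trans h2), h13 (h1.symm.trans h2)]

theorem u_eq_dpos : u = dpos q d u (0, 0) := by simp [dpos, xpos]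

/-- Three neighbouring diagonals contribute zeros and three contribute poles; with the vacuum pole
on the diagonal `(0, 0)` this is the formula of `diagOrd_eq`. -/
theorem count_sub_count (hn : 3 ≤ n) (hq : q ≠ 0) (hd : d ≠ 0) (hu : u ≠ 0)
    (hgen : GenericParameters q d) {i : ZMod n} {a b : ℤ} (hD : dcol k (a, b) = i)
    (S : Finset Box) :
    ((zerosOf q d u k i S).count (dpos q d u (a, b)) : ℤ) -
      (polesOf q d u k i S).count (dpos q d u (a, b)) = diagOrd S a b := by
  have h1 : (if i = k then {u} else (0 : Multiset ℂ)).count (dpos q d u (a, b)) =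
      if a = 0 ∧ b = 0 then 1 else 0 := by
    by_cases h : a = 0 ∧ b = 0
    · obtain ⟨rfl, rfl⟩ := h
      have : i = k := by rw [← hD]; simp [dcol]
      rw [if_pos this, if_pos ⟨rfl, rfl⟩, ← u_eq_dpos, Multiset.count_singleton_self]
    · rw [if_neg h]
      split_ifs
      · refine Multiset.count_eq_zero_of_notMem fun h' => h ?_
        rw [Multiset.mem_singleton] at h'
        have := dpos_injective hq hd hu hgen (h'.trans u_eq_dpos)
        simpa using this
      · simp
  rw [diagOrd_eq, zerosOf, polesOf, Multiset.count_add, h1,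
    count_map_pos S _ _ ?_ ?_ ?_ (zeroPos_eq_iff hn hq hd hu hgen hD),
    count_map_pos S _ _ ?_ ?_ ?_ (polePos_eq_iff hn hq hd hu hgen hD)]
  · simp only [Prod.mk_add_mk, Prod.mk_sub_mk, add_zero, sub_zero]
    split_ifs <;> push_cast <;> ring
  all_goals
    simp only [Prod.mk_add_mk, Prod.mk_sub_mk, ne_eq, Prod.mk.injEq]; omega

theorem Rhat_eq_zeros_div_poles (hq : q ≠ 0) (i : ZMod n) (S : Finset Box) :
    ∃ c : ℂ, c ≠ 0 ∧ Rhat q d u k i S = RatFunc.C c *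
      (((zerosOf q d u k i S).map lin).prod / ((polesOf q d u k i S).map lin).prod) := by
  refine ⟨∏ b ∈ S, q ^ cartan i (bcol k b),
    Finset.prod_ne_zero_iff.mpr fun b _ => zpow_ne_zero _ hq, ?_⟩
  have hv : vac u k i = (((if i = k then {u} else (0 : Multiset ℂ)).map lin).prod)⁻¹ := by
    rw [vac]; split_ifs <;> simp
  rw [Rhat, hv, polesOf, Multiset.map_add, Multiset.prod_add, zerosOf, Multiset.map_map,
    Multiset.map_map]
  have : ∏ b ∈ S, Gz q d u k i b = RatFunc.C (∏ b ∈ S, q ^ cartan i (bcol k b)) *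
      ((∏ b ∈ S, lin (zeroPos q d u k i b)) / ∏ b ∈ S, lin (polePos q d u k i b)) := by
    rw [map_prod, ← Finset.prod_div_distrib, ← Finset.prod_mul_distrib]
    rfl
  rw [this]
  simp only [Finset.prod, Function.comp_def, div_eq_mul_inv, mul_inv]
  ring

variable (k) in
/-- The corners of color `i`. -/
def corners (i : ZMod n) (S : Finset Box) : Finset Box :=
  (addable S ∪ removable S).filter fun b => bcol k b = i

theorem bx_injOn_corners (hq : q ≠ 0) (hd : d ≠ 0) (hu : u ≠ 0)
    (hgen : GenericParameters q d) (i : ZMod n) {S : Finset Box} (hS : Low S) :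
    Set.InjOn (bx q d u) (corners k i S) := by
  intro b hb c hc h
  rw [bx_eq_dpos hq hd hu hgen, bx_eq_dpos hq hd hu hgen] at h
  exact corner_unique hS (Finset.mem_filter.mp hb).1 (Finset.mem_filter.mp hc).1
    (dpos_injective hq hd hu hgen h)

/-- On diagonals of color `i` the bound is `diagOrd_spec`. On other diagonals only boxes of distant
color contribute, and their zeros and poles cancel one by one. -/
theorem count_polesOf_le (hn : 3 ≤ n) (hq : q ≠ 0) (hd : d ≠ 0) (hu : u ≠ 0)
    (hgen : GenericParameters q d) (i : ZMod n) {S : Finset Box} (hS : Low S) {x : ℂ}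
    (hx : x ∈ polesOf q d u k i S) : (polesOf q d u k i S).count x ≤
      (zerosOf q d u k i S).count x + if x ∈ (corners k i S).image (bx q d u) then 1 else 0 := by
  obtain ⟨D, rfl⟩ : ∃ D, x = dpos q d u D := by
    rw [polesOf, Multiset.mem_add] at hx
    rcases hx with hx | hx
    · obtain ⟨b, -, rfl⟩ := Multiset.mem_map.mp hx
      rcases zeroPos_polePos (k := k) hn hq hd hu hgen i b with h | h | h | h <;>
      exact ⟨_, h.2.2⟩
    · split_ifs at hx
      · exact ⟨(0, 0), (Multiset.mem_singleton.mp hx).trans u_eq_dpos⟩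
      · simp at hx
  by_cases hD : dcol k D = i
  · obtain ⟨a, b⟩ := D
    have h1 := count_sub_count hn hq hd hu hgen hD S
    obtain ⟨h2, h3⟩ := diagOrd_spec hS a b
    split_ifs with h4
    · omega
    · have : ¬ diagOrd S a b < 0 := by
        intro h5
        have h6 : ∃ c ∈ addable S ∪ removable S, diag c = (a, b) := by
          rcases h3 h5 with ⟨c, hc, h⟩ | ⟨c, hc, h⟩
          exacts [⟨c, Finset.mem_union_left _ hc, h⟩, ⟨c, Finset.mem_union_right _ hc, h⟩]
        obtain ⟨c, hc, h⟩ := h6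
        refine h4 (Finset.mem_image.mpr ⟨c, Finset.mem_filter.mpr ⟨hc, ?_⟩, ?_⟩)
        · rw [bcol_eq_dcol, h, hD]
        · rw [bx_eq_dpos hq hd hu hgen, h]
      omega
  · refine le_add_right (le_of_eq ?_)
    obtain ⟨s1, s2, -⟩ := dcol_shift (k := k) D
    have inj : ∀ D', dpos q d u D' = dpos q d u D ↔ D' = D := fun D' =>
      (dpos_injective hq hd hu hgen).eq_iff
    have hu' : (if i = k then {u} else (0 : Multiset ℂ)).count (dpos q d u D) = 0 := by
      split_ifs with hi
      · refine Multiset.count_eq_zero_of_notMem fun h' => hD ?_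
        rw [Multiset.mem_singleton] at h'
        rw [dpos_injective hq hd hu hgen (h'.trans u_eq_dpos), hi]
        simp [dcol]
      · simp
    rw [polesOf, zerosOf, Multiset.count_add, hu', add_zero, Multiset.count_map,
      Multiset.count_map]
    refine congrArg Multiset.card (Multiset.filter_congr fun b _ => ?_)
    rw [eq_comm, eq_comm (a := dpos q d u D)]
    have sh := dcol_shift (k := k) (diag b)
    rcases zeroPos_polePos (k := k) hn hq hd hu hgen i b with h | h | h | h <;>
      simp only [h.2.1, h.2.2, inj] <;> have h0 := h.1 <;> rw [bcol_eq_dcol] at h0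
    · exact ⟨fun e => absurd (by rw [← e, sh.1, h0]) hD,
        fun e => absurd (by rw [← e, sh.2.1, h0]) hD⟩
    · refine ⟨fun e => absurd ?_ hD, fun e => absurd ?_ hD⟩
      · have := sh.2.2.2.2.1
        rw [e, h0] at this; exact (add_right_cancel this).symm
      · have := sh.2.2.2.1
        rw [e, h0] at this; exact (add_right_cancel this).symm
    · exact ⟨fun e => absurd (by rw [← e, sh.2.2.1, h0]) hD,
        fun e => absurd (by rw [← e, sh.2.2.2.2.2, h0]) hD⟩

theorem levelFactor_eq_invPoly (K : ℂ) (i : ZMod n) :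
    ∃ P : Polynomial ℂ, P.natDegree ≤ (if i = k then 1 else 0) ∧ levelFactor u k K i = invPoly P := by
  rw [levelFactor]
  split_ifs
  · refine ⟨Polynomial.C K⁻¹ - Polynomial.C (K * u) * Polynomial.X, by compute_degree, ?_⟩
    simp [invPoly, div_eq_mul_inv]
  · exact ⟨1, by simp, by simp⟩

/-- Each box brings as many zeros as poles, and the level factor compensates the vacuum pole in
degree. So the numerator satisfies the degree bound for partial fractions with a constant term. -/
theorem levelFactor_mul_Rhat_eq (hn : 3 ≤ n) (hq : q ≠ 0) (hd : d ≠ 0) (hu : u ≠ 0)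
    (hgen : GenericParameters q d) (K : ℂ) (i : ZMod n) {S : Finset Box} (hS : Low S) :
    ∃ P : Polynomial ℂ, P.natDegree ≤ ((corners k i S).image (bx q d u)).card ∧
      levelFactor u k K i * Rhat q d u k i S * ∏ x ∈ (corners k i S).image (bx q d u), lin x =
        invPoly P := by
  obtain ⟨P, hP, hP'⟩ := exists_invPoly_of_count
    (fun x hx => count_polesOf_le hn hq hd hu hgen i hS (k := k) hx)
  obtain ⟨c, -, hc⟩ := Rhat_eq_zeros_div_poles (d := d) (u := u) (k := k) hq i S
  obtain ⟨Q, hQ, hQ'⟩ := levelFactor_eq_invPoly (u := u) (k := k) K i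
  refine ⟨Q * (Polynomial.C c * P), ?_, ?_⟩
  · have h1 : Multiset.card (polesOf q d u k i S) = S.card + if i = k then 1 else 0 := by
      rw [polesOf, Multiset.card_add, Multiset.card_map]
      split_ifs <;> simp
    have h2 : Multiset.card (zerosOf q d u k i S) = S.card := by
      rw [zerosOf, Multiset.card_map]; rfl
    have h3 := Polynomial.natDegree_mul_le (p := Q) (q := Polynomial.C c * P)
    have h4 := Polynomial.natDegree_C_mul_le c P
    omega
  · rw [hc, hQ', map_mul, map_mul, invPoly_C, ← hP']
    ring

theorem RE_insert_self (i : ZMod n) {S : Finset Box} {b : Box} :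
    RE q d u k i (insert b S) b = RE q d u k i S b := by
  classical
  rw [RE, RE, Finset.filter_insert, if_neg (by simp [RowLt])]

theorem RF_insert_self (i : ZMod n) {S : Finset Box} {b : Box} :
    RF q d u k i (insert b S) b = RF q d u k i S b := by
  classical
  rw [RF, RF, Finset.filter_insert, if_neg (by simp [RowLt])]

theorem RE_ne_zero (hq : q ≠ 0) (i : ZMod n) (S : Finset Box) (b : Box) :
    RE q d u k i S b ≠ 0 :=
  mul_ne_zero (vacE_ne_zero hq _ _) (Finset.prod_ne_zero_iff.mpr fun _ _ => Gz_ne_zero hq _ _)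

theorem RF_ne_zero (hq : q ≠ 0) (i : ZMod n) (S : Finset Box) (b : Box) :
    RF q d u k i S b ≠ 0 :=
  mul_ne_zero (vacF_ne_zero hq _ _) (Finset.prod_ne_zero_iff.mpr fun _ _ => Gz_ne_zero hq _ _)

/-- The level factor is its value at `a` plus a multiple of `1 - a / z`, and the latter removes the
simple pole. Hence the formula also holds when that value is zero. -/
theorem resAt_levelFactor_mul (hq : q ≠ 0) (hd : d ≠ 0) (hu : u ≠ 0) (K : ℂ) (b : Box)
    {R : RatFunc ℂ} (hR : R ≠ 0) (h : ordAt (bx q d u b) R = -1) :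
    resAt (bx q d u b) (levelFactor u k K (bcol k b) * R) =
      levelAt q d u k K b * leadAt (bx q d u b) R := by
  have hb := bx_ne_zero hq hd hu b
  set a := bx q d u b with ha
  rw [levelFactor, levelAt]
  split_ifs with hk
  · have : RatFunc.C K⁻¹ - RatFunc.C (K * u) / RatFunc.X =
        RatFunc.C (K⁻¹ - K * u / a) + RatFunc.C (K * u / a) * lin a := by
      rw [lin, mul_sub, mul_div_assoc', ← map_mul, div_mul_cancel₀ _ hb, map_sub]
      ring
    rw [this, add_mul, resAt_add, resAt_C_mul, mul_assoc, resAt_C_mul, resAt_of_ord_eq h,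
      resAt_of_ord_nonneg (R := lin a * R), mul_zero, add_zero]
    rw [ordAt_mul a (lin_ne_zero a) hR, h, ordAt_lin hb, if_pos rfl]
    norm_num
  · rw [one_mul, one_mul, resAt_of_ord_eq h]

theorem ordAt_lin_div {x c : ℂ} (hx : x ≠ 0) (hc : c ≠ x) : ordAt x (lin c / lin x) = -1 := by
  rw [div_eq_mul_inv, ordAt_mul _ (lin_ne_zero _) (inv_ne_zero (lin_ne_zero _)), ordAt_inv,
    ordAt_lin hx, ordAt_lin hx, if_neg hc, if_pos rfl, zero_add]

theorem exists_addBox_of_mem_addable {S : Finset Box} (hS : Low S) {b : Box}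
    (hb : b ∈ addable S) :
    ∃ L M : PlanePartition, S = L.boxes ∧ insert b S = M.boxes ∧ L.AddBox M b.1 b.2.1 ∧
      L.row b.1 b.2.1 = b.2.2 := by
  obtain ⟨h1, h2⟩ := mem_addable.mp hb
  have e1 := PlanePartition.boxes_ofLow hS
  have e2 := PlanePartition.boxes_ofLow h2
  have := PlanePartition.addBox_of_boxes_eq (L := PlanePartition.ofLow S hS)
    (M := PlanePartition.ofLow _ h2) (b := b) (by rwa [e1]) (by rw [e1, e2])
  exact ⟨_, _, e1.symm, e2.symm, this.1, this.2⟩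

theorem exists_hasLayers (M : PlanePartition) : ∃ r, M.HasLayers r := by
  refine ⟨M.boxes.sup (fun c => c.1) + 1, fun p hp j => ?_⟩
  by_contra h
  have : ((p, j, 0) : Box) ∈ M.boxes := PlanePartition.mem_boxes.mpr (Nat.pos_of_ne_zero h)
  have := Finset.le_sup (f := fun c : Box => c.1) this
  simp only at this
  omega

/-- At the position of `b` only the row of `b` is singular. Before `b` is added its factor is `1 /
ψ(q² x / z)`, afterwards `ψ(x / z)`; both have a simple pole at `x`, with opposite leading
coefficients `∓(q - q⁻¹) x`. -/
theorem residues (hn : 3 ≤ n) (hq : q ≠ 0) (hd : d ≠ 0) (hu : u ≠ 0)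
    (hgen : GenericParameters q d) (K : ℂ) {S : Finset Box} (hS : Low S) {b : Box}
    (hb : b ∈ addable S) :
    resAt (bx q d u b) (levelFactor u k K (bcol k b) * Rhat q d u k (bcol k b) S) =
        -(q - q⁻¹) * bx q d u b * (wE q d u k S b * wF q d u k K S b) ∧
    resAt (bx q d u b) (levelFactor u k K (bcol k b) * Rhat q d u k (bcol k b) (insert b S)) =
        (q - q⁻¹) * bx q d u b * (wE q d u k S b * wF q d u k K S b) := by
  obtain ⟨L, M, hL, hM, hLM, hrow⟩ := exists_addBox_of_mem_addable hS hb
  obtain ⟨r, hr⟩ := exists_hasLayers M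
  obtain ⟨p, j, y⟩ := b
  simp only at hLM hrow
  have hbe : ((p, j, y) : Box) = (p, j, L.row p j) := by rw [hrow]
  have hE := (macE_eq (k := k) hn hq hd hu hgen hLM hbe).2
  have hF := (macF_eq (k := k) hn hq hd hu hgen K hLM hr hbe).2
  have hML := Rhat_eq (u := u) (k := k) hn hq hd (bcol k (p, j, y)) M p j y
  have hLL := Rhat_eq (u := u) (k := k) hn hq hd (bcol k (p, j, y)) L p j y
  have hMrow : M.row p j = y + 1 := by have := hLM p j; simpa [hrow] using this
  rw [← hL] at hLL hE hF
  rw [← hM, RE_insert_self, RF_insert_self] at hML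
  rw [hrow, rowF, half_succ_eq, half_eq_eq, if_pos rfl, if_neg (zmod_ne_add_one hn _),
    xpos_pred hq hd] at hLL
  rw [hMrow, rowF, half_succ_succ, half_eq_succ, if_pos rfl, if_neg (zmod_ne_add_one hn _),
    div_one] at hML
  set x := bx q d u (p, j, y) with hx
  have hx' : xpos q d u p j y = x := rfl
  rw [hx'] at hLL hML
  have hx0 : x ≠ 0 := bx_ne_zero hq hd hu _
  have hq2 := q_sq_ne_one hgen
  rw [psiZ_eq hq] at hLL hML
  have hq2x : q ^ 2 * x ≠ x := fun h => hq2 (mul_right_cancel₀ hx0 (by rw [h, one_mul]))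
  have hqx : q⁻¹ * q⁻¹ * x ≠ x := fun h => hq2 (by
    have := mul_right_cancel₀ hx0 (h.trans (one_mul x).symm)
    field_simp at this
    exact this.symm)
  have hcancel : q⁻¹ * q⁻¹ * (q ^ 2 * x) = x := by field_simp
  rw [hcancel] at hLL
  have o1 := ordAt_lin_div hx0 hq2x
  have o2 := ordAt_lin_div hx0 hqx
  have nC := C_ne_zero hq
  have nL := div_ne_zero (lin_ne_zero (q ^ 2 * x)) (lin_ne_zero x)
  have nM := div_ne_zero (lin_ne_zero (q⁻¹ * q⁻¹ * x)) (lin_ne_zero x)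
  have nE := RE_ne_zero (d := d) (u := u) (k := k) hq (bcol k (p, j, y)) S (p, j, y)
  have nF := RF_ne_zero (d := d) (u := u) (k := k) hq (bcol k (p, j, y)) S (p, j, y)
  have hLL' : Rhat q d u k (bcol k (p, j, y)) S = RE q d u k (bcol k (p, j, y)) S (p, j, y) *
      (RatFunc.C q⁻¹ * (lin (q ^ 2 * x) / lin x)) * RF q d u k (bcol k (p, j, y)) S (p, j, y) := by
    rw [hLL, map_inv₀]
    field_simp
  have nC' := C_ne_zero (inv_ne_zero hq)
  rw [wE_eq, wF_eq, ← hx]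
  constructor
  · have hne : Rhat q d u k (bcol k (p, j, y)) S ≠ 0 := by
      rw [hLL']; exact mul_ne_zero (mul_ne_zero nE (mul_ne_zero nC' nL)) nF
    rw [resAt_levelFactor_mul hq hd hu K _ hne, ← hx, hLL', leadAt_mul, leadAt_mul, leadAt_mul,
      leadAt_div, leadAt_lin_self hx0, leadAt_lin hx0 hq2x, leadAt_C]
    · field_simp
      ring
    · rw [← hx, hLL', ordAt_mul _ (mul_ne_zero nE (mul_ne_zero nC' nL)) nF,
        ordAt_mul _ nE (mul_ne_zero nC' nL), ordAt_mul _ nC' nL, hE, hF, o1, ordAt_C]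
      rfl
  · have hne : Rhat q d u k (bcol k (p, j, y)) (insert (p, j, y) S) ≠ 0 := by
      rw [hML]; exact mul_ne_zero (mul_ne_zero nE (mul_ne_zero nC nM)) nF
    rw [resAt_levelFactor_mul hq hd hu K _ hne, ← hx, hML, leadAt_mul, leadAt_mul, leadAt_mul,
      leadAt_div, leadAt_lin_self hx0, leadAt_lin hx0 hqx, leadAt_C]
    · field_simp
    · rw [← hx, hML, ordAt_mul _ (mul_ne_zero nE (mul_ne_zero nC nM)) nF,
        ordAt_mul _ nE (mul_ne_zero nC nM), ordAt_mul _ nC nM, hE, hF, o2, ordAt_C]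
      rfl

/-- The difference of the expansions of an eigenvalue at `∞` and at `0` is a sum over corners. -/
theorem expand_sub_expand (hn : 3 ≤ n) (hq : q ≠ 0) (hd : d ≠ 0) (hu : u ≠ 0)
    (hgen : GenericParameters q d) (K : ℂ) (i : ZMod n) {S : Finset Box} (hS : Low S) (m : ℤ) :
    expandInf (levelFactor u k K i * Rhat q d u k i S) m -
      expandZero (levelFactor u k K i * Rhat q d u k i S) m = (q - q⁻¹) *
      ((∑ b ∈ removable S, if bcol k b = i then
          bx q d u b ^ m * (wE q d u k (S.erase b) b * wF q d u k K (S.erase b) b) else 0) -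
        ∑ b ∈ addable S, if bcol k b = i then
          bx q d u b ^ m * (wE q d u k S b * wF q d u k K S b) else 0) := by
  obtain ⟨P, hP, hP'⟩ := levelFactor_mul_Rhat_eq hn hq hd hu hgen K (k := k) i hS
  have h0 : (0 : ℂ) ∉ (corners k i S).image (bx q d u) := by
    intro h
    obtain ⟨b, -, hb⟩ := Finset.mem_image.mp h
    exact bx_ne_zero hq hd hu b hb
  have hdisj : Disjoint (addable S) (removable S) := by
    rw [Finset.disjoint_left]
    exact fun b h1 h2 => (mem_addable.mp h1).1 (mem_removable.mp h2).1
  rw [expandInf_sub_expandZero h0 hP hP', Finset.sum_image (bx_injOn_corners hq hd hu hgen i hS),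
    corners, Finset.sum_filter, Finset.sum_union hdisj, mul_sub, Finset.mul_sum, Finset.mul_sum,
    sub_eq_add_neg, ← Finset.sum_neg_distrib, add_comm]
  congr 1
  · refine Finset.sum_congr rfl fun b hb => ?_
    split_ifs with hi
    · subst hi
      obtain ⟨h1, h2⟩ := mem_removable.mp hb
      have hadd : b ∈ addable (S.erase b) :=
        mem_addable.mpr ⟨Finset.notMem_erase _ _, by rwa [Finset.insert_erase h1]⟩
      have := (residues (k := k) hn hq hd hu hgen K h2 hadd).2
      rw [Finset.insert_erase h1] at this
      rw [this]
      have := bx_ne_zero hq hd hu b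
      field_simp
    · rw [mul_zero]
  · refine Finset.sum_congr rfl fun b hb => ?_
    split_ifs with hi
    · subst hi
      rw [(residues (k := k) hn hq hd hu hgen K hS hb).1]
      have := bx_ne_zero hq hd hu b
      field_simp
    · rw [mul_zero, neg_zero]

end Poles

/-! ## The commutator of raising and lowering operators -/

section Commutator

variable {n : ℕ} {q d u : ℂ} {k : ZMod n}

/-- Both factors are nontrivial under the same condition `RowLt b a`, and then they are `num / den`
for the two orders of the pair, which are inverse by `num_swap` and `den_swap`. -/
theorem gE_mul_gF (hn : 3 ≤ n) (hq : q ≠ 0) (hd : d ≠ 0) (hu : u ≠ 0)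
    {a b : Box} (h1 : den q d u k a b ≠ 0) (h2 : den q d u k b a ≠ 0) :
    gE q d u k b a * gF q d u k a b = 1 := by
  rw [gE, gF]
  split_ifs
  · have h3 := (num_eq_zero_iff hn hd (q := q) (u := u) (k := k) a b).not.mpr h1
    have h4 := (num_eq_zero_iff hn hd (q := q) (u := u) (k := k) b a).not.mpr h2
    rw [leadAt_Gz hq hd hu h1 h4, leadAt_Gz hq hd hu h2 h3, num_swap hn hd a b,
      den_swap hn hd a b]
    have := zpow_ne_zero (mMat (bcol k a) (bcol k b)) hd
    field_simp
  · exact one_mul 1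

/-- Both boxes can be added to `T` separately, so neither covers the other; by `good_two` the
factors `den` are nonzero and the mutual contributions cancel. -/
theorem wE_mul_wF_swap (hn : 3 ≤ n) (hq : q ≠ 0) (hd : d ≠ 0) (hu : u ≠ 0)
    (hgen : GenericParameters q d) (K : ℂ) {T : Finset Box} {a b : Box} (hT : Low T)
    (ha : a ∉ T) (hb : b ∉ T) (hab : a ≠ b) (hTa : Low (insert a T)) (hTb : Low (insert b T)) :
    wF q d u k K T b * wE q d u k T a =
      wE q d u k (insert b T) a * wF q d u k K (insert a T) b := by
  have hS : Low (insert a (insert b T)) := by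
    have := hTa.union hTb
    rwa [show insert a T ∪ insert b T = insert a (insert b T) by ext c; simp; tauto] at this
  have hgood := good_two (k := k) hn hq hd hu hgen hT hS ha hb hab
  have c1 : ¬ Covers a b := fun h => by
    have := hTa a (Finset.mem_insert_self _ _) b h.le
    rcases Finset.mem_insert.mp this with h | h
    exacts [hab h.symm, hb h]
  have c2 : ¬ Covers b a := fun h => by
    have := hTb b (Finset.mem_insert_self _ _) a h.le
    rcases Finset.mem_insert.mp this with h | h
    exacts [hab h, ha h]
  rw [wE, wF, wt_insert _ _ hb, wt_insert _ _ ha]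
  linear_combination -(wt _ (gE q d u k) T a * wt _ (gF q d u k) T b) *
    (gE_mul_gF hn hq hd hu (fun h => c1 (hgood.1 h)) (fun h => c2 (hgood.2 h)))

variable (x : Box → ℂ) (col : Box → ZMod n) (w v : Finset Box → Box → ℂ)

/-- Putting `b` back gives the diagonal term. Every other box that can be added without `b` can be
added to `S`; for the boxes included in excess `kv` is zero. -/
theorem Up_kv_erase {S : Finset Box} (hS : Low S) {b : Box} (hb : b ∈ S) (i : ZMod n) (r : ℤ) :
    Up x col w i r (kv (S.erase b)) =
      (if b ∈ removable S ∧ col b = i then (x b ^ r * w (S.erase b) b) • kv S else 0) +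
      ∑ a ∈ addable S, if col a = i then
        (x a ^ r * w (S.erase b) a) • kv (insert a (S.erase b)) else 0 := by
  classical
  by_cases hl : Low (S.erase b)
  · have hbr : b ∈ removable S := mem_removable.mpr ⟨hb, hl⟩
    have hba : b ∈ addable (S.erase b) :=
      mem_addable.mpr ⟨Finset.notMem_erase _ _, by rwa [Finset.insert_erase hb]⟩
    rw [Up_kv x col w hl, ← Finset.add_sum_erase _ _ hba, Finset.insert_erase hb]
    congr 1
    · simp [hbr]
    · refine Finset.sum_subset ?_ ?_
      · intro a ha
        obtain ⟨hab, ha⟩ := Finset.mem_erase.mp ha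
        obtain ⟨h1, h2⟩ := mem_addable.mp ha
        have h3 : a ∉ S := fun h => h1 (Finset.mem_erase.mpr ⟨hab, h⟩)
        refine mem_addable.mpr ⟨h3, ?_⟩
        have := h2.union hS
        rwa [Finset.insert_union, Finset.union_eq_right.mpr (Finset.erase_subset _ _)] at this
      · intro a ha ha'
        have hnl : ¬ Low (insert a (S.erase b)) := by
          intro h
          have h1 := (mem_addable.mp ha).1
          exact ha' (Finset.mem_erase.mpr ⟨fun e => h1 (e ▸ hb),
            mem_addable.mpr ⟨fun h2 => h1 (Finset.mem_of_mem_erase h2), h⟩⟩)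
        rw [kv_of_not_low hnl, smul_zero, ite_self]
  · have hbr : b ∉ removable S := fun h => hl (mem_removable.mp h).2
    rw [kv_of_not_low hl, map_zero, if_neg (fun h => hbr h.1), zero_add]
    symm
    refine Finset.sum_eq_zero fun a ha => ?_
    have hnl : ¬ Low (insert a (S.erase b)) := by
      intro h
      refine hl ?_
      have := h.inter hS
      rwa [Finset.insert_inter_of_notMem (mem_addable.mp ha).1,
        Finset.inter_eq_left.mpr (Finset.erase_subset _ _)] at this
    rw [kv_of_not_low hnl, smul_zero, ite_self]

/-- If the weights are compatible, then the commutator of `Up` and `Dn` is diagonal. -/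
theorem Up_Dn_commutator (hx : ∀ b, x b ≠ 0)
    (h : ∀ T a b, Low T → a ∉ T → b ∉ T → a ≠ b → Low (insert a T) → Low (insert b T) →
      v T b * w T a = w (insert b T) a * v (insert a T) b)
    {S : Finset Box} (hS : Low S) (i j : ZMod n) (r s : ℤ) :
    (Up x col w i r * Dn x col v j s - Dn x col v j s * Up x col w i r) (kv S) =
      if i = j then ((∑ b ∈ removable S, if col b = i then
          x b ^ (r + s) * (w (S.erase b) b * v (S.erase b) b) else 0) -
        ∑ b ∈ addable S, if col b = i then x b ^ (r + s) * (w S b * v S b) else 0) • kv S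
      else 0 := by
  classical
  have hUD : (Up x col w i r * Dn x col v j s) (kv S) =
      (∑ b ∈ removable S, if col b = j ∧ col b = i then
        (x b ^ (r + s) * (w (S.erase b) b * v (S.erase b) b)) • kv S else 0) +
      ∑ b ∈ S, ∑ a ∈ addable S, if col b = j ∧ col a = i then
        (x b ^ s * x a ^ r * (v (S.erase b) b * w (S.erase b) a)) • kv (insert a (S.erase b))
        else 0 := by
    have hrem' : (∑ b ∈ removable S, if col b = j ∧ col b = i then
        (x b ^ (r + s) * (w (S.erase b) b * v (S.erase b) b)) • kv S else 0) =
        ∑ b ∈ S, if b ∈ removable S ∧ col b = j ∧ col b = i then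
          (x b ^ (r + s) * (w (S.erase b) b * v (S.erase b) b)) • kv S else 0 := by
      refine Eq.trans (Finset.sum_congr rfl fun b hb => ?_) (Finset.sum_subset
        (fun b hb => (mem_removable.mp hb).1) (fun b _ hb => if_neg fun h => hb h.1))
      simp only [hb, true_and]
    rw [Module.End.mul_apply, Dn_kv x col v hS, map_sum,
      hrem', ← Finset.sum_add_distrib]
    refine Finset.sum_congr rfl fun b hb => ?_
    by_cases hj : col b = j
    · rw [if_pos hj, map_smul, Up_kv_erase x col w hS hb, smul_add, Finset.smul_sum]
      congr 1
      · simp only [hj, true_and]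
        split_ifs
        · rw [smul_smul, zpow_add₀ (hx b)]; congr 1; ring
        · rw [smul_zero]
      · refine Finset.sum_congr rfl fun a _ => ?_
        simp only [hj, true_and]
        split_ifs
        · rw [smul_smul]; congr 1; ring
        · rw [smul_zero]
    · simp [hj]
  have hDU : (Dn x col v j s * Up x col w i r) (kv S) =
      (∑ a ∈ addable S, if col a = j ∧ col a = i then
        (x a ^ (r + s) * (w S a * v S a)) • kv S else 0) +
      ∑ b ∈ S, ∑ a ∈ addable S, if col b = j ∧ col a = i then
        (x b ^ s * x a ^ r * (w S a * v (insert a (S.erase b)) b)) • kv (insert a (S.erase b))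
        else 0 := by
    rw [Module.End.mul_apply, Up_kv x col w hS, map_sum, Finset.sum_comm,
      ← Finset.sum_add_distrib]
    refine Finset.sum_congr rfl fun a ha => ?_
    obtain ⟨ha1, ha2⟩ := mem_addable.mp ha
    by_cases hi : col a = i
    · rw [if_pos hi, map_smul, Dn_kv x col v ha2, Finset.sum_insert ha1, smul_add,
        Finset.smul_sum, Finset.erase_insert ha1]
      congr 1
      · simp only [hi, and_true]
        split_ifs
        · rw [smul_smul, zpow_add₀ (hx a)]; congr 1; ring
        · rw [smul_zero]
      · refine Finset.sum_congr rfl fun b hb => ?_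
        have hab : a ≠ b := fun e => ha1 (e ▸ hb)
        simp only [hi, and_true]
        rw [Finset.erase_insert_of_ne hab]
        split_ifs
        · rw [smul_smul]; congr 1; ring
        · rw [smul_zero]
    · simp [hi]
  -- Moving a box from `b` to `a` has the same weight in both orders; if the resulting set is not
  -- lower, `kv` kills both sides.
  have hoff : ∀ b ∈ S, ∀ a ∈ addable S,
      (v (S.erase b) b * w (S.erase b) a) • kv (insert a (S.erase b)) =
      (w S a * v (insert a (S.erase b)) b) • kv (insert a (S.erase b)) := by
    intro b hb a ha
    by_cases hl : Low (insert a (S.erase b))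
    · obtain ⟨ha1, ha2⟩ := mem_addable.mp ha
      have hT : Low (S.erase b) := by
        have := hl.inter hS
        rwa [Finset.insert_inter_of_notMem ha1,
          Finset.inter_eq_left.mpr (Finset.erase_subset _ _)] at this
      rw [h (S.erase b) a b hT (fun e => ha1 (Finset.mem_of_mem_erase e))
        (Finset.notMem_erase _ _) (fun e => ha1 (e ▸ hb)) hl (by rwa [Finset.insert_erase hb]),
        Finset.insert_erase hb]
    · rw [kv_of_not_low hl, smul_zero, smul_zero]
  have hoff' : (∑ b ∈ S, ∑ a ∈ addable S, if col b = j ∧ col a = i then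
        (x b ^ s * x a ^ r * (v (S.erase b) b * w (S.erase b) a)) • kv (insert a (S.erase b))
        else 0) = ∑ b ∈ S, ∑ a ∈ addable S, if col b = j ∧ col a = i then
        (x b ^ s * x a ^ r * (w S a * v (insert a (S.erase b)) b)) • kv (insert a (S.erase b))
        else 0 := by
    refine Finset.sum_congr rfl fun b hb => Finset.sum_congr rfl fun a ha => ?_
    rw [mul_smul, mul_smul (x b ^ s * x a ^ r), hoff b hb a ha]
  rw [LinearMap.sub_apply, hUD, hDU, hoff', add_sub_add_right_eq_sub]
  split_ifs with hij
  · subst hij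
    simp only [and_self]
    rw [sub_smul, Finset.sum_smul, Finset.sum_smul]
    simp only [ite_smul, zero_smul]
  · rw [Finset.sum_eq_zero, Finset.sum_eq_zero, sub_zero]
    · exact fun b _ => if_neg fun h' => hij (h'.2.symm.trans h'.1)
    · exact fun b _ => if_neg fun h' => hij (h'.2.symm.trans h'.1)

end Commutator

/-! ## Exponentials of power series -/

section Exponential

theorem map_expCoeff {A B : Type*} [Ring A] [Algebra ℂ A] [Ring B] [Algebra ℂ B] (f : A →ₐ[ℂ] B)
    (X : PowerSeries A) (m : ℕ) :
    f (expCoeff X m) = expCoeff (PowerSeries.map (f : A →+* B) X) m := by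
  rw [expCoeff, expCoeff, map_sum, map_sum, map_sum]
  refine Finset.sum_congr rfl fun j _ => ?_
  rw [PowerSeries.coeff_smul, PowerSeries.coeff_smul, map_smul, ← map_pow, PowerSeries.coeff_map]
  rfl

variable {A : Type*} [Ring A]

theorem coeff_pow_congr {X Y : PowerSeries A} {m : ℕ}
    (h : ∀ l < m, PowerSeries.coeff l X = PowerSeries.coeff l Y) (j : ℕ) :
    ∀ a < m, PowerSeries.coeff a (X ^ j) = PowerSeries.coeff a (Y ^ j) := by
  induction j with
  | zero => simp
  | succ j ih =>
    intro a ha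
    rw [pow_succ, pow_succ, PowerSeries.coeff_mul, PowerSeries.coeff_mul]
    refine Finset.sum_congr rfl fun p hp => ?_
    have := Finset.HasAntidiagonal.mem_antidiagonal.mp hp
    rw [ih _ (by omega), h _ (by omega)]

/-- Without constant terms, the coefficient of `T ^ m` in a power of exponent at least two involves
only coefficients of smaller degree. -/
theorem coeff_pow_add_two_congr {X Y : PowerSeries A} {m : ℕ}
    (hX : PowerSeries.coeff 0 X = 0) (hY : PowerSeries.coeff 0 Y = 0)
    (h : ∀ l < m, PowerSeries.coeff l X = PowerSeries.coeff l Y) (j : ℕ) :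
    PowerSeries.coeff m (X ^ (j + 2)) = PowerSeries.coeff m (Y ^ (j + 2)) := by
  rw [pow_succ _ (j + 1), pow_succ _ (j + 1), PowerSeries.coeff_mul, PowerSeries.coeff_mul]
  refine Finset.sum_congr rfl fun p hp => ?_
  have := Finset.HasAntidiagonal.mem_antidiagonal.mp hp
  by_cases h0 : p.1 = 0
  · rw [PowerSeries.coeff_zero_eq_constantCoeff_apply] at hX hY
    rw [h0, PowerSeries.coeff_zero_eq_constantCoeff_apply,
      PowerSeries.coeff_zero_eq_constantCoeff_apply, map_pow, map_pow, hX, hY,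
      zero_pow (Nat.succ_ne_zero j), zero_mul, zero_mul]
  by_cases h1 : p.2 = 0
  · rw [h1, hX, hY, mul_zero, mul_zero]
  rw [coeff_pow_congr h _ _ (by omega), h _ (by omega)]

theorem expCoeff_zero [Algebra ℂ A] (X : PowerSeries A) : expCoeff X 0 = 1 := by
  simp [expCoeff]

/-- The leading part of the coefficients of an exponential. -/
theorem expCoeff_sub_expCoeff [Algebra ℂ A] {X Y : PowerSeries A} {m : ℕ} (hm : m ≠ 0)
    (hX : PowerSeries.coeff 0 X = 0) (hY : PowerSeries.coeff 0 Y = 0)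
    (h : ∀ l < m, PowerSeries.coeff l X = PowerSeries.coeff l Y) :
    expCoeff X m - expCoeff Y m = PowerSeries.coeff m X - PowerSeries.coeff m Y := by
  obtain ⟨m, rfl⟩ := Nat.exists_eq_succ_of_ne_zero hm
  rw [expCoeff, expCoeff, map_sum, map_sum, Finset.sum_range_succ', Finset.sum_range_succ',
    Finset.sum_range_succ', Finset.sum_range_succ']
  have : ∀ j ∈ Finset.range m, PowerSeries.coeff (m + 1)
      ((((j + 1 + 1).factorial : ℂ)⁻¹) • X ^ (j + 1 + 1)) =
      PowerSeries.coeff (m + 1) ((((j + 1 + 1).factorial : ℂ)⁻¹) • Y ^ (j + 1 + 1)) := by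
    intro j _
    rw [PowerSeries.coeff_smul, PowerSeries.coeff_smul, coeff_pow_add_two_congr hX hY h]
  rw [Finset.sum_congr rfl this]
  simp

/-- The coefficient of degree `m` enters the exponential linearly, plus terms from lower degrees, so
it can be recovered recursively, even in a noncommutative ring. -/
theorem eq_of_expCoeff_eq [Algebra ℂ A] {X Y : PowerSeries A}
    (hX : PowerSeries.coeff 0 X = 0) (hY : PowerSeries.coeff 0 Y = 0)
    (h : ∀ m, expCoeff X m = expCoeff Y m) : X = Y := by
  ext m
  induction m using Nat.strong_induction_on with
  | _ m ih =>
    by_cases hm : m = 0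
    · rw [hm, hX, hY]
    · have := expCoeff_sub_expCoeff hm hX hY ih
      rw [h, sub_self] at this
      exact (sub_eq_zero.mp this.symm)

/-- The coefficients of the logarithm of a power series with constant term `1`. -/
def logCoeff (c : ℕ → ℂ) (m : ℕ) : ℂ :=
  if m = 0 then 0
  else c m - expCoeff (PowerSeries.mk fun l => if _h : l < m then logCoeff c l else 0) m
termination_by m

theorem expCoeff_logCoeff {c : ℕ → ℂ} (hc : c 0 = 1) (m : ℕ) :
    expCoeff (PowerSeries.mk (logCoeff c)) m = c m := by
  have h0 : logCoeff c 0 = 0 := by rw [logCoeff, if_pos rfl]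
  by_cases hm : m = 0
  · rw [hm, expCoeff_zero, hc]
  · have := expCoeff_sub_expCoeff (X := PowerSeries.mk (logCoeff c))
      (Y := PowerSeries.mk fun l => if _h : l < m then logCoeff c l else 0) hm
      (by simp [h0]) (by simp [h0]) (fun l hl => by simp [hl])
    have h1 := logCoeff.eq_1 c m
    rw [if_neg hm] at h1
    simp only [PowerSeries.coeff_mk, lt_irrefl, dite_false, sub_zero] at this
    rw [h1] at this
    exact sub_left_injective this

end Exponential

/-! ## Regular expansions -/

section Regular

/-- The series `φ R` is a power series with constant term `v`. -/
def IsRegular (φ : RatFunc ℂ →+* LaurentSeries ℂ) (R : RatFunc ℂ) (v : ℂ) : Prop :=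
  ∃ P : PowerSeries ℂ, φ R = HahnSeries.ofPowerSeries ℤ ℂ P ∧ PowerSeries.constantCoeff P = v

variable {φ : RatFunc ℂ →+* LaurentSeries ℂ} {R R' : RatFunc ℂ} {v v' : ℂ}

theorem IsRegular.mul (h : IsRegular φ R v) (h' : IsRegular φ R' v') :
    IsRegular φ (R * R') (v * v') := by
  obtain ⟨P, hP, rfl⟩ := h
  obtain ⟨Q, hQ, rfl⟩ := h'
  exact ⟨P * Q, by rw [map_mul, map_mul, hP, hQ], map_mul _ _ _⟩

theorem IsRegular.sub (h : IsRegular φ R v) (h' : IsRegular φ R' v') :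
    IsRegular φ (R - R') (v - v') := by
  obtain ⟨P, hP, rfl⟩ := h
  obtain ⟨Q, hQ, rfl⟩ := h'
  exact ⟨P - Q, by rw [map_sub, map_sub, hP, hQ], map_sub _ _ _⟩

theorem IsRegular.inv (h : IsRegular φ R v) (hv : v ≠ 0) : IsRegular φ R⁻¹ v⁻¹ := by
  obtain ⟨P, hP, rfl⟩ := h
  refine ⟨P⁻¹, ?_, PowerSeries.constantCoeff_inv P⟩
  rw [map_inv₀, hP]
  refine inv_eq_of_mul_eq_one_right ?_
  rw [← map_mul, PowerSeries.mul_inv_cancel P hv, map_one]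

theorem IsRegular.div (h : IsRegular φ R v) (h' : IsRegular φ R' v') (hv : v' ≠ 0) :
    IsRegular φ (R / R') (v / v') := by
  rw [div_eq_mul_inv, div_eq_mul_inv]; exact h.mul (h'.inv hv)

theorem isRegular_one : IsRegular φ 1 1 := ⟨1, by simp, by simp⟩

theorem IsRegular.prod {ι : Type*} {s : Finset ι} {f : ι → RatFunc ℂ} {v : ι → ℂ}
    (h : ∀ x ∈ s, IsRegular φ (f x) (v x)) : IsRegular φ (∏ x ∈ s, f x) (∏ x ∈ s, v x) := by
  classical
  induction s using Finset.induction_on with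
  | empty => simpa using isRegular_one
  | insert a s ha ih =>
    rw [Finset.prod_insert ha, Finset.prod_insert ha]
    exact (h a (Finset.mem_insert_self _ _)).mul
      (ih fun x hx => h x (Finset.mem_insert_of_mem hx))

theorem IsRegular.coeff (h : IsRegular φ R v) :
    (∀ r < 0, (φ R).coeff r = 0) ∧ (φ R).coeff 0 = v := by
  obtain ⟨P, hP, rfl⟩ := h
  rw [hP]
  constructor
  · intro r hr
    rw [HahnSeries.ofPowerSeries_apply]
    refine HahnSeries.embDomain_of_notMem_range ?_
    rintro ⟨a, ha⟩
    change (a : ℤ) = r at ha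
    omega
  · have := HahnSeries.ofPowerSeries_apply_coeff (Γ := ℤ) P 0
    simpa using this

theorem infHom_C (c : ℂ) : infHom (RatFunc.C c) = HahnSeries.C c := evalHom_C _ _ _

theorem zeroHom_C (c : ℂ) : zeroHom (RatFunc.C c) = HahnSeries.C c := evalHom_C _ _ _

theorem isRegular_infHom_C (c : ℂ) : IsRegular infHom (RatFunc.C c) c :=
  ⟨PowerSeries.C c, by rw [infHom_C, HahnSeries.ofPowerSeries_C], by simp⟩

theorem isRegular_zeroHom_C (c : ℂ) : IsRegular zeroHom (RatFunc.C c) c :=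
  ⟨PowerSeries.C c, by rw [zeroHom_C, HahnSeries.ofPowerSeries_C], by simp⟩

theorem isRegular_infHom_inv_X : IsRegular infHom (RatFunc.X)⁻¹ 0 := by
  refine ⟨PowerSeries.X, ?_, by simp⟩
  rw [map_inv₀, infHom, evalHom_X, HahnSeries.ofPowerSeries_X]
  refine inv_eq_of_mul_eq_one_right ?_
  rw [HahnSeries.single_mul_single]
  simp

theorem isRegular_zeroHom_X : IsRegular zeroHom RatFunc.X 0 :=
  ⟨PowerSeries.X, by rw [zeroHom, evalHom_X, HahnSeries.ofPowerSeries_X], by simp⟩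

theorem isRegular_infHom_lin (c : ℂ) : IsRegular infHom (lin c) 1 := by
  have := isRegular_one.sub ((isRegular_infHom_C c).mul isRegular_infHom_inv_X)
  rwa [mul_zero, sub_zero, ← div_eq_mul_inv] at this

theorem isRegular_zeroHom_X_sub (c : ℂ) : IsRegular zeroHom (RatFunc.X - RatFunc.C c) (-c) := by
  have := isRegular_zeroHom_X.sub (isRegular_zeroHom_C c)
  rwa [zero_sub] at this

end Regular

/-! ## The eigenvalues of `K_i(z)` at infinity and at zero -/

section Eigenvalues

variable {n : ℕ} {q d u K : ℂ} {k : ZMod n}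

variable (q d u k K) in
/-- The eigenvalue of `K_i(z)`. -/
def eig (i : ZMod n) (S : Finset Box) : RatFunc ℂ := levelFactor u k K i * Rhat q d u k i S

theorem lin_div_lin (a b : ℂ) :
    lin a / lin b = (RatFunc.X - RatFunc.C a) / (RatFunc.X - RatFunc.C b) := by
  rw [lin_eq, lin_eq, div_div_div_cancel_right₀ RatFunc.X_ne_zero]

theorem isRegular_infHom_Gz (i : ZMod n) (b : Box) :
    IsRegular infHom (Gz q d u k i b) (q ^ cartan i (bcol k b)) := by
  have := (isRegular_infHom_C (q ^ cartan i (bcol k b))).mul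
    ((isRegular_infHom_lin (zeroPos q d u k i b)).div (isRegular_infHom_lin (polePos q d u k i b))
      one_ne_zero)
  rwa [div_one, mul_one] at this

theorem isRegular_zeroHom_Gz (hq : q ≠ 0) (hd : d ≠ 0) (hu : u ≠ 0) (i : ZMod n) (b : Box) :
    IsRegular zeroHom (Gz q d u k i b) (q ^ (-cartan i (bcol k b))) := by
  have h1 := bx_ne_zero hq hd hu b
  have h2 := zpow_ne_zero (cartan i (bcol k b)) hq
  have h3 := zpow_ne_zero (-mMat i (bcol k b)) hd
  have hp : polePos q d u k i b ≠ 0 := mul_ne_zero (mul_ne_zero h2 h3) h1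
  have := (isRegular_zeroHom_C (q ^ cartan i (bcol k b))).mul
    ((isRegular_zeroHom_X_sub (zeroPos q d u k i b)).div
      (isRegular_zeroHom_X_sub (polePos q d u k i b)) (neg_ne_zero.mpr hp))
  rw [← lin_div_lin] at this
  have e : q ^ cartan i (bcol k b) * (-zeroPos q d u k i b / -polePos q d u k i b) =
      q ^ (-cartan i (bcol k b)) := by
    rw [neg_div_neg_eq, zeroPos, polePos, zpow_neg]
    field_simp
  rwa [e] at this

theorem isRegular_infHom_eig (i : ZMod n) (S : Finset Box) :
    IsRegular infHom (eig q d u K k i S)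
      ((if i = k then K⁻¹ else 1) * ∏ b ∈ S, q ^ cartan i (bcol k b)) := by
  rw [eig, Rhat, ← mul_assoc]
  refine IsRegular.mul ?_ (IsRegular.prod fun b _ => isRegular_infHom_Gz i b)
  rw [levelFactor, vac]
  split_ifs
  · have := ((isRegular_infHom_C K⁻¹).sub
      ((isRegular_infHom_C (K * u)).mul isRegular_infHom_inv_X)).div
        (isRegular_infHom_lin u) one_ne_zero
    rwa [mul_zero, sub_zero, div_one, ← div_eq_mul_inv, div_eq_mul_inv _ (lin u)] at this
  · rw [mul_one]; exact isRegular_one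

theorem isRegular_zeroHom_eig (hq : q ≠ 0) (hd : d ≠ 0) (hu : u ≠ 0) (i : ZMod n)
    (S : Finset Box) : IsRegular zeroHom (eig q d u K k i S)
      ((if i = k then K else 1) * ∏ b ∈ S, q ^ (-cartan i (bcol k b))) := by
  rw [eig, Rhat, ← mul_assoc]
  refine IsRegular.mul ?_ (IsRegular.prod fun b _ => isRegular_zeroHom_Gz hq hd hu i b)
  rw [levelFactor, vac]
  split_ifs
  · have := (((isRegular_zeroHom_C K⁻¹).mul isRegular_zeroHom_X).sub
      (isRegular_zeroHom_C (K * u))).div (isRegular_zeroHom_X_sub u) (neg_ne_zero.mpr hu)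
    rw [mul_zero, zero_sub, neg_div_neg_eq, mul_div_cancel_right₀ _ hu] at this
    convert this using 1
    have hX : (RatFunc.X : RatFunc ℂ) ≠ 0 := RatFunc.X_ne_zero
    have := X_sub_C_ne_zero u
    rw [lin_eq]
    field_simp
  · rw [mul_one]; exact isRegular_one

theorem expandInf_eig_of_neg (i : ZMod n) (S : Finset Box) {r : ℤ} (hr : r < 0) :
    expandInf (eig q d u K k i S) r = 0 := (isRegular_infHom_eig i S).coeff.1 r hr

theorem expandZero_eig_of_pos (hq : q ≠ 0) (hd : d ≠ 0) (hu : u ≠ 0) (i : ZMod n)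
    (S : Finset Box) {r : ℤ} (hr : 0 < r) : expandZero (eig q d u K k i S) r = 0 :=
  (isRegular_zeroHom_eig hq hd hu i S).coeff.1 (-r) (by omega)

theorem expandInf_eig_zero (i : ZMod n) (S : Finset Box) :
    expandInf (eig q d u K k i S) 0 =
      (if i = k then K⁻¹ else 1) * ∏ b ∈ S, q ^ cartan i (bcol k b) :=
  (isRegular_infHom_eig i S).coeff.2

theorem expandZero_eig_zero (hq : q ≠ 0) (hd : d ≠ 0) (hu : u ≠ 0) (i : ZMod n)
    (S : Finset Box) : expandZero (eig q d u K k i S) 0 =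
      (if i = k then K else 1) * ∏ b ∈ S, q ^ (-cartan i (bcol k b)) := by
  rw [expandZero_eq, neg_zero]
  exact (isRegular_zeroHom_eig hq hd hu i S).coeff.2

/-- From infinity to zero every box changes `q ^ a` to `q ^ (-a)`, and the vacuum changes `K⁻¹` to
`K`; this is the relation `K_i K_i⁻¹ = 1`. -/
theorem expandInf_mul_expandZero (hq : q ≠ 0) (hd : d ≠ 0) (hu : u ≠ 0) (hK : K ≠ 0) (i : ZMod n)
    (S : Finset Box) :
    expandInf (eig q d u K k i S) 0 * expandZero (eig q d u K k i S) 0 = 1 := by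
  rw [expandInf_eig_zero, expandZero_eig_zero hq hd hu, mul_mul_mul_comm,
    ← Finset.prod_mul_distrib, Finset.prod_eq_one, mul_one]
  · split_ifs
    · exact inv_mul_cancel₀ hK
    · exact one_mul 1
  · intro b _
    rw [← zpow_add₀ hq, add_neg_cancel, zpow_zero]

theorem eig_insert {S : Finset Box} {b : Box} (hb : b ∉ S) (i : ZMod n) :
    eig q d u K k i (insert b S) = Gz q d u k i b * eig q d u K k i S := by
  rw [eig, eig, Rhat, Rhat, Finset.prod_insert hb]; ring

theorem eig_insert_mul (hq : q ≠ 0) (hd : d ≠ 0) {S : Finset Box} {b : Box} (hb : b ∉ S)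
    (i : ZMod n) :
    RatFunc.C (q ^ cartan i (bcol k b) * bx q d u b) * eig q d u K k i (insert b S) -
      RatFunc.C (d ^ mMat i (bcol k b)) * (RatFunc.X * eig q d u K k i (insert b S)) =
    RatFunc.C (bx q d u b) * eig q d u K k i S -
      RatFunc.C (d ^ mMat i (bcol k b) * q ^ cartan i (bcol k b)) *
        (RatFunc.X * eig q d u K k i S) := by
  rw [eig_insert hb]
  linear_combination eig q d u K k i S * Gz_mul hq hd i b

theorem expandInf_eig_insert (hq : q ≠ 0) (hd : d ≠ 0) {S : Finset Box} {b : Box} (hb : b ∉ S)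
    (i : ZMod n) (r : ℤ) :
    q ^ cartan i (bcol k b) * bx q d u b * expandInf (eig q d u K k i (insert b S)) r -
      d ^ mMat i (bcol k b) * expandInf (eig q d u K k i (insert b S)) (r + 1) =
    bx q d u b * expandInf (eig q d u K k i S) r -
      d ^ mMat i (bcol k b) * q ^ cartan i (bcol k b) * expandInf (eig q d u K k i S) (r + 1) := by
  have := congrArg (fun R => expandInf R r) (eig_insert_mul (u := u) (K := K) (k := k) hq hd hb i)
  simpa only [expandInf_sub, expandInf_C_mul, expandInf_X_mul] using this

theorem expandZero_eig_insert (hq : q ≠ 0) (hd : d ≠ 0) {S : Finset Box} {b : Box} (hb : b ∉ S)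
    (i : ZMod n) (r : ℤ) :
    q ^ cartan i (bcol k b) * bx q d u b * expandZero (eig q d u K k i (insert b S)) r -
      d ^ mMat i (bcol k b) * expandZero (eig q d u K k i (insert b S)) (r + 1) =
    bx q d u b * expandZero (eig q d u K k i S) r -
      d ^ mMat i (bcol k b) * q ^ cartan i (bcol k b) * expandZero (eig q d u K k i S) (r + 1) := by
  have := congrArg (fun R => expandZero R r) (eig_insert_mul (u := u) (K := K) (k := k) hq hd hb i)
  simpa only [expandZero_sub, expandZero_C_mul, expandZero_X_mul] using this

end Eigenvalues

/-! ## Diagonal operators -/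

section Diagonal

/-- The operator with given eigenvalues. -/
def diagOp : (Finset Box → ℂ) →ₐ[ℂ] Module.End ℂ Macmahon where
  toFun f := liftKv fun S => f S • kv S
  map_one' := macmahon_hom_ext fun S hS => by simp [liftKv_kv _ hS]
  map_mul' f g := macmahon_hom_ext fun S hS => by
    simp [liftKv_kv _ hS, smul_smul, mul_comm]
  map_zero' := macmahon_hom_ext fun S hS => by simp [liftKv_kv _ hS]
  map_add' f g := macmahon_hom_ext fun S hS => by simp [liftKv_kv _ hS, add_smul]
  commutes' c := macmahon_hom_ext fun S hS => by
    simp [liftKv_kv _ hS, Algebra.algebraMap_eq_smul_one]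

theorem diagOp_kv (f : Finset Box → ℂ) (S : Finset Box) : diagOp f (kv S) = f S • kv S := by
  by_cases hS : Low S
  · exact liftKv_kv (fun S => f S • kv S) hS
  · rw [kv_of_not_low hS, map_zero, smul_zero]

theorem adj_diagOp (f : Finset Box → ℂ) : Adj (diagOp f) (diagOp f) := by
  intro L M
  rw [← kv_boxes, ← kv_boxes, diagOp_kv, diagOp_kv, Finsupp.smul_apply, Finsupp.smul_apply,
    kv_apply, kv_apply, smul_eq_mul, smul_eq_mul]
  by_cases h : L.boxes = M.boxes
  · rw [h]
  · rw [if_neg h, if_neg (Ne.symm h), mul_zero, mul_zero]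

theorem Adj.symm {X Y : Module.End ℂ Macmahon} (h : Adj X Y) : Adj Y X := fun L M => (h M L).symm

variable {n : ℕ} (x : Box → ℂ) (col : Box → ZMod n) (w : Finset Box → Box → ℂ)

theorem diagOp_Up {j : ZMod n} {f g : Finset Box → ℂ} {α β γ δ : ℂ} (hx : ∀ b, x b ≠ 0)
    (h : ∀ S b, b ∉ S → col b = j →
      α * x b * f (insert b S) - β * g (insert b S) = γ * x b * f S - δ * g S) (s : ℤ) :
    α • (diagOp f * Up x col w j (s + 1)) - β • (diagOp g * Up x col w j s) =
      γ • (Up x col w j (s + 1) * diagOp f) - δ • (Up x col w j s * diagOp g) := by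
  refine macmahon_hom_ext fun S hS => ?_
  simp only [LinearMap.sub_apply, LinearMap.smul_apply, Module.End.mul_apply, diagOp_kv, map_smul,
    Up_kv x col w hS, map_sum, Finset.smul_sum, ← Finset.sum_sub_distrib]
  refine Finset.sum_congr rfl fun b hb => ?_
  split_ifs with hc
  · have := h S b (mem_addable.mp hb).1 hc
    simp only [map_smul, diagOp_kv, smul_smul, ← sub_smul, zpow_add_one₀ (hx b)]
    congr 1
    linear_combination (x b ^ s * w S b) * this
  · simp

theorem diagOp_Dn {j : ZMod n} {f g : Finset Box → ℂ} {α β γ δ : ℂ} (hx : ∀ b, x b ≠ 0)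
    (h : ∀ S b, b ∉ S → col b = j →
      α * x b * f (insert b S) - β * g (insert b S) = γ * x b * f S - δ * g S) (s : ℤ) :
    γ • (diagOp f * Dn x col w j (s + 1)) - δ • (diagOp g * Dn x col w j s) =
      α • (Dn x col w j (s + 1) * diagOp f) - β • (Dn x col w j s * diagOp g) := by
  have a := fun m => (adj_Up_Dn x col w j m).symm
  refine Adj.left_unique ((((adj_diagOp f).mul (a (s + 1))).smul γ).sub
    (((adj_diagOp g).mul (a s)).smul δ)) ?_
  rw [← diagOp_Up x col w hx h s]
  exact ((((a (s + 1)).mul (adj_diagOp f)).smul α).sub (((a s).mul (adj_diagOp g)).smul β))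

end Diagonal

/-! ## Construction of the module -/

section Construction

variable {n : ℕ} {q d u K : ℂ} {k : ZMod n}

variable (q d u k K) in
/-- The normalized coefficients of the expansion at infinity. -/
def normInf (i : ZMod n) (S : Finset Box) (m : ℕ) : ℂ :=
  expandInf (eig q d u K k i S) m / expandInf (eig q d u K k i S) 0

variable (q d u k K) in
/-- The normalized coefficients of the expansion at zero. -/
def normZero (i : ZMod n) (S : Finset Box) (m : ℕ) : ℂ :=
  expandZero (eig q d u K k i S) (-m) / expandZero (eig q d u K k i S) 0

variable (q d u k K) in
/-- The action of the generators. -/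
def genOp : Gen n → Module.End ℂ Macmahon
  | Gen.E i m => Up (bx q d u) (bcol k) (wE q d u k) i m
  | Gen.F i m => Dn (bx q d u) (bcol k) (wF q d u k K) i m
  -- These eigenvalues are forced: their exponential has to be the expansion divided by its constant
  -- term.
  | Gen.H i l _ => diagOp fun S =>
      if 0 < l then (q - q⁻¹)⁻¹ * logCoeff (normInf q d u K k i S) l.toNat
      else (-(q - q⁻¹))⁻¹ * logCoeff (normZero q d u K k i S) (-l).toNat
  | Gen.K i => diagOp fun S => expandInf (eig q d u K k i S) 0
  | Gen.Kinv i => diagOp fun S => expandZero (eig q d u K k i S) 0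

variable (q d u k K) in
/-- The action of the free algebra. -/
def freeRep : FreeGen n →ₐ[ℂ] Module.End ℂ Macmahon := FreeAlgebra.lift ℂ (genOp q d u K k)

theorem freeRep_ι (g : Gen n) : freeRep q d u K k (FreeAlgebra.ι ℂ g) = genOp q d u K k g :=
  FreeAlgebra.lift_ι_apply _ _

theorem freeRep_E (i : ZMod n) (m : ℤ) : freeRep q d u K k (fE i m) =
    Up (bx q d u) (bcol k) (wE q d u k) i m := freeRep_ι _

theorem freeRep_F (i : ZMod n) (m : ℤ) : freeRep q d u K k (fF i m) =
    Dn (bx q d u) (bcol k) (wF q d u k K) i m := freeRep_ι _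

theorem freeGen_expCoeff {V : Type*} [AddCommGroup V] [Module ℂ V]
    (f : FreeGen n →ₐ[ℂ] Module.End ℂ V) (X : PowerSeries (FreeGen n)) (m : ℕ) :
    f (expCoeff X m) = expCoeff (PowerSeries.mk fun l => f (PowerSeries.coeff l X)) m :=
  (@map_expCoeff (FreeGen n) (Module.End ℂ V) _ _ _ _ f X m).trans
    (congrArg (fun Y => expCoeff Y m) (PowerSeries.ext fun l => by
      rw [PowerSeries.coeff_map, PowerSeries.coeff_mk]; rfl))

theorem freeRep_expCoeff (X : PowerSeries (FreeGen n)) (m : ℕ) :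
    freeRep q d u K k (expCoeff X m) =
      expCoeff (PowerSeries.mk fun l => freeRep q d u K k (PowerSeries.coeff l X)) m :=
  freeGen_expCoeff _ X m

theorem logCoeff_zero (c : ℕ → ℂ) : logCoeff c 0 = 0 := by rw [logCoeff, if_pos rfl]

/-- `diagOp` is an algebra homomorphism from functions, so the exponential is computed pointwise in
`ℂ`. -/
theorem expCoeff_diagOp {c : Finset Box → ℕ → ℂ} (hc : ∀ S, c S 0 = 1)
    {X : PowerSeries (Module.End ℂ Macmahon)}
    (hX : ∀ l, PowerSeries.coeff l X = diagOp fun S => logCoeff (c S) l) (m : ℕ) :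
    expCoeff X m = diagOp fun S => c S m := by
  have h1 : X = PowerSeries.map (diagOp : (Finset Box → ℂ) →+* Module.End ℂ Macmahon)
      (PowerSeries.mk fun l S => logCoeff (c S) l) := by
    ext1 l
    rw [hX, PowerSeries.coeff_map, PowerSeries.coeff_mk]
    rfl
  rw [h1, ← map_expCoeff]
  congr 1
  funext S
  have h2 := map_expCoeff (Pi.evalAlgHom ℂ (fun _ : Finset Box => ℂ) S)
    (PowerSeries.mk fun l S => logCoeff (c S) l) m
  rw [Pi.evalAlgHom_apply] at h2
  rw [h2, ← expCoeff_logCoeff (hc S) m]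
  congr 1

theorem freeRep_Kplus (hq : q ≠ 0) (hd : d ≠ 0) (hu : u ≠ 0) (hK : K ≠ 0)
    (hgen : GenericParameters q d) (i : ZMod n) (r : ℤ) :
    freeRep q d u K k (fKplus q i r) = diagOp fun S => expandInf (eig q d u K k i S) r := by
  have hqq := q_sub_inv_ne_zero hq hgen
  have hne : ∀ S, expandInf (eig q d u K k i S) 0 ≠ 0 := fun S =>
    left_ne_zero_of_mul_eq_one (expandInf_mul_expandZero hq hd hu hK i S)
  rw [fKplus]
  split_ifs with hr
  · rw [map_mul, freeRep_expCoeff, expCoeff_diagOp (c := normInf q d u K k i)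
      (fun S => div_self (hne S)), fK, freeRep_ι, genOp, ← map_mul]
    · congr 1
      funext S
      rw [Pi.mul_apply, normInf, mul_div_cancel₀ _ (hne S), Int.toNat_of_nonneg hr]
    · intro l
      rw [PowerSeries.coeff_mk, hPlus, PowerSeries.coeff_mk]
      split_ifs with hl
      · subst hl
        simp only [logCoeff_zero, map_zero]
        exact (map_zero (diagOp)).symm
      · rw [map_smul, fH, freeRep_ι, genOp, ← map_smul]
        congr 1
        funext S
        rw [Pi.smul_apply, if_pos (by omega), Int.toNat_natCast, smul_eq_mul,
          mul_inv_cancel_left₀ hqq]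
  · rw [map_zero]
    symm
    convert map_zero (diagOp) using 2
    funext S
    exact expandInf_eig_of_neg i S (by omega)

theorem freeRep_Kminus (hq : q ≠ 0) (hd : d ≠ 0) (hu : u ≠ 0) (hK : K ≠ 0)
    (hgen : GenericParameters q d) (i : ZMod n) (r : ℤ) :
    freeRep q d u K k (fKminus q i r) = diagOp fun S => expandZero (eig q d u K k i S) r := by
  have hqq := q_sub_inv_ne_zero hq hgen
  have hne : ∀ S, expandZero (eig q d u K k i S) 0 ≠ 0 := fun S =>
    right_ne_zero_of_mul_eq_one (expandInf_mul_expandZero hq hd hu hK i S)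
  rw [fKminus]
  split_ifs with hr
  · rw [map_mul, freeRep_expCoeff, expCoeff_diagOp (c := normZero q d u K k i)
      (fun S => by rw [normZero, Nat.cast_zero, neg_zero, div_self (hne S)]), fKinv, freeRep_ι,
      genOp, ← map_mul]
    · congr 1
      funext S
      rw [Pi.mul_apply, normZero, mul_div_cancel₀ _ (hne S), Int.toNat_of_nonneg (by omega),
        neg_neg]
    · intro l
      rw [PowerSeries.coeff_mk, hMinus, PowerSeries.coeff_mk]
      split_ifs with hl
      · subst hl
        simp only [logCoeff_zero, map_zero]
        exact (map_zero (diagOp)).symm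
      · rw [map_smul, fH, freeRep_ι, genOp, ← map_smul]
        congr 1
        funext S
        rw [Pi.smul_apply, if_neg (by omega), neg_neg, Int.toNat_natCast, smul_eq_mul,
          mul_inv_cancel_left₀ (neg_ne_zero.mpr hqq)]
  · rw [map_zero]
    symm
    convert map_zero (diagOp) using 2
    funext S
    exact expandZero_eig_of_pos hq hd hu i S (by omega)

theorem freeRep_serre (X : ZMod n → ℤ → FreeGen n) (Y : ZMod n → ℤ → Module.End ℂ Macmahon)
    (h : ∀ i m, freeRep q d u K k (X i m) = Y i m) (i j : ZMod n) (r₁ r₂ s : ℤ) :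
    freeRep q d u K k (serre q X i j r₁ r₂ s) = serreOp q Y i j r₁ r₂ s := by
  simp only [serre, serreOp, map_add, map_sub, map_mul, map_smul, h]

theorem freeRep_rel (hn : 3 ≤ n) (hq : q ≠ 0) (hd : d ≠ 0) (hu : u ≠ 0) (hK : K ≠ 0)
    (hgen : GenericParameters q d) {x y : FreeGen n} (h : Rel n q d x y) :
    freeRep q d u K k x = freeRep q d u K k y := by
  have hx := bx_ne_zero (q := q) (d := d) (u := u) hq hd hu
  have kp := freeRep_Kplus (k := k) hq hd hu hK hgen
  have km := freeRep_Kminus (k := k) hq hd hu hK hgen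
  have gE := isStructure_gE (k := k) hn hq hd hu
  have gF := isStructure_gF (k := k) hn hq hd hu
  have kpc : ∀ (i j : ZMod n) (r : ℤ) (S : Finset Box) (b : Box), b ∉ S → bcol k b = j →
      q ^ cartan i j * bx q d u b * expandInf (eig q d u K k i (insert b S)) r -
        d ^ mMat i j * expandInf (eig q d u K k i (insert b S)) (r + 1) =
      1 * bx q d u b * expandInf (eig q d u K k i S) r -
        d ^ mMat i j * q ^ cartan i j * expandInf (eig q d u K k i S) (r + 1) := by
    rintro i j r S b hb rfl
    rw [one_mul]
    exact expandInf_eig_insert hq hd hb i r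
  have kmc : ∀ (i j : ZMod n) (r : ℤ) (S : Finset Box) (b : Box), b ∉ S → bcol k b = j →
      q ^ cartan i j * bx q d u b * expandZero (eig q d u K k i (insert b S)) r -
        d ^ mMat i j * expandZero (eig q d u K k i (insert b S)) (r + 1) =
      1 * bx q d u b * expandZero (eig q d u K k i S) r -
        d ^ mMat i j * q ^ cartan i j * expandZero (eig q d u K k i S) (r + 1) := by
    rintro i j r S b hb rfl
    rw [one_mul]
    exact expandZero_eig_insert hq hd hb i r
  have kk : ∀ f g : Finset Box → ℂ, diagOp f * diagOp g = diagOp g * diagOp f := fun f g => by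
    rw [← map_mul, ← map_mul, mul_comm]
  have ef : ∀ i j r s, freeRep q d u K k (fE i r * fF j s - fF j s * fE i r) =
      if i = j then (q - q⁻¹)⁻¹ • diagOp fun S => expandInf (eig q d u K k i S) (r + s) -
        expandZero (eig q d u K k i S) (r + s) else 0 := by
    intro i j r s
    rw [map_sub, map_mul, map_mul, freeRep_E, freeRep_F]
    refine macmahon_hom_ext fun S hS => ?_
    have key := Up_Dn_commutator (bx q d u) (bcol k) (wE q d u k) (wF q d u k K) hx
      (fun T a b h1 h2 h3 h4 h5 h6 => wE_mul_wF_swap hn hq hd hu hgen K h1 h2 h3 h4 h5 h6) hS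
      i j r s
    rw [key]
    split_ifs
    · rw [LinearMap.smul_apply, diagOp_kv, eig,
        expand_sub_expand hn hq hd hu hgen K i hS, smul_smul,
        inv_mul_cancel_left₀ (q_sub_inv_ne_zero hq hgen)]
    · rfl
  cases h with
  | K_mul_Kinv i =>
    rw [map_mul, fK, fKinv, freeRep_ι, freeRep_ι, genOp, genOp, ← map_mul, map_one]
    convert map_one (diagOp) using 2
    funext S
    exact expandInf_mul_expandZero hq hd hu hK i S
  | Kinv_mul_K i =>
    rw [map_mul, fK, fKinv, freeRep_ι, freeRep_ι, genOp, genOp, kk, ← map_mul, map_one]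
    convert map_one (diagOp) using 2
    funext S
    exact expandInf_mul_expandZero hq hd hu hK i S
  | KpKp i j r s => rw [map_mul, map_mul, kp, kp, kk]
  | KmKm i j r s => rw [map_mul, map_mul, km, km, kk]
  | KmKp i j r s => rw [map_mul, map_mul, km, kp, kk]
  | KpE i j r s =>
    simp only [map_sub, map_smul, map_mul, kp, freeRep_E]
    have := diagOp_Up (bx q d u) (bcol k) (wE q d u k)
      (f := fun S => expandInf (eig q d u K k i S) r)
      (g := fun S => expandInf (eig q d u K k i S) (r + 1)) hx (kpc i j r) s
    rwa [one_smul] at this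
  | KmE i j r s =>
    simp only [map_sub, map_smul, map_mul, km, freeRep_E]
    have := diagOp_Up (bx q d u) (bcol k) (wE q d u k)
      (f := fun S => expandZero (eig q d u K k i S) r)
      (g := fun S => expandZero (eig q d u K k i S) (r + 1)) hx (kmc i j r) s
    rwa [one_smul] at this
  | KpF i j r s =>
    simp only [map_sub, map_smul, map_mul, kp, freeRep_F]
    have := diagOp_Dn (bx q d u) (bcol k) (wF q d u k K)
      (f := fun S => expandInf (eig q d u K k i S) r)
      (g := fun S => expandInf (eig q d u K k i S) (r + 1)) hx (kpc i j r) s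
    rwa [one_smul] at this
  | KmF i j r s =>
    simp only [map_sub, map_smul, map_mul, km, freeRep_F]
    have := diagOp_Dn (bx q d u) (bcol k) (wF q d u k K)
      (f := fun S => expandZero (eig q d u K k i S) r)
      (g := fun S => expandZero (eig q d u K k i S) (r + 1)) hx (kmc i j r) s
    rwa [one_smul] at this
  | EF_same i r s =>
    rw [ef, if_pos rfl, map_smul, map_sub, kp, km, ← map_sub]
    rfl
  | EF_diff i j h r s => rw [ef, if_neg h, map_zero]
  | EE i j r s =>
    simp only [map_sub, map_smul, map_mul, freeRep_E]
    have := Up_quadratic (bx q d u) (bcol k) (wE q d u k) (i := i) (j := j)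
      (α := d ^ mMat i j) (β := q ^ cartan i j) (γ := d ^ mMat i j * q ^ cartan i j) (δ := 1) hx
      (fun T a b h1 h2 h3 h4 h5 h6 h7 => by
        have := path_quadratic hn hq hd hu hgen (fun b =>
          leadAt (bx q d u b) (vacE q d u k (bcol k b) b)) gE h1 h2 h3 h4 h5
        rw [num, den, h6, h7] at this
        rw [one_mul]
        exact this) r s
    rwa [one_smul] at this
  | FF i j r s =>
    simp only [map_sub, map_smul, map_mul, freeRep_F]
    have := Dn_quadratic (bx q d u) (bcol k) (wF q d u k K) (i := i) (j := j)
      (α := d ^ mMat i j) (β := q ^ (-cartan i j)) (γ := d ^ mMat i j * q ^ (-cartan i j))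
      (δ := 1) hx
      (fun T a b h1 h2 h3 h4 h5 h6 h7 => by
        have := path_quadratic hn hq hd hu hgen (fun b =>
          levelAt q d u k K b * leadAt (bx q d u b) (vacF q d u k (bcol k b) b)) gF h1 h2 h3 h4 h5
        rw [num, den, h6, h7] at this
        -- Removing boxes reverses the order of the path, so this is the identity of
        -- `path_quadratic` divided by `q ^ cartan i j`.
        have hz := zpow_ne_zero (cartan i j) hq
        rw [zpow_neg, ← mul_right_inj' hz, one_mul]
        change _ * (_ * pathTwo (wt _ _) T a b) = _ * (_ * pathTwo (wt _ _) T b a)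
        field_simp
        linear_combination -this) r s
    rwa [one_smul] at this
  | serreE i j h r₁ r₂ s =>
    rw [map_add, map_zero, freeRep_serre _ _ freeRep_E, freeRep_serre _ _ freeRep_E]
    refine Up_serre (bx q d u) (bcol k) (wE q d u k) (fun T a b c h1 h2 h3 h4 h5 h6 h7 h8 h9 h10
      h11 => path_serre hn hq hd hu hgen _ gE h1 h2 h3 h4 h5 h6 h7 h8 (h9.trans h10.symm) ?_) _ _ _
    rw [h9, h11]
    exact h.imp id fun h => by rw [h]; ring
  | serreF i j h r₁ r₂ s =>
    rw [map_add, map_zero, freeRep_serre _ _ freeRep_F, freeRep_serre _ _ freeRep_F]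
    refine Dn_serre (bx q d u) (bcol k) (wF q d u k K) (fun T a b c h1 h2 h3 h4 h5 h6 h7 h8 h9 h10
      h11 => path_serre hn hq hd hu hgen _ gF h1 h2 h3 h4 h5 h6 h7 h8 (h9.trans h10.symm) ?_) _ _ _
    rw [h9, h11]
    exact h.imp id fun h => by rw [h]; ring
  | commE i j h r s =>
    rw [map_mul, map_mul, freeRep_E, freeRep_E]
    refine Up_comm _ _ _ (fun T a b h1 h2 h3 h4 h5 h6 h7 =>
      path_comm hn hq hd hu hgen _ gE h1 h2 h3 h4 h5 ?_ ?_ ?_) r s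
    · rw [h6, h7]; exact h.1
    · rw [h6, h7]; exact fun e => h.2.2 (by rw [e]; ring)
    · rw [h6, h7]; exact h.2.1
  | commF i j h r s =>
    rw [map_mul, map_mul, freeRep_F, freeRep_F]
    refine Dn_comm _ _ _ (fun T a b h1 h2 h3 h4 h5 h6 h7 =>
      path_comm hn hq hd hu hgen _ gF h1 h2 h3 h4 h5 ?_ ?_ ?_) r s
    · rw [h6, h7]; exact h.1
    · rw [h6, h7]; exact fun e => h.2.2 (by rw [e]; ring)
    · rw [h6, h7]; exact h.2.1

end Construction

/-! ## Existence and uniqueness of the module -/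

section Existence

open PlanePartition

variable {n : ℕ} {q d u K : ℂ} {k : ZMod n}

theorem Up_apply_of_insert (x : Box → ℂ) (col : Box → ZMod n) (w : Finset Box → Box → ℂ)
    {L M : PlanePartition} {b : Box} (hb : b ∉ L.boxes) (h : M.boxes = insert b L.boxes)
    (i : ZMod n) (m : ℤ) : Up x col w i m (ket L) M =
      if col b = i then x b ^ m * w L.boxes b else 0 := by
  classical
  have hba : b ∈ addable L.boxes := mem_addable.mpr ⟨hb, h ▸ M.low_boxes⟩
  rw [← kv_boxes, Up_kv x col w L.low_boxes, Finsupp.finsetSum_apply,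
    Finset.sum_eq_single_of_mem b hba]
  · split_ifs
    · rw [Finsupp.smul_apply, kv_apply, if_pos h.symm, smul_eq_mul, mul_one]
    · rfl
  · intro c hc hcb
    split_ifs
    · rw [Finsupp.smul_apply, kv_apply, if_neg, smul_zero]
      intro e
      rw [h] at e
      have : c ∈ insert b L.boxes := e ▸ Finset.mem_insert_self _ _
      rcases Finset.mem_insert.mp this with h1 | h1
      exacts [hcb h1, (mem_addable.mp hc).1 h1]
    · rfl

theorem Up_apply_eq_zero (x : Box → ℂ) (col : Box → ZMod n) (w : Finset Box → Box → ℂ)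
    {L M : PlanePartition} (i : ZMod n)
    (h : ∀ b, b ∉ L.boxes → M.boxes = insert b L.boxes → col b ≠ i) (m : ℤ) :
    Up x col w i m (ket L) M = 0 := by
  classical
  rw [← kv_boxes, Up_kv x col w L.low_boxes, Finsupp.finsetSum_apply]
  refine Finset.sum_eq_zero fun c hc => ?_
  split_ifs with hi
  · rw [Finsupp.smul_apply, kv_apply, if_neg, smul_zero]
    exact fun e => h c (mem_addable.mp hc).1 e.symm hi
  · rfl

theorem colorAt_iff {i : ZMod n} {L : PlanePartition} {p j : ℕ} :
    ColorAt k i L p j ↔ bcol k (p, j, L.row p j) = i := by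
  rw [ColorAt, bcol]
  constructor
  · intro h; linear_combination -h
  · intro h; linear_combination -h

theorem color_ne_of_not_exists {i : ZMod n} {L M : PlanePartition}
    (h : ¬ ∃ p j, L.AddBox M p j ∧ ColorAt k i L p j) (b : Box) (hb : b ∉ L.boxes)
    (hM : M.boxes = insert b L.boxes) : bcol k b ≠ i := by
  intro hc
  obtain ⟨h1, h2⟩ := addBox_of_boxes_eq hb hM
  refine h ⟨b.1, b.2.1, h1, colorAt_iff.mpr ?_⟩
  rw [h2]
  exact hc

theorem boxSupport_eq (L : PlanePartition) (p j : ℕ) :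
    boxSupport q d u L p j = bx q d u (p, j, L.row p j) := by
  rw [boxSupport, fockSupport, bx, xpos]; simp

variable (k K) in
/-- The Macmahon module. -/
def macmahonRep (hn : 3 ≤ n) (hq : q ≠ 0) (hd : d ≠ 0) (hu : u ≠ 0) (hK : K ≠ 0)
    (hgen : GenericParameters q d) : Toroidal n q d →ₐ[ℂ] Module.End ℂ Macmahon :=
  RingQuot.liftAlgHom ℂ ⟨freeRep q d u K k, fun _ _ h => freeRep_rel hn hq hd hu hK hgen h⟩

theorem macmahonRep_mk (hn : 3 ≤ n) (hq : q ≠ 0) (hd : d ≠ 0) (hu : u ≠ 0) (hK : K ≠ 0)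
    (hgen : GenericParameters q d) (x : FreeGen n) :
    macmahonRep K k hn hq hd hu hK hgen (mk n q d x) = freeRep q d u K k x :=
  RingQuot.liftAlgHom_mkAlgHom_apply _ _ _ _

theorem isMacmahonAction_macmahonRep (hn : 3 ≤ n) (hq : q ≠ 0) (hd : d ≠ 0) (hu : u ≠ 0)
    (hK : K ≠ 0) (hgen : GenericParameters q d) :
    IsMacmahonAction k u K (macmahonRep K k hn hq hd hu hK hgen) where
  Kplus i m L r hr := by
    rw [macmahonRep_mk, freeRep_Kplus hq hd hu hK hgen, ← kv_boxes, diagOp_kv,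
      macK_eq hn hq hd K i L hr, eig]
  Kminus i m L r hr := by
    rw [macmahonRep_mk, freeRep_Kminus hq hd hu hK hgen, ← kv_boxes, diagOp_kv,
      macK_eq hn hq hd K i L hr, eig]
  E i m L M p j h hc := by
    obtain ⟨h1, h2⟩ := h.boxes_eq
    rw [colorAt_iff] at hc
    rw [macmahonRep_mk, freeRep_E, Up_apply_of_insert _ _ _ h2 h1, if_pos hc, boxSupport_eq,
      ← (macE_eq hn hq hd hu hgen h rfl).1, hc]
  E_zero i m L M h := by
    rw [macmahonRep_mk, freeRep_E]
    exact Up_apply_eq_zero _ _ _ i (color_ne_of_not_exists h) m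
  F i m L M p j r h hc hr := by
    obtain ⟨h1, h2⟩ := h.boxes_eq
    rw [colorAt_iff] at hc
    rw [macmahonRep_mk, freeRep_F, ← adj_Up_Dn, Up_apply_of_insert _ _ _ h2 h1, if_pos hc,
      boxSupport_eq, ← (macF_eq hn hq hd hu hgen K h hr rfl).1, hc]
  F_zero i m L M h := by
    rw [macmahonRep_mk, freeRep_F, ← adj_Up_Dn]
    exact Up_apply_eq_zero _ _ _ i (color_ne_of_not_exists h) m

theorem fKplus_zero (i : ZMod n) : fKplus q i 0 = fK i := by
  rw [fKplus, if_pos le_rfl, Int.toNat_zero, expCoeff_zero, mul_one]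

theorem fKminus_zero (i : ZMod n) : fKminus q i 0 = fKinv i := by
  rw [fKminus, if_pos le_rfl, neg_zero, Int.toNat_zero, expCoeff_zero, mul_one]

theorem end_ext {X Y : Module.End ℂ Macmahon} (h : ∀ L, X (ket L) = Y (ket L)) : X = Y :=
  Finsupp.lhom_ext' fun L => LinearMap.ext_ring (h L)

/-- The leading factor is cancelled by its left inverse `b`, and the logarithm is unique. -/
theorem eq_of_mul_expCoeff_eq {V : Type*} [AddCommGroup V] [Module ℂ V]
    {f g : FreeGen n →ₐ[ℂ] Module.End ℂ V} {a b : FreeGen n} (hf : f (b * a) = 1)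
    (hfg : f a = g a) {X : PowerSeries (FreeGen n)} (hX : PowerSeries.coeff 0 X = 0)
    (h : ∀ m, f (a * expCoeff X m) = g (a * expCoeff X m)) (l : ℕ) :
    f (PowerSeries.coeff l X) = g (PowerSeries.coeff l X) := by
  have key : (PowerSeries.mk fun l => f (PowerSeries.coeff l X)) =
      PowerSeries.mk fun l => g (PowerSeries.coeff l X) := by
    refine eq_of_expCoeff_eq (by simp [hX]) (by simp [hX]) fun m => ?_
    have h1 := h m
    rw [map_mul, map_mul, freeGen_expCoeff, freeGen_expCoeff, ← hfg] at h1
    have h2 := congrArg (f b * ·) h1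
    simp only [← mul_assoc] at h2
    rwa [← map_mul, hf, one_mul, one_mul] at h2
  simpa using congrArg (PowerSeries.coeff l) key

/-- `E` and `F` are prescribed by matrix elements, `K_i^{±1}` are the zero modes of the prescribed
series, and the `H_{i,l}` are recovered from them as logarithms. -/
theorem isMacmahonAction_unique (hq : q ≠ 0) (hgen : GenericParameters q d)
    {ρ ρ' : Toroidal n q d →ₐ[ℂ] Module.End ℂ Macmahon}
    (h : IsMacmahonAction k u K ρ) (h' : IsMacmahonAction k u K ρ') : ρ = ρ' := by
  have hqq := q_sub_inv_ne_zero hq hgen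
  have kp : ∀ i m, ρ (mk n q d (fKplus q i m)) = ρ' (mk n q d (fKplus q i m)) := fun i m =>
    end_ext fun L => by
      obtain ⟨r, hr⟩ := exists_hasLayers L
      rw [h.Kplus i m L r hr, h'.Kplus i m L r hr]
  have km : ∀ i m, ρ (mk n q d (fKminus q i m)) = ρ' (mk n q d (fKminus q i m)) := fun i m =>
    end_ext fun L => by
      obtain ⟨r, hr⟩ := exists_hasLayers L
      rw [h.Kminus i m L r hr, h'.Kminus i m L r hr]
  have hK : ∀ i, ρ (mk n q d (fK i)) = ρ' (mk n q d (fK i)) := fun i => by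
    rw [← fKplus_zero (q := q)]; exact kp i 0
  have hKinv : ∀ i, ρ (mk n q d (fKinv i)) = ρ' (mk n q d (fKinv i)) := fun i => by
    rw [← fKminus_zero (q := q)]; exact km i 0
  have inv1 : ∀ i, ρ (mk n q d (fKinv i * fK i)) = 1 := fun i => by
    rw [mk, RingQuot.mkAlgHom_rel ℂ (Rel.Kinv_mul_K i), map_one, map_one]
  have inv2 : ∀ i, ρ (mk n q d (fK i * fKinv i)) = 1 := fun i => by
    rw [mk, RingQuot.mkAlgHom_rel ℂ (Rel.K_mul_Kinv i), map_one, map_one]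
  refine RingQuot.ringQuot_ext' _ _ _ (FreeAlgebra.hom_ext (funext fun g => ?_))
  change ρ (mk n q d (FreeAlgebra.ι ℂ g)) = ρ' (mk n q d (FreeAlgebra.ι ℂ g))
  cases g with
  | E i m =>
    refine end_ext fun L => Finsupp.ext fun M => ?_
    by_cases hM : ∃ p j, L.AddBox M p j ∧ ColorAt k i L p j
    · obtain ⟨p, j, h1, h2⟩ := hM
      exact (h.E i m L M p j h1 h2).trans (h'.E i m L M p j h1 h2).symm
    · exact (h.E_zero i m L M hM).trans (h'.E_zero i m L M hM).symm
  | F i m =>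
    refine end_ext fun M => Finsupp.ext fun L => ?_
    by_cases hM : ∃ p j, L.AddBox M p j ∧ ColorAt k i L p j
    · obtain ⟨p, j, h1, h2⟩ := hM
      obtain ⟨r, hr⟩ := exists_hasLayers M
      exact (h.F i m L M p j r h1 h2 hr).trans (h'.F i m L M p j r h1 h2 hr).symm
    · exact (h.F_zero i m L M hM).trans (h'.F_zero i m L M hM).symm
  | K i => exact hK i
  | Kinv i => exact hKinv i
  | H i l hl =>
    rcases lt_or_gt_of_ne hl with hneg | hpos
    · obtain ⟨m, rfl⟩ : ∃ m : ℕ, l = -(m : ℤ) := ⟨(-l).toNat, by omega⟩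
      have hm : m ≠ 0 := by omega
      have := eq_of_mul_expCoeff_eq (f := ρ.comp (mk n q d)) (g := ρ'.comp (mk n q d))
        (inv2 i) (hKinv i) (X := hMinus q i) (by simp [hMinus])
        (fun r => by
          have := km i (-r)
          rw [fKminus, if_pos (by omega), neg_neg, Int.toNat_natCast] at this
          exact this) m
      rw [hMinus, PowerSeries.coeff_mk, dif_neg hm, map_smul, map_smul] at this
      exact (smul_right_injective _ (neg_ne_zero.mpr hqq)) this
    · obtain ⟨m, rfl⟩ : ∃ m : ℕ, l = (m : ℤ) := ⟨l.toNat, by omega⟩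
      have hm : m ≠ 0 := by omega
      have := eq_of_mul_expCoeff_eq (f := ρ.comp (mk n q d)) (g := ρ'.comp (mk n q d))
        (inv1 i) (hK i) (X := hPlus q i) (by simp [hPlus])
        (fun r => by
          have := kp i r
          rw [fKplus, if_pos (by omega), Int.toNat_natCast] at this
          exact this) m
      rw [hPlus, PowerSeries.coeff_mk, dif_neg hm, map_smul, map_smul] at this
      exact (smul_right_injective _ hqq) this

end Existence

/-! ## The joint spectrum of the currents `K_i(z)` is simple -/

section Spectrum

open PlanePartition

variable {n : ℕ} {q d u K : ℂ} {k : ZMod n}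

theorem levelFactor_ne_zero (hK : K ≠ 0) (i : ZMod n) : levelFactor u k K i ≠ 0 := by
  rw [levelFactor]
  split_ifs
  · intro h
    have h1 := ((isRegular_infHom_C K⁻¹).sub
      ((isRegular_infHom_C (K * u)).mul isRegular_infHom_inv_X)).coeff.2
    rw [← div_eq_mul_inv, h, map_zero, HahnSeries.coeff_zero, mul_zero, sub_zero] at h1
    exact inv_ne_zero hK h1.symm
  · exact one_ne_zero

theorem ordAt_prod_lin {x : ℂ} (hx : x ≠ 0) (A : Multiset ℂ) :
    (A.map lin).prod ≠ 0 ∧ ordAt x (A.map lin).prod = A.count x := by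
  induction A using Multiset.induction_on with
  | empty => simp [ordAt_one]
  | cons a A ih =>
    rw [Multiset.map_cons, Multiset.prod_cons, ordAt_mul _ (lin_ne_zero _) ih.1, ih.2,
      ordAt_lin hx, Multiset.count_cons]
    refine ⟨mul_ne_zero (lin_ne_zero _) ih.1, ?_⟩
    by_cases h : a = x
    · rw [if_pos h, if_pos h.symm]; push_cast; ring
    · rw [if_neg h, if_neg (Ne.symm h)]; push_cast; ring

theorem dpos_ne_zero (hq : q ≠ 0) (hd : d ≠ 0) (hu : u ≠ 0) (D : ℤ × ℤ) : dpos q d u D ≠ 0 :=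
  xpos_ne_zero hq hd hu _ _ _

theorem ordAt_Rhat (hn : 3 ≤ n) (hq : q ≠ 0) (hd : d ≠ 0) (hu : u ≠ 0)
    (hgen : GenericParameters q d) (S : Finset Box) (a b : ℤ) :
    ordAt (dpos q d u (a, b)) (Rhat q d u k (dcol k (a, b)) S) = diagOrd S a b := by
  have hx := dpos_ne_zero (u := u) hq hd hu (a, b)
  obtain ⟨c, hc, h⟩ := Rhat_eq_zeros_div_poles (d := d) (u := u) (k := k) hq (dcol k (a, b)) S
  obtain ⟨z1, z2⟩ := ordAt_prod_lin hx (zerosOf q d u k (dcol k (a, b)) S)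
  obtain ⟨p1, p2⟩ := ordAt_prod_lin hx (polesOf q d u k (dcol k (a, b)) S)
  rw [h, div_eq_mul_inv, ordAt_mul _ (C_ne_zero hc) (mul_ne_zero z1 (inv_ne_zero p1)),
    ordAt_mul _ z1 (inv_ne_zero p1), ordAt_C, ordAt_inv, z2, p2,
    ← count_sub_count hn hq hd hu hgen rfl]
  ring

theorem diagCount_eq_of_diagOrd_eq {S S' : Finset Box}
    (h : ∀ a b, diagOrd S a b = diagOrd S' a b) (D : ℤ × ℤ) :
    diagCount S D = diagCount S' D := by
  by_contra hD
  set A := ((S ∪ S').image diag).filter fun D => diagCount S D ≠ diagCount S' D with hA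
  have hmem : ∀ D, diagCount S D ≠ diagCount S' D → D ∈ A := by
    intro D hD
    refine Finset.mem_filter.mpr ⟨?_, hD⟩
    by_contra hn
    rw [Finset.mem_image] at hn
    push Not at hn
    apply hD
    rw [diagCount, diagCount, Finset.filter_eq_empty_iff.mpr, Finset.filter_eq_empty_iff.mpr]
    · exact fun b hb => hn b (Finset.mem_union_right _ hb)
    · exact fun b hb => hn b (Finset.mem_union_left _ hb)
  obtain ⟨⟨a, b⟩, h1, h2⟩ := A.exists_max_image (fun D => D.1 + D.2) ⟨D, hmem D hD⟩
  have hz : ∀ a' b', a + b < a' + b' → diagCount S (a', b') = diagCount S' (a', b') := by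
    intro a' b' hlt
    by_contra hne
    exact absurd (h2 _ (hmem _ hne)) (not_le.mpr hlt)
  -- The diagonal `(a, b)` maximizes `a + b` among those with different counts. In `diagOrd` at `(a
  -- + 1, b + 1)` all other diagonals have a larger sum, so only the count at `(a, b)` can differ.
  have h3 := h (a + 1) (b + 1)
  rw [diagOrd_eq, diagOrd_eq, add_sub_cancel_right, add_sub_cancel_right, hz _ (b + 1 + 1) (by omega),
    hz (a + 1 + 1) (b + 1) (by omega), hz (a + 1) b (by omega), hz a (b + 1) (by omega),
    hz (a + 1 + 1) (b + 1 + 1) (by omega)] at h3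
  exact (Finset.mem_filter.mp h1).2 (by omega)

theorem eq_of_diagCount_eq {S S' : Finset Box} (hS : Low S) (hS' : Low S')
    (h : ∀ D, diagCount S D = diagCount S' D) : S = S' := by
  ext ⟨p, j, y⟩
  have key : ∀ T : Finset Box, Low T →
      ((p, j, y) ∈ T ↔ (p : ℤ) < height T ((y : ℤ) - p) ((j : ℤ) - p)) := by
    intro T hT
    rw [lt_height_iff hT, ← inExt_natCast (S := T) (p, j, y)]
    simp only [add_sub_cancel]
  rw [key S hS, key S' hS', height, height, h]

/-- An eigenvalue is determined by its expansion at infinity. After division by the nonzero level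
factor its orders give all `diagOrd`, hence all diagonal counts, hence the set. -/
theorem exists_eig_ne (hn : 3 ≤ n) (hq : q ≠ 0) (hd : d ≠ 0) (hu : u ≠ 0) (hK : K ≠ 0)
    (hgen : GenericParameters q d) {S S' : Finset Box} (hS : Low S) (hS' : Low S') (h : S ≠ S') :
    ∃ (i : ZMod n) (r : ℤ), expandInf (eig q d u K k i S) r ≠ expandInf (eig q d u K k i S') r := by
  by_contra! hall
  refine h (eq_of_diagCount_eq hS hS' (diagCount_eq_of_diagOrd_eq fun a b => ?_))
  have h1 := expandInf_injective (hall (dcol k (a, b)))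
  have h2 := mul_left_cancel₀ (levelFactor_ne_zero hK _) h1
  rw [← ordAt_Rhat (k := k) hn hq hd hu hgen S, h2, ordAt_Rhat hn hq hd hu hgen]

end Spectrum

/-! ## Structure of the module -/

section Structure

open PlanePartition

variable {n : ℕ} {q d u K : ℂ} {k : ZMod n}

theorem diagOp_apply (f : Finset Box → ℂ) (v : Macmahon) (L : PlanePartition) :
    diagOp f v L = f L.boxes * v L := by
  classical
  rw [apply_apply_eq_sum]
  simp only [← kv_boxes, diagOp_kv, Finsupp.smul_apply, kv_apply, smul_eq_mul]
  rw [Finsupp.sum, Finset.sum_eq_single L]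
  · rw [if_pos rfl]; ring
  · intro P _ hP
    rw [if_neg fun e => hP (boxes_injective e), mul_zero, mul_zero]
  · intro h
    rw [Finsupp.notMem_support_iff.mp h, zero_mul]

theorem exists_removable {S : Finset Box} (hS : Low S) (hne : S.Nonempty) :
    ∃ b ∈ S, Low (S.erase b) := by
  obtain ⟨b, hb⟩ := S.exists_maximal hne
  refine ⟨b, hb.1, fun c hc e he => Finset.mem_erase.mpr ⟨?_, hS c (Finset.mem_of_mem_erase hc) e he⟩⟩
  rintro rfl
  exact Finset.ne_of_mem_erase hc (le_antisymm (hb.2 (Finset.mem_of_mem_erase hc) he) he)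

variable (hn : 3 ≤ n) (hq : q ≠ 0) (hd : d ≠ 0) (hu : u ≠ 0) (hK : K ≠ 0)
  (hgen : GenericParameters q d)

theorem levelAt_ne_zero (hq : q ≠ 0) (hd : d ≠ 0) (hu : u ≠ 0) (hK : K ≠ 0)
    (hlev : GenericLevel n q d K) (b : Box) : levelAt q d u k K b ≠ 0 := by
  rw [levelAt]
  split_ifs with hb
  · intro h
    have hx := bx_ne_zero hq hd hu b
    obtain ⟨p, j, y⟩ := b
    have hc : ((j + 1 : ℕ) : ZMod n) = ((y + 1 : ℕ) : ZMod n) := by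
      simp only [bcol] at hb
      push_cast
      linear_combination hb
    -- Counting coordinates from one instead of zero multiplies the position by `q₃ q₁ q₂ = 1`.
    refine hlev (j + 1) (y + 1) (p + 1) (by omega) (by omega) (by omega) hc ?_
    have h1 : K ^ 2 * u = bx q d u (p, j, y) := by
      field_simp at h
      linear_combination -h
    rw [bx, xpos] at h1
    simp only [zpow_natCast] at h1
    have h2 := q1_mul_q2_mul_q3 hq hd
    refine mul_right_cancel₀ hu ?_
    rw [h1, pow_succ, pow_succ, pow_succ]
    linear_combination -(q1 q d ^ y * q3 q d ^ j * q2 q ^ p * u) * h2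
  · exact one_ne_zero

/-- An invariant subspace contains the components of its elements. -/
theorem ket_mem_of_apply_ne_zero {W : Submodule ℂ Macmahon}
    (hW : ∀ x, ∀ v ∈ W, macmahonRep K k hn hq hd hu hK hgen x v ∈ W) {v : Macmahon} (hv : v ∈ W)
    {L : PlanePartition} (hL : v L ≠ 0) : ket L ∈ W := by
  classical
  induction hc : v.support.card using Nat.strong_induction_on generalizing v with
  | _ c ih =>
    by_cases hs : ∃ L', v L' ≠ 0 ∧ L' ≠ L
    · obtain ⟨L', hL', hne⟩ := hs
      obtain ⟨i, r, hir⟩ := exists_eig_ne (k := k) hn hq hd hu hK hgen L.low_boxes L'.low_boxes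
        (fun e => hne (boxes_injective e.symm))
      set f : Finset Box → ℂ := fun S => expandInf (eig q d u K k i S) r with hf
      have h1 : diagOp f v ∈ W := by
        have := hW (mk n q d (fKplus q i r)) v hv
        rwa [macmahonRep_mk, freeRep_Kplus hq hd hu hK hgen] at this
      -- This combination kills the component at `L'` and keeps a nonzero one at `L`, so the support
      -- shrinks.
      have h2 : diagOp f v - f L'.boxes • v ∈ W := W.sub_mem h1 (W.smul_mem _ hv)
      have h3 : ∀ P, (diagOp f v - f L'.boxes • v) P = (f P.boxes - f L'.boxes) * v P := by
        intro P
        rw [Finsupp.sub_apply, diagOp_apply, Finsupp.smul_apply, smul_eq_mul, sub_mul]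
      refine ih _ ?_ h2 ?_ rfl
      · rw [← hc]
        refine Finset.card_lt_card ((Finset.ssubset_iff_of_subset ?_).mpr ⟨L', ?_, ?_⟩)
        · intro P hP
          rw [Finsupp.mem_support_iff, h3] at hP
          exact Finsupp.mem_support_iff.mpr (right_ne_zero_of_mul hP)
        · exact Finsupp.mem_support_iff.mpr hL'
        · rw [Finsupp.mem_support_iff, h3, sub_self, zero_mul, not_not]
      · rw [h3]
        exact mul_ne_zero (sub_ne_zero.mpr hir) hL
    · push Not at hs
      have : v = v L • ket L := by
        ext P
        rw [Finsupp.smul_apply, ket, smul_eq_mul, Finsupp.single_apply]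
        split_ifs with h
        · rw [h, mul_one]
        · rw [mul_zero]
          by_contra h0
          exact h (hs P h0).symm
      rw [this] at hv
      exact (W.smul_mem_iff hL).mp hv

/-- The zero mode of `E` has a nonzero entry upwards and that of `F` a nonzero entry downwards; the
wanted component is then extracted by simplicity of the spectrum. Genericity of `K` matters only
downwards. -/
theorem kv_erase_mem_iff (hlev : GenericLevel n q d K) {W : Submodule ℂ Macmahon}
    (hW : ∀ x, ∀ v ∈ W, macmahonRep K k hn hq hd hu hK hgen x v ∈ W) {S : Finset Box} {b : Box}
    (hS : Low S) (hb : b ∈ S) (hSb : Low (S.erase b)) : kv (S.erase b) ∈ W ↔ kv S ∈ W := by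
  obtain ⟨L, hL⟩ : ∃ L : PlanePartition, L.boxes = S.erase b := ⟨_, boxes_ofLow hSb⟩
  obtain ⟨M, hM⟩ : ∃ M : PlanePartition, M.boxes = S := ⟨_, boxes_ofLow hS⟩
  have hLM : M.boxes = insert b L.boxes := by rw [hL, hM, Finset.insert_erase hb]
  have hbL : b ∉ L.boxes := by rw [hL]; exact Finset.notMem_erase _ _
  rw [← hL, ← hM, kv_boxes, kv_boxes]
  constructor
  · intro h
    have h1 := hW (mk n q d (fE (bcol k b) 0)) _ h
    rw [macmahonRep_mk, freeRep_E] at h1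
    refine ket_mem_of_apply_ne_zero hn hq hd hu hK hgen hW h1 ?_
    rw [Up_apply_of_insert _ _ _ hbL hLM, if_pos rfl, zpow_zero, one_mul]
    exact wE_ne_zero hq _ _
  · intro h
    have h1 := hW (mk n q d (fF (bcol k b) 0)) _ h
    rw [macmahonRep_mk, freeRep_F] at h1
    refine ket_mem_of_apply_ne_zero hn hq hd hu hK hgen hW h1 ?_
    rw [← adj_Up_Dn, Up_apply_of_insert _ _ _ hbL hLM, if_pos rfl, zpow_zero, one_mul]
    exact wF_ne_zero hq (levelAt_ne_zero hq hd hu hK hlev b) _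

theorem kv_mem_iff (hlev : GenericLevel n q d K) {W : Submodule ℂ Macmahon}
    (hW : ∀ x, ∀ v ∈ W, macmahonRep K k hn hq hd hu hK hgen x v ∈ W) {S : Finset Box}
    (hS : Low S) : kv S ∈ W ↔ kv ∅ ∈ W := by
  induction hc : S.card generalizing S with
  | zero => rw [Finset.card_eq_zero.mp hc]
  | succ c ih =>
    obtain ⟨b, hb, hl⟩ := exists_removable hS (Finset.card_pos.mp (by omega))
    rw [← kv_erase_mem_iff hn hq hd hu hK hgen hlev hW hS hb hl,
      ih hl (by rw [Finset.card_erase_of_mem hb]; omega)]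

theorem span_ket : Submodule.span ℂ (Set.range ket) = ⊤ := by
  rw [eq_top_iff]
  intro v _
  rw [← Finsupp.sum_single v]
  refine Submodule.sum_mem _ fun L _ => ?_
  have : (Finsupp.single L (v L) : Macmahon) = v L • ket L := by simp [ket]
  rw [this]
  exact Submodule.smul_mem _ _ (Submodule.subset_span ⟨L, rfl⟩)

theorem eq_top_of_invariant (hlev : GenericLevel n q d K) {W : Submodule ℂ Macmahon}
    (hW : ∀ x, ∀ v ∈ W, macmahonRep K k hn hq hd hu hK hgen x v ∈ W) {v : Macmahon} (hv : v ∈ W)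
    (hv0 : v ≠ 0) : W = ⊤ := by
  obtain ⟨L, hL⟩ := Finsupp.ne_iff.mp hv0
  have h1 := ket_mem_of_apply_ne_zero hn hq hd hu hK hgen hW hv hL
  rw [← kv_boxes, kv_mem_iff hn hq hd hu hK hgen hlev hW L.low_boxes] at h1
  rw [eq_top_iff, ← span_ket, Submodule.span_le]
  rintro _ ⟨M, rfl⟩
  rw [SetLike.mem_coe, ← kv_boxes, kv_mem_iff hn hq hd hu hK hgen hlev hW M.low_boxes]
  exact h1

theorem range_eq_top (hlev : GenericLevel n q d K) {v : Macmahon} (hv : v ≠ 0) (y : Macmahon) :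
    ∃ x, macmahonRep K k hn hq hd hu hK hgen x v = y := by
  have := eq_top_of_invariant (k := k) hn hq hd hu hK hgen hlev
    (W := LinearMap.range ((LinearMap.applyₗ v).comp
      (macmahonRep K k hn hq hd hu hK hgen).toLinearMap)) (v := v) ?_ ?_ hv
  · have hy : y ∈ (⊤ : Submodule ℂ Macmahon) := Submodule.mem_top
    rw [← this] at hy
    exact hy
  · rintro x _ ⟨x', rfl⟩
    exact ⟨x * x', by simp⟩
  · exact ⟨1, by simp⟩

theorem isIrreducibleAction_macmahonRep (hlev : GenericLevel n q d K) :
    IsIrreducibleAction (macmahonRep K k hn hq hd hu hK hgen) := by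
  let := Module.compHom Macmahon (macmahonRep K k hn hq hd hu hK hgen).toRingHom
  change IsSimpleModule (Toroidal n q d) Macmahon
  rw [isSimpleModule_iff_toSpanSingleton_surjective]
  exact ⟨⟨⟨ket PlanePartition.empty, 0, by simp [ket]⟩⟩, fun v hv y => range_eq_top hn hq hd hu hK hgen hlev hv y⟩

theorem ket_mem_weightSpace (L : PlanePartition) :
    ket L ∈ weightSpace (macmahonRep K k hn hq hd hu hK hgen)
      (ratWeight fun i => eig q d u K k i L.boxes) := by
  simp only [weightSpace, Submodule.mem_iInf]
  intro i r
  rw [Submodule.mem_inf, Module.End.mem_eigenspace_iff, Module.End.mem_eigenspace_iff,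
    macmahonRep_mk, macmahonRep_mk, freeRep_Kplus hq hd hu hK hgen,
    freeRep_Kminus hq hd hu hK hgen, ← kv_boxes, diagOp_kv, diagOp_kv]
  exact ⟨rfl, rfl⟩

theorem rank_le_one_of_exists_le_span {V : Type*} [AddCommGroup V] [Module ℂ V]
    {W : Submodule ℂ V} (h : ∃ v, W ≤ Submodule.span ℂ {v}) : Module.rank ℂ W ≤ 1 :=
  (rank_submodule_le_one_iff' W).mpr h

theorem isTame_macmahonRep : IsTame (macmahonRep K k hn hq hd hu hK hgen) := by
  classical
  refine ⟨?_, fun φ => ?_⟩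
  · rw [IsWeighted, eq_top_iff, ← span_ket, Submodule.span_le]
    rintro _ ⟨L, rfl⟩
    exact (le_iSup (weightSpace (macmahonRep K k hn hq hd hu hK hgen)) _)
      (ket_mem_weightSpace hn hq hd hu hK hgen L)
  · apply rank_le_one_of_exists_le_span
    -- Every component of a weight vector has the eigenvalues `φ`, so by simplicity of the spectrum
    -- all vectors of the weight space are supported on one common basis vector.
    have key : ∀ v ∈ weightSpace (macmahonRep K k hn hq hd hu hK hgen) φ, ∀ L, v L ≠ 0 →
        ∀ i r, φ.1 i r = expandInf (eig q d u K k i L.boxes) r := by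
      intro v hv L hL i r
      simp only [weightSpace, Submodule.mem_iInf] at hv
      have h1 := (Submodule.mem_inf.mp (hv i r)).1
      rw [Module.End.mem_eigenspace_iff, macmahonRep_mk, freeRep_Kplus hq hd hu hK hgen] at h1
      have h2 := DFunLike.congr_fun h1 L
      rw [diagOp_apply, Finsupp.smul_apply, smul_eq_mul] at h2
      exact (mul_right_cancel₀ hL h2).symm
    by_cases h : ∃ v ∈ weightSpace (macmahonRep K k hn hq hd hu hK hgen) φ, v ≠ 0
    · obtain ⟨v, hv, hv0⟩ := h
      obtain ⟨L, hL⟩ := Finsupp.ne_iff.mp hv0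
      refine ⟨ket L, fun w hw => Submodule.mem_span_singleton.mpr ⟨w L, ?_⟩⟩
      ext P
      rw [Finsupp.smul_apply, ket, smul_eq_mul, Finsupp.single_apply]
      split_ifs with hP
      · rw [hP, mul_one]
      · rw [mul_zero]
        by_contra h0
        obtain ⟨i, r, hir⟩ := exists_eig_ne (k := k) hn hq hd hu hK hgen L.low_boxes P.low_boxes
          (fun e => hP (boxes_injective e))
        exact hir ((key v hv L hL i r).symm.trans (key w hw P (Ne.symm h0) i r))
    · push Not at h
      exact ⟨0, fun w hw => by rw [h w hw]; exact Submodule.zero_mem _⟩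

theorem eig_empty (i : ZMod n) : eig q d u K k i ∅ = macmahonWeight k u K i := by
  rw [eig, Rhat, Finset.prod_empty, mul_one, levelFactor, vac, macmahonWeight]
  split_ifs
  · exact (div_eq_mul_inv _ _).symm
  · exact one_mul 1

theorem isLowestWeightVector_macmahonRep (hlev : GenericLevel n q d K) :
    IsLowestWeightVector (macmahonRep K k hn hq hd hu hK hgen)
      (ratWeight (macmahonWeight k u K)) (ket PlanePartition.empty) := by
  refine ⟨fun i m => ?_, ?_, ?_⟩
  · rw [macmahonRep_mk, freeRep_F, ← kv_empty, Dn_kv _ _ _ low_empty, Finset.sum_empty]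
  · have := ket_mem_weightSpace (k := k) hn hq hd hu hK hgen PlanePartition.empty
    rw [boxes_empty] at this
    simpa only [eig_empty] using this
  · rw [eq_top_iff]
    intro y _
    have h0 : ket PlanePartition.empty ≠ 0 := by simp [ket]
    obtain ⟨x, hx⟩ := range_eq_top (k := k) hn hq hd hu hK hgen hlev h0 y
    exact Submodule.subset_span ⟨x, hx⟩

end Structure

/-! ## Grading and level -/

section Grading

open PlanePartition

variable {n : ℕ} {q d u K : ℂ} {k : ZMod n}

variable (k) in
/-- The number of boxes of color `i`. -/
def boxCount (S : Finset Box) (i : ZMod n) : ℤ := (S.filter fun b => bcol k b = i).card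

theorem colorCount_eq (L : PlanePartition) (i : ZMod n) :
    (colorCount k L i : ℤ) = boxCount k L.boxes i := by
  rw [colorCount, boxCount, ← Set.ncard_coe_finset]
  congr 2
  ext b
  rw [Finset.mem_coe, Finset.mem_filter, mem_boxes]
  rfl

theorem kv_mem_grading {S : Finset Box} {α : ZMod n → ℤ} (h : ∀ i, boxCount k S i = α i) :
    kv S ∈ macmahonGrading k α := by
  by_cases hS : Low S
  · refine Submodule.subset_span ⟨ofLow S hS, fun i => ?_, ?_⟩
    · rw [colorCount_eq, boxes_ofLow, h]
    · rw [← kv_boxes, boxes_ofLow]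
  · rw [kv_of_not_low hS]; exact Submodule.zero_mem _

theorem boxCount_insert {S : Finset Box} {b : Box} (hb : b ∉ S) (i : ZMod n) :
    boxCount k (insert b S) i = boxCount k S i + (Pi.single (bcol k b) 1 : ZMod n → ℤ) i := by
  rw [boxCount, boxCount, Finset.filter_insert]
  by_cases h : bcol k b = i
  · subst h
    rw [if_pos rfl, Finset.card_insert_of_notMem (fun h => hb (Finset.mem_filter.mp h).1),
      Pi.single_eq_same]
    push_cast; ring
  · rw [if_neg h, Pi.single_eq_of_ne (Ne.symm h), add_zero]

theorem macmahonGrading_eq (α : ZMod n → ℤ) : macmahonGrading k α =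
    Finsupp.supported ℂ ℂ {L : PlanePartition | ∀ i, (colorCount k L i : ℤ) = α i} := by
  rw [Finsupp.supported_eq_span_single, macmahonGrading]
  congr 1
  ext v
  constructor
  · rintro ⟨L, h1, rfl⟩; exact ⟨L, h1, rfl⟩
  · rintro ⟨L, h1, rfl⟩; exact ⟨L, h1, rfl⟩

theorem iSupIndep_macmahonGrading : iSupIndep (macmahonGrading k) := by
  intro α
  have hle : (⨆ β, ⨆ (_ : β ≠ α), macmahonGrading k β) ≤
      Finsupp.supported ℂ ℂ {L : PlanePartition | ∀ i, (colorCount k L i : ℤ) = α i}ᶜ := by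
    refine iSup₂_le fun β hβ => ?_
    rw [macmahonGrading_eq]
    refine Finsupp.supported_mono fun L hL hL' => hβ (funext fun i => ?_)
    rw [← hL i, hL' i]
  refine Disjoint.mono_right hle ?_
  rw [macmahonGrading_eq]
  exact Finsupp.disjoint_supported_supported disjoint_compl_right

theorem isGradedBy_macmahonRep (hn : 3 ≤ n) (hq : q ≠ 0) (hd : d ≠ 0) (hu : u ≠ 0) (hK : K ≠ 0)
    (hgen : GenericParameters q d) :
    IsGradedBy (macmahonRep K k hn hq hd hu hK hgen) (macmahonGrading k) := by
  refine ⟨iSupIndep_macmahonGrading, ?_, fun g α v hv => ?_⟩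
  · rw [eq_top_iff, ← span_ket, Submodule.span_le]
    rintro _ ⟨L, rfl⟩
    exact le_iSup (macmahonGrading k) (fun i => (colorCount k L i : ℤ))
      (Submodule.subset_span ⟨L, fun _ => rfl, rfl⟩)
  · rw [macmahonRep_mk, freeRep_ι]
    have hle : macmahonGrading k α ≤
        (macmahonGrading k (α + genDegree g)).comap (genOp q d u K k g) := by
      refine Submodule.span_le.mpr ?_
      rintro _ ⟨L, hL, rfl⟩
      rw [SetLike.mem_coe, Submodule.mem_comap, ← kv_boxes]
      have hL' : ∀ i, boxCount k L.boxes i = α i := fun i => by rw [← colorCount_eq, hL]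
      have hdiag : ∀ f : Finset Box → ℂ, diagOp f (kv L.boxes) ∈ macmahonGrading k (α + 0) := by
        intro f
        rw [diagOp_kv, add_zero]
        exact Submodule.smul_mem _ _ (kv_mem_grading hL')
      cases g with
      | E i m =>
        rw [genOp, Up_kv _ _ _ L.low_boxes]
        refine Submodule.sum_mem _ fun b hb => ?_
        split_ifs with hc
        · refine Submodule.smul_mem _ _ (kv_mem_grading fun j => ?_)
          rw [boxCount_insert (mem_addable.mp hb).1, hL', hc]
          rfl
        · exact Submodule.zero_mem _
      | F i m =>
        rw [genOp, Dn_kv _ _ _ L.low_boxes]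
        refine Submodule.sum_mem _ fun b hb => ?_
        split_ifs with hc
        · refine Submodule.smul_mem _ _ (kv_mem_grading fun j => ?_)
          have h1 := boxCount_insert (k := k) (Finset.notMem_erase b L.boxes) j
          rw [Finset.insert_erase hb, hL', hc] at h1
          rw [Pi.add_apply, genDegree, Pi.neg_apply]
          omega
        · exact Submodule.zero_mem _
      | H i l hl => exact hdiag _
      | K i => exact hdiag _
      | Kinv i => exact hdiag _
    exact hle hv

theorem prod_map_range_zmod [NeZero n] (f : ZMod n → ℂ) :
    ((List.range n).map fun j : ℕ => f (j : ZMod n)).prod = ∏ i, f i := by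
  rw [← List.prod_toFinset _ List.nodup_range, List.toFinset_range]
  refine Finset.prod_nbij' (fun j => (j : ZMod n)) ZMod.val ?_ ?_ ?_ ?_ ?_
  · simp
  · exact fun i _ => Finset.mem_range.mpr (ZMod.val_lt i)
  · exact fun j hj => ZMod.val_cast_of_lt (Finset.mem_range.mp hj)
  · exact fun i _ => ZMod.natCast_zmod_val i
  · simp

/-- For `n ≥ 3` the colors `c - 1`, `c`, `c + 1` are distinct and contribute `-1 + 2 - 1`. Hence
boxes do not change the eigenvalue of `∏ K_i⁻¹`. -/
theorem sum_cartan [NeZero n] (hn : 3 ≤ n) (c : ZMod n) : ∑ i : ZMod n, cartan i c = 0 := by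
  have key : ∀ i : ZMod n, cartan i c = ((if i = c then 2 else 0) +
      (if i = c - 1 then -1 else 0)) + (if i = c + 1 then -1 else 0) := by
    intro i
    have h1 : c = i + 1 ↔ i = c - 1 := ⟨fun h => by rw [h]; ring, fun h => by rw [h]; ring⟩
    have n1 := zmod_ne_add_one hn (c - 1)
    have n2 := zmod_ne_add_one hn c
    have n3 := zmod_ne_add_two hn (c - 1)
    rw [sub_add_cancel] at n1 n3
    simp only [cartan, h1]
    by_cases e1 : i = c
    · subst e1; simp [n1.symm, n2]
    by_cases e2 : i = c - 1
    · subst e2; simp [n1, n3]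
    by_cases e3 : i = c + 1
    · subst e3; simp [n2.symm, n3.symm]
    simp [e1, e2, e3]
  simp only [key, Finset.sum_add_distrib, Finset.sum_ite_eq', Finset.mem_univ, if_true]
  norm_num

theorem prod_zpow_eq_zpow_sum {ι : Type*} (hq : q ≠ 0) (s : Finset ι) (f : ι → ℤ) :
    ∏ i ∈ s, q ^ f i = q ^ ∑ i ∈ s, f i := by
  classical
  induction s using Finset.induction_on with
  | empty => simp
  | insert a s ha ih => rw [Finset.prod_insert ha, Finset.sum_insert ha, zpow_add₀ hq, ih]

theorem hasLevel_macmahonRep (hn : 3 ≤ n) (hq : q ≠ 0) (hd : d ≠ 0) (hu : u ≠ 0) (hK : K ≠ 0)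
    (hgen : GenericParameters q d) : HasLevel (macmahonRep K k hn hq hd hu hK hgen) K := by
  have : NeZero n := ⟨by omega⟩
  have h1 : macmahonRep K k hn hq hd hu hK hgen (kappaInv n q d) =
      diagOp ((List.range n).map fun j : ℕ => fun S =>
        expandZero (eig q d u K k (j : ZMod n) S) 0).prod := by
    rw [kappaInv, map_list_prod, map_list_prod, List.map_map, List.map_map]
    congr 1
    refine List.map_congr_left fun j _ => ?_
    simp only [Function.comp]
    rw [macmahonRep_mk, fKinv, freeRep_ι, genOp]
  have h2 : ((List.range n).map fun j : ℕ => fun S =>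
      expandZero (eig q d u K k (j : ZMod n) S) 0).prod = fun _ => K := by
    funext S
    refine (map_list_prod (Pi.evalRingHom (fun _ : Finset Box => ℂ) S) _).trans ?_
    rw [List.map_map]
    simp only [Function.comp_def, Pi.evalRingHom_apply]
    rw [prod_map_range_zmod fun i => expandZero (eig q d u K k i S) 0]
    simp only [expandZero_eig_zero hq hd hu, Finset.prod_mul_distrib]
    rw [Finset.prod_comm, Finset.prod_ite_eq', if_pos (Finset.mem_univ _), Finset.prod_eq_one,
      mul_one]
    intro b _
    rw [prod_zpow_eq_zpow_sum hq, Finset.sum_neg_distrib, sum_cartan hn, neg_zero, zpow_zero]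
  intro v
  rw [h1, h2]
  ext L
  rw [diagOp_apply, Finsupp.smul_apply, smul_eq_mul]

end Grading

end QuantumToroidal

end

/-! ### The Macmahon module -/

open QuantumToroidal in
theorem theoremM (n : ℕ) (hn : 3 ≤ n) (q d : ℂ) (hq : q ≠ 0) (hd : d ≠ 0)
    (hgen : GenericParameters q d) (k : ZMod n) (u K : ℂ) (hu : u ≠ 0) (hK : K ≠ 0) :
    (∃! ρ : Toroidal n q d →ₐ[ℂ] Module.End ℂ Macmahon, IsMacmahonAction k u K ρ) ∧
    (GenericLevel n q d K →
      ∀ ρ : Toroidal n q d →ₐ[ℂ] Module.End ℂ Macmahon, IsMacmahonAction k u K ρ →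
        IsIrreducibleAction ρ ∧
        IsTame ρ ∧
        IsLowestWeightVector ρ (ratWeight (macmahonWeight k u K)) (ket PlanePartition.empty) ∧
        IsGradedBy ρ (macmahonGrading k) ∧
        HasLevel ρ K) := by
  refine ⟨⟨macmahonRep K k hn hq hd hu hK hgen, isMacmahonAction_macmahonRep hn hq hd hu hK hgen,
    fun ρ h => isMacmahonAction_unique hq hgen h
      (isMacmahonAction_macmahonRep hn hq hd hu hK hgen)⟩, fun hlev ρ hρ => ?_⟩
  obtain rfl := isMacmahonAction_unique hq hgen hρ
    (isMacmahonAction_macmahonRep hn hq hd hu hK hgen)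
  exact ⟨isIrreducibleAction_macmahonRep hn hq hd hu hK hgen hlev,
    isTame_macmahonRep hn hq hd hu hK hgen,
    isLowestWeightVector_macmahonRep hn hq hd hu hK hgen hlev,
    isGradedBy_macmahonRep hn hq hd hu hK hgen,
    hasLevel_macmahonRep hn hq hd hu hK hgen⟩
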